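/- **Theorem (Freudenthal suspension theorem, in homotopy type theory).** Work in homotopy type theory: intensional Martin-Löf type theory with a cumulative hierarchy of universes $\mathcal U_0 : \mathcal U_1 : \cdots$, dependent function types (with judgmental $\beta$ and $\eta$), the inductive types $\mathbb 0$, $\mathbb 1$, $A+B$, $\mathbb N$, $\sum_{x:A}B(x)$, identity types $a=_A b$ with path induction, the univalence axiom for each universe, and the following higher inductive types, whose induction principles compute judgmentally on point constructors and up to a path on path constructors: * the pushout $A\sqcup^{C}B$ of $f:C\to A$ and $g:C\to B$, generated by $\mathtt{inl}:A\to A\sqcup^CB$, $\mathtt{inr}:B\to A\sqcup^CB$ and $\mathtt{glue}:(c:C)\to \mathtt{inl}(f(c))=\mathtt{inr}(g(c))$; * for $n\ge -1$, the $n$-truncation $\|A\|_n$, generated by $|-|_n:A\to\|A\|_n$, $h:(\mathbb S^{n+1}\to\|A\|_n)\to\|A\|_n$ and $s:(r:\mathbb S^{n+1}\to\|A\|_n)\to(x:\mathbb S^{n+1})\to r(x)=h(r)$. Here the suspension $\Sigma A$ is the pushout of $\mathbb 1\leftarrow A\to\mathbb 1$, with $\mathtt{north}:\equiv\mathtt{inl}(\star)$,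 $\mathtt{south}:\equiv\mathtt{inr}(\star)$ and $\mathtt{merid}(a):\equiv\mathtt{glue}(a):\mathtt{north}=\mathtt{south}$; the spheres are $\mathbb S^0:\equiv\mathbb 1+\mathbb 1$ and $\mathbb S^{k+1}:\equiv\Sigma\,\mathbb S^k$; and $\|A\|_{-2}:\equiv\mathbb 1$. A type $A$ is contractible if $\sum_{a:A}\prod_{x:A}(a=x)$ is inhabited, and $n$-connected if $\|A\|_n$ is contractible. A function $f:A\to B$ is $n$-connected if its fibre $\sum_{x:A}(f(x)=y)$ is $n$-connected for every $y:B$. Finally $\Omega(\Sigma A):\equiv(\mathtt{north}=_{\Sigma A}\mathtt{north})$. For every universe level $i$, the following is a theorem of this system, i.e. the closed type expressing it has a derivable closed term: for every integer $n\ge-1$ (quantified inside the theory), every $n$-connected type $C:\mathcal U_i$ and every $x_0:C$, the map $$\sigma: C\to\Omega(\Sigma C),\qquad \sigma(x):\equiv\mathtt{merid}(x)\cdot\mathtt{merid}(x_0)^{-1},$$ is $2n$-connected. -/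

import Mathlib

/-!
# Homotopy type theory as a formal system

Intensional Martin-Löf type theory with a cumulative hierarchy of Russell universes, dependent
functions, the inductive types `0`, `1`, `+`, `ℕ`, `Σ`, identity types, the univalence axiom, and
the higher inductive types "pushout" and "hub-and-spoke truncation": raw syntax, typing and
judgmental equality.  A theorem of homotopy type theory is a closed type that has a derivable
closed term.
-/

namespace HoTT

/-! ## Raw syntax -/

/-- The primitive constants.  They carry no universe levels: each one has its type (see
`constType`) at all levels. -/
inductive Const
  | empty | emptyInd
  | unit | star | unitInd
  | sum | inl | inr | sumInd
  | nat | zero | succ | natInd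
  | sigma | pair | sigmaInd
  | id | refl | pathInd
  | push | pushInl | pushInr | glue | pushInd | pushIndGlue
  | trunc | truncIn | hub | spoke | truncInd | truncIndSpoke
  | univalence
  deriving DecidableEq

/-- Raw terms; `var` is a de Bruijn index, and `pi A B`, `lam A b` bind index `0` in `B`, `b`. -/
inductive Tm
  | var (n : ℕ)
  | univ (i : ℕ)
  | pi (A B : Tm)
  | lam (A b : Tm)
  | app (f a : Tm)
  | const (c : Const)
  deriving DecidableEq

namespace Tm

/-- A renaming that is carried under a binder. -/
def liftRen (ρ : ℕ → ℕ) : ℕ → ℕ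
  | 0 => 0
  | n + 1 => ρ n + 1

/-- Renaming of the free variables. -/
def rename : Tm → (ℕ → ℕ) → Tm
  | var n, ρ => var (ρ n)
  | univ i, _ => univ i
  | pi A B, ρ => pi (A.rename ρ) (B.rename (liftRen ρ))
  | lam A b, ρ => lam (A.rename ρ) (b.rename (liftRen ρ))
  | app f a, ρ => app (f.rename ρ) (a.rename ρ)
  | const c, _ => const c

/-- A substitution that is carried under a binder. -/
def liftSub (σ : ℕ → Tm) : ℕ → Tm
  | 0 => var 0
  | n + 1 => (σ n).rename (· + 1)

/-- Simultaneous capture-avoiding substitution for the free variables. -/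
def subst : Tm → (ℕ → Tm) → Tm
  | var n, σ => σ n
  | univ i, _ => univ i
  | pi A B, σ => pi (A.subst σ) (B.subst (liftSub σ))
  | lam A b, σ => lam (A.subst σ) (b.subst (liftSub σ))
  | app f a, σ => app (f.subst σ) (a.subst σ)
  | const c, _ => const c

/-- The substitution `[a/0]`. -/
def single (a : Tm) : ℕ → Tm
  | 0 => a
  | n + 1 => var n

/-- `b.inst a` is `b[a/x]`, where `x` is the variable with index `0`. -/
def inst (b a : Tm) : Tm := b.subst (single a)

end Tm

/-! ## Writing terms with named variables

An `Exp` gives, for each number `d` of enclosing binders, the raw term that it denotes there.  The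
combinators `pi`, `lam` turn Lean-bound variables into de Bruijn indices. -/

/-- Terms as functions of the number of enclosing binders. -/
abbrev Exp := ℕ → Tm

namespace Exp

/-- The variable bound by a binder that itself stands under `d` binders. -/
def bound (d : ℕ) : Exp := fun d' => .var (d' - (d + 1))

/-- `(x : A) → B x` -/
def pi (A : Exp) (B : Exp → Exp) : Exp := fun d => .pi (A d) (B (bound d) (d + 1))

/-- `λ (x : A). b x` -/
def lam (A : Exp) (b : Exp → Exp) : Exp := fun d => .lam (A d) (b (bound d) (d + 1))

/-- `f a` -/
def app (f a : Exp) : Exp := fun d => .app (f d) (a d)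

/-- `A → B` -/
def arr (A B : Exp) : Exp := pi A fun _ => B

/-- The `i`-th universe. -/
def U (i : ℕ) : Exp := fun _ => .univ i

/-- A constant applied to a list of arguments. -/
def con (c : Const) (args : List Exp := []) : Exp :=
  args.foldl app (fun _ => .const c)

/-- The raw term denoted by a closed expression. -/
def close (t : Exp) : Tm := t 0

end Exp

open Exp

infixl:90 " ⬝ " => Exp.app
infixr:60 " ⇒ " => Exp.arr

/-! ## Applied constants -/

def EmptyT : Exp := con .empty
def UnitT : Exp := con .unit
def star : Exp := con .star
def SumT (A B : Exp) : Exp := con .sum [A, B]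
def NatT : Exp := con .nat
def zero : Exp := con .zero
def succ (n : Exp) : Exp := con .succ [n]
/-- `Σ (x : A), B x` -/
def SigmaT (A : Exp) (B : Exp → Exp) : Exp := con .sigma [A, lam A B]
/-- `(a, b) : Σ (x : A), B x` -/
def pair (A : Exp) (B : Exp → Exp) (a b : Exp) : Exp := con .pair [A, lam A B, a, b]
/-- `A × B` -/
def ProdT (A B : Exp) : Exp := SigmaT A fun _ => B
/-- `a =_A b` -/
def Id (A a b : Exp) : Exp := con .id [A, a, b]
def refl (A a : Exp) : Exp := con .refl [A, a]

/-- Recursion on `n : ℕ` into the type `T`. -/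
def natRec (T z : Exp) (s : Exp → Exp → Exp) (n : Exp) : Exp :=
  con .natInd [lam NatT fun _ => T, z, lam NatT fun m => lam T fun r => s m r, n]

/-- Path induction based at `a`: the motive is `P x p` for `x : A`, `p : a = x`, the base case is
`d : P a refl`, and the result is a term of `P b q`. -/
def pathInd (A a : Exp) (P : Exp → Exp → Exp) (d b q : Exp) : Exp :=
  con .pathInd [A, a, lam A fun x => lam (Id A a x) fun p => P x p, d, b, q]

/-! ## Paths -/

/-- `transport^P(p) : P x → P y` for `p : x =_A y`. -/
def transport (A P x y p : Exp) : Exp :=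
  pathInd A x (fun y _ => P ⬝ x ⇒ P ⬝ y) (lam (P ⬝ x) fun u => u) y p

/-- The type of dependent paths `u =_p^P v` over `p : x =_A y`. -/
def PathOver (A P x y p u v : Exp) : Exp := Id (P ⬝ y) (transport A P x y p ⬝ u) v

/-- `apd_f(p) : f x =_p^P f y` for `f : (a : A) → P a` and `p : x =_A y`. -/
def apd (A P f x y p : Exp) : Exp :=
  pathInd A x (fun y p => PathOver A P x y p (f ⬝ x) (f ⬝ y)) (refl (P ⬝ x) (f ⬝ x)) y p

/-- `p⁻¹ : y =_A x` for `p : x =_A y`. -/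
def inv (A x y p : Exp) : Exp := pathInd A x (fun y _ => Id A y x) (refl A x) y p

/-- `p · q : x =_A z` for `p : x =_A y` and `q : y =_A z`, by path induction on `p`, then `q`. -/
def concat (A x y z p q : Exp) : Exp :=
  pathInd A x (fun y _ => pi A fun z => Id A y z ⇒ Id A x z)
    (lam A fun z => lam (Id A x z) fun q => pathInd A x (fun z _ => Id A x z) (refl A x) z q)
    y p ⬝ z ⬝ q

/-! ## Equivalences -/

/-- `f : A → B` has a left inverse and a right inverse. -/
def IsEquiv (A B f : Exp) : Exp :=
  ProdT (SigmaT (B ⇒ A) fun g => pi A fun a => Id A (g ⬝ (f ⬝ a)) a)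
    (SigmaT (B ⇒ A) fun h => pi B fun b => Id B (f ⬝ (h ⬝ b)) b)

/-- `A ≃ B` -/
def EquivT (A B : Exp) : Exp := SigmaT (A ⇒ B) fun f => IsEquiv A B f

def idFun (A : Exp) : Exp := lam A fun a => a

/-- The term of `IsEquiv A A (idFun A)` given by `idFun A` and reflexivity, twice. -/
def idIsEquiv (A : Exp) : Exp :=
  pair (SigmaT (A ⇒ A) fun g => pi A fun a => Id A (g ⬝ (idFun A ⬝ a)) a)
    (fun _ => SigmaT (A ⇒ A) fun h => pi A fun b => Id A (idFun A ⬝ (h ⬝ b)) b)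
    (pair (A ⇒ A) (fun g => pi A fun a => Id A (g ⬝ (idFun A ⬝ a)) a)
      (idFun A) (lam A fun a => refl A a))
    (pair (A ⇒ A) (fun h => pi A fun b => Id A (idFun A ⬝ (h ⬝ b)) b)
      (idFun A) (lam A fun b => refl A b))

/-- `transport^(X ↦ X)(p) : A → B` for a path `p : A = B` of types in `U i`. -/
def coe (i : ℕ) (A B p : Exp) : Exp := transport (U i) (lam (U i) fun X => X) A B p

/-- `idtoeqv(p) : A ≃ B` for a path `p : A = B` of types in `U i`. -/
def idtoeqv (i : ℕ) (A B p : Exp) : Exp :=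
  pair (A ⇒ B) (fun f => IsEquiv A B f) (coe i A B p)
    (pathInd (U i) A (fun B p => IsEquiv A B (coe i A B p)) (idIsEquiv A) B p)

/-! ## Pushouts, suspensions and spheres -/

/-- The pushout of `f : C → A` and `g : C → B`. -/
def Push (A B C f g : Exp) : Exp := con .push [A, B, C, f, g]
def pushInl (A B C f g a : Exp) : Exp := con .pushInl [A, B, C, f, g, a]
def pushInr (A B C f g b : Exp) : Exp := con .pushInr [A, B, C, f, g, b]
/-- `glue c : inl (f c) = inr (g c)` -/
def glue (A B C f g c : Exp) : Exp := con .glue [A, B, C, f, g, c]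

def toUnit (A : Exp) : Exp := lam A fun _ => star

/-- The suspension of `A`: the pushout of `1 ← A → 1`. -/
def Susp (A : Exp) : Exp := Push UnitT UnitT A (toUnit A) (toUnit A)
def north (A : Exp) : Exp := pushInl UnitT UnitT A (toUnit A) (toUnit A) star
def south (A : Exp) : Exp := pushInr UnitT UnitT A (toUnit A) (toUnit A) star
/-- `merid a : north = south` -/
def merid (A a : Exp) : Exp := glue UnitT UnitT A (toUnit A) (toUnit A) a

/-- The sphere `S^n` for `n : ℕ`: `S^0 = 1 + 1` and `S^(n+1)` is the suspension of `S^n`. -/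
def Sphere (n : Exp) : Exp := natRec (U 0) (SumT UnitT UnitT) (fun _ S => Susp S) n

/-! ## Truncations -/

/-- The higher inductive type `‖A‖_(m-1)` for `m : ℕ`, generated by `|-| : A → ‖A‖`, a hub
`h r : ‖A‖` for each `r : S^m → ‖A‖`, and spokes `r x = h r` for `x : S^m`. -/
def HubTrunc (m A : Exp) : Exp := con .trunc [m, A]
def truncIn (m A a : Exp) : Exp := con .truncIn [m, A, a]
def hub (m A r : Exp) : Exp := con .hub [m, A, r]
def spoke (m A r x : Exp) : Exp := con .spoke [m, A, r, x]

/-! ## The types of the constants -/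

/-- The data of an induction on the pushout: the spans, a motive `P` and the three cases.  `all`
is the binder to be used. -/
def pushData {R : Type} (all : Exp → (Exp → R) → R) (i j : ℕ)
    (k : (A B C f g P l r e : Exp) → R) : R :=
  all (U i) fun A => all (U i) fun B => all (U i) fun C =>
  all (C ⇒ A) fun f => all (C ⇒ B) fun g =>
  all (Push A B C f g ⇒ U j) fun P =>
  all (pi A fun a => P ⬝ pushInl A B C f g a) fun l =>
  all (pi B fun b => P ⬝ pushInr A B C f g b) fun r =>
  all (pi C fun c =>
    PathOver (Push A B C f g) P (pushInl A B C f g (f ⬝ c)) (pushInr A B C f g (g ⬝ c))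
      (glue A B C f g c) (l ⬝ (f ⬝ c)) (r ⬝ (g ⬝ c))) fun e =>
  k A B C f g P l r e

/-- The data of an induction on the hub-and-spoke truncation. -/
def truncData {R : Type} (all : Exp → (Exp → R) → R) (i j : ℕ)
    (k : (m A P t h s : Exp) → R) : R :=
  all NatT fun m => all (U i) fun A =>
  all (HubTrunc m A ⇒ U j) fun P =>
  all (pi A fun a => P ⬝ truncIn m A a) fun t =>
  all (pi (Sphere m ⇒ HubTrunc m A) fun r =>
    (pi (Sphere m) fun x => P ⬝ (r ⬝ x)) ⇒ P ⬝ hub m A r) fun h =>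
  all (pi (Sphere m ⇒ HubTrunc m A) fun r =>
    pi (pi (Sphere m) fun x => P ⬝ (r ⬝ x)) fun r' => pi (Sphere m) fun x =>
      PathOver (HubTrunc m A) P (r ⬝ x) (hub m A r) (spoke m A r x) (r' ⬝ x) (h ⬝ r ⬝ r')) fun s =>
  k m A P t h s

/-- The type of a constant, at universe level `i` for the type that is formed and level `j` for
the motive of an eliminator. -/
def constType (i j : ℕ) : Const → Exp
  | .empty => U 0
  | .emptyInd => pi (EmptyT ⇒ U j) fun P => pi EmptyT fun x => P ⬝ x
  | .unit => U 0
  | .star => UnitT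
  | .unitInd => pi (UnitT ⇒ U j) fun P => P ⬝ star ⇒ pi UnitT fun x => P ⬝ x
  | .sum => U i ⇒ U i ⇒ U i
  | .inl => pi (U i) fun A => pi (U i) fun B => A ⇒ SumT A B
  | .inr => pi (U i) fun A => pi (U i) fun B => B ⇒ SumT A B
  | .sumInd => pi (U i) fun A => pi (U i) fun B => pi (SumT A B ⇒ U j) fun P =>
      (pi A fun a => P ⬝ con .inl [A, B, a]) ⇒ (pi B fun b => P ⬝ con .inr [A, B, b]) ⇒
      pi (SumT A B) fun x => P ⬝ x
  | .nat => U 0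
  | .zero => NatT
  | .succ => NatT ⇒ NatT
  | .natInd => pi (NatT ⇒ U j) fun P => P ⬝ zero ⇒ (pi NatT fun n => P ⬝ n ⇒ P ⬝ succ n) ⇒
      pi NatT fun n => P ⬝ n
  | .sigma => pi (U i) fun A => (A ⇒ U i) ⇒ U i
  | .pair => pi (U i) fun A => pi (A ⇒ U i) fun B => pi A fun a => B ⬝ a ⇒ con .sigma [A, B]
  | .sigmaInd => pi (U i) fun A => pi (A ⇒ U i) fun B => pi (con .sigma [A, B] ⇒ U j) fun P =>
      (pi A fun a => pi (B ⬝ a) fun b => P ⬝ con .pair [A, B, a, b]) ⇒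
      pi (con .sigma [A, B]) fun z => P ⬝ z
  | .id => pi (U i) fun A => A ⇒ A ⇒ U i
  | .refl => pi (U i) fun A => pi A fun a => Id A a a
  | .pathInd => pi (U i) fun A => pi A fun a => pi (pi A fun x => Id A a x ⇒ U j) fun P =>
      P ⬝ a ⬝ refl A a ⇒ pi A fun x => pi (Id A a x) fun p => P ⬝ x ⬝ p
  | .push => pi (U i) fun A => pi (U i) fun B => pi (U i) fun C => (C ⇒ A) ⇒ (C ⇒ B) ⇒ U i
  | .pushInl => pi (U i) fun A => pi (U i) fun B => pi (U i) fun C =>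
      pi (C ⇒ A) fun f => pi (C ⇒ B) fun g => A ⇒ Push A B C f g
  | .pushInr => pi (U i) fun A => pi (U i) fun B => pi (U i) fun C =>
      pi (C ⇒ A) fun f => pi (C ⇒ B) fun g => B ⇒ Push A B C f g
  | .glue => pi (U i) fun A => pi (U i) fun B => pi (U i) fun C =>
      pi (C ⇒ A) fun f => pi (C ⇒ B) fun g => pi C fun c =>
      Id (Push A B C f g) (pushInl A B C f g (f ⬝ c)) (pushInr A B C f g (g ⬝ c))
  | .pushInd => pushData pi i j fun A B C f g P _ _ _ => pi (Push A B C f g) fun z => P ⬝ z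
  | .pushIndGlue => pushData pi i j fun A B C f g P l r e => pi C fun c =>
      Id (PathOver (Push A B C f g) P (pushInl A B C f g (f ⬝ c)) (pushInr A B C f g (g ⬝ c))
          (glue A B C f g c) (l ⬝ (f ⬝ c)) (r ⬝ (g ⬝ c)))
        (apd (Push A B C f g) P (con .pushInd [A, B, C, f, g, P, l, r, e])
          (pushInl A B C f g (f ⬝ c)) (pushInr A B C f g (g ⬝ c)) (glue A B C f g c))
        (e ⬝ c)
  | .trunc => NatT ⇒ U i ⇒ U i
  | .truncIn => pi NatT fun m => pi (U i) fun A => A ⇒ HubTrunc m A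
  | .hub => pi NatT fun m => pi (U i) fun A => (Sphere m ⇒ HubTrunc m A) ⇒ HubTrunc m A
  | .spoke => pi NatT fun m => pi (U i) fun A => pi (Sphere m ⇒ HubTrunc m A) fun r =>
      pi (Sphere m) fun x => Id (HubTrunc m A) (r ⬝ x) (hub m A r)
  | .truncInd => truncData pi i j fun m A P _ _ _ => pi (HubTrunc m A) fun z => P ⬝ z
  | .truncIndSpoke => truncData pi i j fun m A P t h s =>
      pi (Sphere m ⇒ HubTrunc m A) fun r => pi (Sphere m) fun x =>
      let ind : Exp := con .truncInd [m, A, P, t, h, s]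
      let r' : Exp := lam (Sphere m) fun x => ind ⬝ (r ⬝ x)
      Id (PathOver (HubTrunc m A) P (r ⬝ x) (hub m A r) (spoke m A r x) (r' ⬝ x) (h ⬝ r ⬝ r'))
        (apd (HubTrunc m A) P ind (r ⬝ x) (hub m A r) (spoke m A r x))
        (s ⬝ r ⬝ r' ⬝ x)
  | .univalence => pi (U i) fun A => pi (U i) fun B =>
      IsEquiv (Id (U i) A B) (EquivT A B) (lam (Id (U i) A B) fun p => idtoeqv i A B p)

/-! ## The judgmental computation rules of the constants -/

/-- `all A₁ fun x₁ => … all Aₙ fun xₙ => eqn l r T` says `l ≡ r : T` for all `x₁ : A₁, …`. -/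
inductive Rule
  | all (A : Exp) (r : Exp → Rule)
  | eqn (l r T : Exp)

namespace Rule

/-- The left-hand side, as a function of the variables. -/
def lhs : Rule → Exp
  | all A r => lam A fun x => (r x).lhs
  | eqn l _ _ => l

/-- The right-hand side, as a function of the variables. -/
def rhs : Rule → Exp
  | all A r => lam A fun x => (r x).rhs
  | eqn _ r _ => r

/-- The dependent function type of both sides. -/
def type : Rule → Exp
  | all A r => pi A fun x => (r x).type
  | eqn _ _ T => T

end Rule

open Rule in
/-- The computation rules, at universe levels `i` and `j`. -/
def computation (i j : ℕ) : List Rule :=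
  [ -- `1`
    all (UnitT ⇒ U j) fun P => all (P ⬝ star) fun d =>
      eqn (con .unitInd [P, d, star]) d (P ⬝ star),
    -- `A + B`
    all (U i) fun A => all (U i) fun B => all (SumT A B ⇒ U j) fun P =>
      all (pi A fun a => P ⬝ con .inl [A, B, a]) fun l =>
      all (pi B fun b => P ⬝ con .inr [A, B, b]) fun r => all A fun a =>
      eqn (con .sumInd [A, B, P, l, r, con .inl [A, B, a]]) (l ⬝ a) (P ⬝ con .inl [A, B, a]),
    all (U i) fun A => all (U i) fun B => all (SumT A B ⇒ U j) fun P =>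
      all (pi A fun a => P ⬝ con .inl [A, B, a]) fun l =>
      all (pi B fun b => P ⬝ con .inr [A, B, b]) fun r => all B fun b =>
      eqn (con .sumInd [A, B, P, l, r, con .inr [A, B, b]]) (r ⬝ b) (P ⬝ con .inr [A, B, b]),
    -- `ℕ`
    all (NatT ⇒ U j) fun P => all (P ⬝ zero) fun z =>
      all (pi NatT fun n => P ⬝ n ⇒ P ⬝ succ n) fun s =>
      eqn (con .natInd [P, z, s, zero]) z (P ⬝ zero),
    all (NatT ⇒ U j) fun P => all (P ⬝ zero) fun z =>
      all (pi NatT fun n => P ⬝ n ⇒ P ⬝ succ n) fun s => all NatT fun n =>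
      eqn (con .natInd [P, z, s, succ n]) (s ⬝ n ⬝ con .natInd [P, z, s, n]) (P ⬝ succ n),
    -- `Σ`
    all (U i) fun A => all (A ⇒ U i) fun B => all (con .sigma [A, B] ⇒ U j) fun P =>
      all (pi A fun a => pi (B ⬝ a) fun b => P ⬝ con .pair [A, B, a, b]) fun g =>
      all A fun a => all (B ⬝ a) fun b =>
      eqn (con .sigmaInd [A, B, P, g, con .pair [A, B, a, b]]) (g ⬝ a ⬝ b)
        (P ⬝ con .pair [A, B, a, b]),
    -- identity types
    all (U i) fun A => all A fun a => all (pi A fun x => Id A a x ⇒ U j) fun P =>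
      all (P ⬝ a ⬝ refl A a) fun d =>
      eqn (con .pathInd [A, a, P, d, a, refl A a]) d (P ⬝ a ⬝ refl A a),
    -- pushouts
    pushData all i j fun A B C f g P l r e => all A fun a =>
      eqn (con .pushInd [A, B, C, f, g, P, l, r, e, pushInl A B C f g a]) (l ⬝ a)
        (P ⬝ pushInl A B C f g a),
    pushData all i j fun A B C f g P l r e => all B fun b =>
      eqn (con .pushInd [A, B, C, f, g, P, l, r, e, pushInr A B C f g b]) (r ⬝ b)
        (P ⬝ pushInr A B C f g b),
    -- hub-and-spoke truncations
    truncData all i j fun m A P t h s => all A fun a =>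
      eqn (con .truncInd [m, A, P, t, h, s, truncIn m A a]) (t ⬝ a) (P ⬝ truncIn m A a),
    truncData all i j fun m A P t h s => all (Sphere m ⇒ HubTrunc m A) fun r =>
      eqn (con .truncInd [m, A, P, t, h, s, hub m A r])
        (h ⬝ r ⬝ lam (Sphere m) fun x => con .truncInd [m, A, P, t, h, s, r ⬝ x])
        (P ⬝ hub m A r) ]

/-! ## Judgments and derivations -/

/-- `Γ ctx`, `Γ ⊢ t : A` and `Γ ⊢ t ≡ u : A`.  The head of a context is its last entry. -/
inductive Judgment
  | ctx (Γ : List Tm)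
  | typ (Γ : List Tm) (t A : Tm)
  | eq (Γ : List Tm) (t u A : Tm)

open Judgment in
/-- Derivability of a judgment. -/
inductive Derivable : Judgment → Prop
  -- contexts
  | nil : Derivable (ctx [])
  | cons {Γ A i} : Derivable (ctx Γ) → Derivable (typ Γ A (.univ i)) → Derivable (ctx (A :: Γ))
  -- variables, universes, constants
  | var {Γ n A} : Derivable (ctx Γ) → Γ[n]? = some A →
      Derivable (typ Γ (.var n) (A.rename (· + (n + 1))))
  | univ {Γ} (i) : Derivable (ctx Γ) → Derivable (typ Γ (.univ i) (.univ (i + 1)))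
  | cumul {Γ A i} : Derivable (typ Γ A (.univ i)) → Derivable (typ Γ A (.univ (i + 1)))
  | const {Γ} (c : Const) (i j : ℕ) : Derivable (ctx Γ) →
      Derivable (typ Γ (.const c) (constType i j c).close)
  -- dependent functions
  | pi {Γ A B i} : Derivable (typ Γ A (.univ i)) → Derivable (typ (A :: Γ) B (.univ i)) →
      Derivable (typ Γ (.pi A B) (.univ i))
  | lam {Γ A B b i} : Derivable (typ Γ A (.univ i)) → Derivable (typ (A :: Γ) b B) →
      Derivable (typ Γ (.lam A b) (.pi A B))
  | app {Γ A B f a} : Derivable (typ Γ f (.pi A B)) → Derivable (typ Γ a A) →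
      Derivable (typ Γ (.app f a) (B.inst a))
  -- judgmentally equal types have the same terms
  | conv {Γ A B t i} : Derivable (typ Γ t A) → Derivable (eq Γ A B (.univ i)) →
      Derivable (typ Γ t B)
  | eqConv {Γ A B t u i} : Derivable (eq Γ t u A) → Derivable (eq Γ A B (.univ i)) →
      Derivable (eq Γ t u B)
  | eqCumul {Γ A B i} : Derivable (eq Γ A B (.univ i)) → Derivable (eq Γ A B (.univ (i + 1)))
  -- judgmental equality is an equivalence relation and a congruence
  | eqRefl {Γ A t} : Derivable (typ Γ t A) → Derivable (eq Γ t t A)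
  | eqSymm {Γ A t u} : Derivable (eq Γ t u A) → Derivable (eq Γ u t A)
  | eqTrans {Γ A t u v} : Derivable (eq Γ t u A) → Derivable (eq Γ u v A) →
      Derivable (eq Γ t v A)
  | eqPi {Γ A A' B B' i} : Derivable (typ Γ A (.univ i)) → Derivable (eq Γ A A' (.univ i)) →
      Derivable (eq (A :: Γ) B B' (.univ i)) →
      Derivable (eq Γ (.pi A B) (.pi A' B') (.univ i))
  | eqLam {Γ A A' B b b' i} : Derivable (typ Γ A (.univ i)) → Derivable (eq Γ A A' (.univ i)) →
      Derivable (eq (A :: Γ) b b' B) →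
      Derivable (eq Γ (.lam A b) (.lam A' b') (.pi A B))
  | eqApp {Γ A B f f' a a'} : Derivable (eq Γ f f' (.pi A B)) → Derivable (eq Γ a a' A) →
      Derivable (eq Γ (.app f a) (.app f' a') (B.inst a))
  -- computation
  | beta {Γ A B b a i} : Derivable (typ Γ A (.univ i)) → Derivable (typ (A :: Γ) b B) →
      Derivable (typ Γ a A) → Derivable (eq Γ (.app (.lam A b) a) (b.inst a) (B.inst a))
  | eta {Γ A B f} : Derivable (typ Γ f (.pi A B)) →
      Derivable (eq Γ f (.lam A (.app (f.rename (· + 1)) (.var 0))) (.pi A B))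
  | comp {Γ} (i j : ℕ) {r : Rule} : Derivable (ctx Γ) → r ∈ computation i j →
      Derivable (eq Γ r.lhs.close r.rhs.close r.type.close)

/-- The closed type `T` is inhabited: there is a term `t` with `⊢ t : T`. -/
def IsInhabited (T : Exp) : Prop := ∃ t : Tm, Derivable (.typ [] t T.close)

/-! ## Connectedness and the suspension map

The truncation levels `n ≥ -2` are represented by the natural numbers `k = n + 2`. -/

/-- `‖A‖_(k-2)` for `A` in `U i`: the unit type if `k = 0`, the hub-and-spoke type if `k ≥ 1`. -/
def Trunc (i : ℕ) (k A : Exp) : Exp := natRec (U i) UnitT (fun m _ => HubTrunc m A) k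

def IsContr (A : Exp) : Exp := SigmaT A fun a => pi A fun x => Id A a x

/-- The fibre of `f : A → B` over `y : B`. -/
def Fib (A B f y : Exp) : Exp := SigmaT A fun x => Id B (f ⬝ x) y

/-- The type `A` in `U i` is `(k-2)`-connected. -/
def IsConn (i : ℕ) (k A : Exp) : Exp := IsContr (Trunc i k A)

/-- The function `f : A → B` between types in `U i` is `(k-2)`-connected. -/
def IsConnMap (i : ℕ) (k A B f : Exp) : Exp := pi B fun y => IsConn i k (Fib A B f y)

/-- The underlying type of the loop space of `(A, a)`. -/
def Loop (A a : Exp) : Exp := Id A a a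

/-- `σ(x) = merid(x) · merid(x₀)⁻¹`, a function from `C` to the loop space of its suspension. -/
def suspMap (C x₀ : Exp) : Exp :=
  lam C fun x => concat (Susp C) (north C) (south C) (north C) (merid C x)
    (inv (Susp C) (north C) (south C) (merid C x₀))

/-- `2 m` -/
def double (m : Exp) : Exp := natRec NatT zero (fun _ r => succ (succ r)) m

/-- For all `m : ℕ`, write `n = m - 1`, so that `n` runs over the integers `n ≥ -1`, with
`n + 2 = m + 1` and `2 n + 2 = 2 m`.  For every type `C` in `U i` that is `n`-connected and every
`x₀ : C`, the map `σ` is `2n`-connected. -/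
def Freudenthal (i : ℕ) : Exp :=
  pi NatT fun m => pi (U i) fun C => IsConn i (succ m) C ⇒ pi C fun x₀ =>
    IsConnMap i (double m) C (Loop (Susp C) (north C)) (suspMap C x₀)

end HoTT

namespace HoTT

open Judgment

/-! ## Renaming and substitution -/

namespace Tm

/-! The mathematics is the encode-decode method together with the wedge lemma. Write `μ` for
`merid`. A loop `p` at the north pole has the code `F p = ‖Σ x, μ x · (μ x₀)⁻¹ = p‖` and a path `q`
from north to south the code `G q = ‖Σ x, μ x = q‖`, both truncated at level `2n`. The types `F p`
are the ones that have to be contractible. For each `a` a map `F p → G (p · μ a)` is needed. By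
induction on the truncation and on paths it amounts to an element of `G ((μ b · (μ x₀)⁻¹) · μ a)`
for all `a` and `b`. If `b = x₀`, the point `a` gives one; if `a = x₀`, the point `b` does; and the
two agree if both are `x₀`. As `C` is `n`-connected and the types are `2n`-truncated, the wedge
lemma (`wedge`) extends these partial choices to all `a`, `b`.

For `a = x₀` the map has an explicit inverse. Having contractible fibres is a proposition and `C` is
connected if `n ≥ 0`, so the map is an equivalence for every `a`. By univalence these equivalences
become equalities that glue `F` and `G` into a family over all paths from north. Path induction,
started at the code of reflexivity given by `x₀`, yields a section of it. By the first wedge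
condition its value at `μ a` is the class of `a`, so it is a centre of each `G q`. Finally `F p` is
a retract of `G (p · μ x₀)`. For `n = -1` truncation at level `-2` makes the claim trivial.

The wedge lemma rests on `Conn.ind_exists`: over a pointed `n`-connected type a family of
`(n-1)`-types has a section with any prescribed value at the base point. Indeed the universe of
`(n-1)`-types is an `n`-type (`isTy_types`), so the family extends over the truncation, where all
points are equal. Each further truncation level allowed in the fibres costs one level for the type
of extensions (`isTy_ext`). Below this lie function extensionality, which follows from univalence,
and the fact that an `n`-type is a type in which all maps from the `(n+1)`-sphere are null
(`isTy_null`, `null_isTy`); the latter gives the induction principle of the hub-and-spoke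
truncation.

What the theorem demands is a derivation in a formal system, and this is obtained by reflection. A
type checker is defined on raw terms, and `sound_checker` shows that all its positive verdicts are
derivable judgments. The construction is a list of definitions, each of which becomes a global
constant for the later ones, and Lean's kernel evaluates the checker on them. Universes are
represented by codes relative to an arbitrary base, so that one run serves all levels. A `Model`
replaces codes by actual universes and global constants by closed terms. -/

theorem rename_ext {ρ ρ' : ℕ → ℕ} (h : ∀ n, ρ n = ρ' n) (t : Tm) : t.rename ρ = t.rename ρ' := by
  rw [funext h]

theorem subst_ext {σ σ' : ℕ → Tm} (h : ∀ n, σ n = σ' n) (t : Tm) : t.subst σ = t.subst σ' := by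
  rw [funext h]

theorem subst_var (t : Tm) {σ : ℕ → Tm} (h : ∀ n, σ n = var n) : t.subst σ = t := by
  induction t generalizing σ with
  | var n => exact h n
  | pi A B ihA ihB => exact congrArg₂ Tm.pi (ihA h) (ihB fun n => by cases n <;> simp [liftSub, h, rename])
  | lam A B ihA ihB => exact congrArg₂ Tm.lam (ihA h) (ihB fun n => by cases n <;> simp [liftSub, h, rename])
  | app f a ihf iha => exact congrArg₂ Tm.app (ihf h) (iha h)
  | _ => rfl

theorem rename_eq_subst (t : Tm) (ρ : ℕ → ℕ) : t.rename ρ = t.subst fun n => var (ρ n) := by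
  induction t generalizing ρ with
  | pi A B ihA ihB =>
    refine congrArg₂ Tm.pi (ihA ρ) ((ihB _).trans (subst_ext (fun n => ?_) B))
    cases n <;> rfl
  | lam A B ihA ihB =>
    refine congrArg₂ Tm.lam (ihA ρ) ((ihB _).trans (subst_ext (fun n => ?_) B))
    cases n <;> rfl
  | app f a ihf iha => exact congrArg₂ Tm.app (ihf ρ) (iha ρ)
  | _ => rfl

theorem rename_subst (t : Tm) (ρ : ℕ → ℕ) (σ : ℕ → Tm) :
    (t.rename ρ).subst σ = t.subst fun n => σ (ρ n) := by
  induction t generalizing ρ σ with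
  | pi A B ihA ihB =>
    refine congrArg₂ Tm.pi (ihA ρ σ) ((ihB _ _).trans (subst_ext (fun n => ?_) B))
    cases n <;> rfl
  | lam A B ihA ihB =>
    refine congrArg₂ Tm.lam (ihA ρ σ) ((ihB _ _).trans (subst_ext (fun n => ?_) B))
    cases n <;> rfl
  | app f a ihf iha => exact congrArg₂ Tm.app (ihf ρ σ) (iha ρ σ)
  | _ => rfl

theorem rename_rename (t : Tm) (ρ ρ' : ℕ → ℕ) :
    (t.rename ρ).rename ρ' = t.rename fun n => ρ' (ρ n) := by
  rw [rename_eq_subst, rename_subst, rename_eq_subst]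

theorem subst_rename (t : Tm) (σ : ℕ → Tm) (ρ : ℕ → ℕ) :
    (t.subst σ).rename ρ = t.subst fun n => (σ n).rename ρ := by
  induction t generalizing ρ σ with
  | pi A B ihA ihB =>
    refine congrArg₂ Tm.pi (ihA σ ρ) ((ihB _ _).trans (subst_ext (fun n => ?_) B))
    cases n <;> simp [liftSub, rename, rename_rename, liftRen]
  | lam A B ihA ihB =>
    refine congrArg₂ Tm.lam (ihA σ ρ) ((ihB _ _).trans (subst_ext (fun n => ?_) B))
    cases n <;> simp [liftSub, rename, rename_rename, liftRen]
  | app f a ihf iha => exact congrArg₂ Tm.app (ihf σ ρ) (iha σ ρ)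
  | _ => rfl

theorem subst_subst (t : Tm) (σ τ : ℕ → Tm) :
    (t.subst σ).subst τ = t.subst fun n => (σ n).subst τ := by
  induction t generalizing σ τ with
  | pi A B ihA ihB =>
    refine congrArg₂ Tm.pi (ihA σ τ) ((ihB _ _).trans (subst_ext (fun n => ?_) B))
    cases n <;> simp [liftSub, subst, rename_subst, subst_rename]
  | lam A B ihA ihB =>
    refine congrArg₂ Tm.lam (ihA σ τ) ((ihB _ _).trans (subst_ext (fun n => ?_) B))
    cases n <;> simp [liftSub, subst, rename_subst, subst_rename]
  | app f a ihf iha => exact congrArg₂ Tm.app (ihf σ τ) (iha σ τ)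
  | _ => rfl

/-- The substitution of `a` for the variable `0` and of `σ` for the other ones. -/
def cons (a : Tm) (σ : ℕ → Tm) : ℕ → Tm
  | 0 => a
  | n + 1 => σ n

theorem inst_eq (b a : Tm) : b.inst a = b.subst (cons a var) :=
  subst_ext (fun n => by cases n <;> rfl) b

theorem subst_liftSub_inst (b a : Tm) (σ : ℕ → Tm) :
    (b.subst (liftSub σ)).inst a = b.subst (cons a σ) := by
  rw [inst_eq, subst_subst]
  refine subst_ext (fun n => ?_) b
  cases n with
  | zero => rfl
  | succ n => simpa [liftSub, rename_subst, cons] using subst_var _ fun _ => rfl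

theorem inst_subst (b a : Tm) (σ : ℕ → Tm) :
    (b.inst a).subst σ = (b.subst (liftSub σ)).inst (a.subst σ) := by
  rw [subst_liftSub_inst, inst_eq, subst_subst]
  refine subst_ext (fun n => ?_) b
  cases n <;> rfl

theorem liftRen_eq (ρ : ℕ → ℕ) (t : Tm) :
    t.rename (liftRen ρ) = t.subst (liftSub fun n => var (ρ n)) := by
  rw [rename_eq_subst]
  refine subst_ext (fun n => ?_) t
  cases n <;> rfl

theorem inst_rename (b a : Tm) (ρ : ℕ → ℕ) :
    (b.inst a).rename ρ = (b.rename (liftRen ρ)).inst (a.rename ρ) := by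
  rw [rename_eq_subst, inst_subst, liftRen_eq, rename_eq_subst]

/-- A term without free variables. -/
def Closed (t : Tm) : Prop := ∀ σ, t.subst σ = t

theorem Closed.rename {t : Tm} (h : t.Closed) (ρ : ℕ → ℕ) : t.rename ρ = t := by
  rw [rename_eq_subst, h]

/-- Are all variables of a term among the first `c`? -/
def isScoped : Tm → ℕ → Bool
  | var n, c => decide (n < c)
  | univ _, _ => true
  | pi A B, c => A.isScoped c && B.isScoped (c + 1)
  | lam A B, c => A.isScoped c && B.isScoped (c + 1)
  | app f a, c => f.isScoped c && a.isScoped c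
  | const _, _ => true

theorem subst_of_isScoped {t : Tm} {c : ℕ} (h : t.isScoped c = true) {σ : ℕ → Tm}
    (hσ : ∀ n < c, σ n = var n) : t.subst σ = t := by
  induction t generalizing c σ with
  | var n => exact hσ n (by simpa [isScoped] using h)
  | pi A B ihA ihB =>
    simp only [isScoped, Bool.and_eq_true] at h
    refine congrArg₂ Tm.pi (ihA h.1 hσ) (ihB h.2 fun n hn => ?_)
    cases n with
    | zero => rfl
    | succ n => simp [liftSub, hσ n (by omega), Tm.rename]
  | lam A B ihA ihB =>
    simp only [isScoped, Bool.and_eq_true] at h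
    refine congrArg₂ Tm.lam (ihA h.1 hσ) (ihB h.2 fun n hn => ?_)
    cases n with
    | zero => rfl
    | succ n => simp [liftSub, hσ n (by omega), Tm.rename]
  | app f a ihf iha =>
    simp only [isScoped, Bool.and_eq_true] at h
    exact congrArg₂ Tm.app (ihf h.1 hσ) (iha h.2 hσ)
  | _ => rfl

theorem closed_of_isScoped {t : Tm} (h : t.isScoped 0 = true) : t.Closed :=
  fun _ => subst_of_isScoped h fun n hn => absurd hn (Nat.not_lt_zero n)

end Tm

open Tm

/-- Scoping does not depend on universe levels, so evaluation decides it for all levels at once.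
Closedness is what makes the rules for constants stable under renaming and substitution. -/
theorem closed_constType (i j : ℕ) (c : Const) : (constType i j c).close.Closed := by
  apply closed_of_isScoped
  cases c <;> rfl

theorem closed_rule {i j : ℕ} {r : Rule} (h : r ∈ computation i j) :
    r.lhs.close.Closed ∧ r.rhs.close.Closed ∧ r.type.close.Closed := by
  have key : ((computation i j).all fun r => r.lhs.close.isScoped 0 && r.rhs.close.isScoped 0 &&
      r.type.close.isScoped 0) = true := rfl
  have := List.all_eq_true.mp key r h
  simp only [Bool.and_eq_true] at this
  exact ⟨closed_of_isScoped this.1.1, closed_of_isScoped this.1.2, closed_of_isScoped this.2⟩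

/-! ## The substitution theorem -/

/-- `ρ` renames the variables of `Γ` to variables of `Δ` of the same type. -/
def IsRen (Γ Δ : List Tm) (ρ : ℕ → ℕ) : Prop :=
  ∀ n A, Γ[n]? = some A →
    ∃ B, Δ[ρ n]? = some B ∧ B.rename (· + (ρ n + 1)) = (A.rename (· + (n + 1))).rename ρ

theorem IsRen.lift {Γ Δ : List Tm} {ρ : ℕ → ℕ} (h : IsRen Γ Δ ρ) (A : Tm) :
    IsRen (A :: Γ) (A.rename ρ :: Δ) (liftRen ρ) := by
  rintro (_ | n) B hB
  · obtain rfl : A = B := by simpa using hB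
    exact ⟨_, rfl, by simp [rename_rename, liftRen]⟩
  · obtain ⟨C, hC, e⟩ := h n B (by simpa using hB)
    refine ⟨C, by simpa [liftRen] using hC, ?_⟩
    have := congrArg (fun t => Tm.rename t (· + 1)) e
    simp only [rename_rename] at this ⊢
    simpa [liftRen, Nat.add_assoc] using this

theorem isRen_succ (Γ : List Tm) (A : Tm) : IsRen Γ (A :: Γ) (· + 1) := fun n B hB =>
  ⟨B, by simpa using hB, by simp [rename_rename, Nat.add_assoc]⟩

/-- Renaming of a judgment. -/
def RenOK : Judgment → Prop
  | ctx _ => True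
  | typ Γ t A => ∀ Δ ρ, Derivable (ctx Δ) → IsRen Γ Δ ρ →
      Derivable (typ Δ (t.rename ρ) (A.rename ρ))
  | eq Γ t u A => ∀ Δ ρ, Derivable (ctx Δ) → IsRen Γ Δ ρ →
      Derivable (eq Δ (t.rename ρ) (u.rename ρ) (A.rename ρ))

/-- Renaming precedes substitution because a substitution that passes a binder has its terms
weakened. The premise of each binder rule that the domain is a type is what allows the target
context to be extended. -/
theorem Derivable.renOK {J : Judgment} (h : Derivable J) : RenOK J := by
  induction h with
  | nil => trivial
  | cons => trivial
  | @var Γ n A _ hn _ =>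
    intro Δ ρ hΔ hρ
    obtain ⟨B, hB, e⟩ := hρ n A hn
    rw [← e]
    exact .var hΔ hB
  | univ i _ _ => exact fun Δ ρ hΔ _ => .univ i hΔ
  | cumul _ ih => exact fun Δ ρ hΔ hρ => .cumul (ih Δ ρ hΔ hρ)
  | const c i j _ _ =>
    intro Δ ρ hΔ _
    rw [(closed_constType i j c).rename]
    exact .const c i j hΔ
  | pi _ _ ihA ihB =>
    exact fun Δ ρ hΔ hρ => .pi (ihA Δ ρ hΔ hρ)
      (ihB _ _ (.cons hΔ (ihA Δ ρ hΔ hρ)) (hρ.lift _))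
  | lam _ _ ihA ihB =>
    exact fun Δ ρ hΔ hρ => .lam (ihA Δ ρ hΔ hρ)
      (ihB _ _ (.cons hΔ (ihA Δ ρ hΔ hρ)) (hρ.lift _))
  | app _ _ ihf iha =>
    intro Δ ρ hΔ hρ
    rw [inst_rename]
    exact .app (ihf Δ ρ hΔ hρ) (iha Δ ρ hΔ hρ)
  | conv _ _ iht ihA => exact fun Δ ρ hΔ hρ => .conv (iht Δ ρ hΔ hρ) (ihA Δ ρ hΔ hρ)
  | eqConv _ _ iht ihA => exact fun Δ ρ hΔ hρ => .eqConv (iht Δ ρ hΔ hρ) (ihA Δ ρ hΔ hρ)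
  | eqCumul _ ih => exact fun Δ ρ hΔ hρ => .eqCumul (ih Δ ρ hΔ hρ)
  | eqRefl _ ih => exact fun Δ ρ hΔ hρ => .eqRefl (ih Δ ρ hΔ hρ)
  | eqSymm _ ih => exact fun Δ ρ hΔ hρ => .eqSymm (ih Δ ρ hΔ hρ)
  | eqTrans _ _ ih ih' => exact fun Δ ρ hΔ hρ => .eqTrans (ih Δ ρ hΔ hρ) (ih' Δ ρ hΔ hρ)
  | eqPi _ _ _ ihA ihA' ihB =>
    exact fun Δ ρ hΔ hρ => .eqPi (ihA Δ ρ hΔ hρ) (ihA' Δ ρ hΔ hρ)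
      (ihB _ _ (.cons hΔ (ihA Δ ρ hΔ hρ)) (hρ.lift _))
  | eqLam _ _ _ ihA ihA' ihB =>
    exact fun Δ ρ hΔ hρ => .eqLam (ihA Δ ρ hΔ hρ) (ihA' Δ ρ hΔ hρ)
      (ihB _ _ (.cons hΔ (ihA Δ ρ hΔ hρ)) (hρ.lift _))
  | eqApp _ _ ihf iha =>
    intro Δ ρ hΔ hρ
    rw [inst_rename]
    exact .eqApp (ihf Δ ρ hΔ hρ) (iha Δ ρ hΔ hρ)
  | beta _ _ _ ihA ihb iha =>
    intro Δ ρ hΔ hρ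
    rw [inst_rename, inst_rename]
    exact .beta (ihA Δ ρ hΔ hρ) (ihb _ _ (.cons hΔ (ihA Δ ρ hΔ hρ)) (hρ.lift _)) (iha Δ ρ hΔ hρ)
  | @eta Γ A B f _ ih =>
    intro Δ ρ hΔ hρ
    have := Derivable.eta (ih Δ ρ hΔ hρ)
    simpa [Tm.rename, rename_rename, liftRen] using this
  | comp i j _ hr _ =>
    intro Δ ρ hΔ _
    obtain ⟨h₁, h₂, h₃⟩ := closed_rule hr
    rw [h₁.rename, h₂.rename, h₃.rename]
    exact .comp i j hΔ hr

/-- `σ` assigns to the variables of `Γ` terms in the context `Δ`. -/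
def IsSub (Γ Δ : List Tm) (σ : ℕ → Tm) : Prop :=
  ∀ n A, Γ[n]? = some A → Derivable (typ Δ (σ n) ((A.rename (· + (n + 1))).subst σ))

theorem Derivable.weaken {Γ : List Tm} {t A B : Tm} (h : Derivable (typ Γ t A))
    (hΓ : Derivable (ctx (B :: Γ))) :
    Derivable (typ (B :: Γ) (t.rename (· + 1)) (A.rename (· + 1))) :=
  h.renOK _ _ hΓ (isRen_succ Γ B)

theorem IsSub.lift {Γ Δ : List Tm} {σ : ℕ → Tm} (h : IsSub Γ Δ σ) {A : Tm}
    (hA : Derivable (ctx (A.subst σ :: Δ))) : IsSub (A :: Γ) (A.subst σ :: Δ) (liftSub σ) := by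
  rintro (_ | n) B hB
  · obtain rfl : A = B := by simpa using hB
    have := Derivable.var hA (n := 0) rfl
    simpa [rename_subst, subst_rename, liftSub] using this
  · have := (h n B (by simpa using hB)).weaken hA
    simpa [rename_subst, subst_rename, liftSub, rename_rename] using this

theorem IsSub.cons {Γ Δ : List Tm} {σ : ℕ → Tm} (h : IsSub Γ Δ σ) {A a : Tm}
    (ha : Derivable (typ Δ a (A.subst σ))) : IsSub (A :: Γ) Δ (cons a σ) := by
  rintro (_ | n) B hB
  · obtain rfl : A = B := by simpa using hB
    simpa [rename_subst, Tm.cons] using ha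
  · simpa [rename_subst, Tm.cons] using h n B (by simpa using hB)

theorem isSub_var {Γ : List Tm} (h : Derivable (ctx Γ)) : IsSub Γ Γ Tm.var := fun n A hA => by
  rw [subst_var _ fun _ => rfl]
  exact .var h hA

theorem isSub_nil (Δ : List Tm) (σ : ℕ → Tm) : IsSub [] Δ σ := fun n A h => by simp at h

/-- Substitution in a judgment. -/
def SubOK : Judgment → Prop
  | ctx _ => True
  | typ Γ t A => ∀ Δ σ, Derivable (ctx Δ) → IsSub Γ Δ σ →
      Derivable (typ Δ (t.subst σ) (A.subst σ))
  | eq Γ t u A => ∀ Δ σ, Derivable (ctx Δ) → IsSub Γ Δ σ →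
      Derivable (eq Δ (t.subst σ) (u.subst σ) (A.subst σ))

theorem Derivable.subOK {J : Judgment} (h : Derivable J) : SubOK J := by
  induction h with
  | nil => trivial
  | cons => trivial
  | @var Γ n A _ hn _ => exact fun Δ σ _ hσ => hσ n A hn
  | univ i _ _ => exact fun Δ σ hΔ _ => .univ i hΔ
  | cumul _ ih => exact fun Δ σ hΔ hσ => .cumul (ih Δ σ hΔ hσ)
  | const c i j _ _ =>
    intro Δ σ hΔ _
    rw [closed_constType i j c]
    exact .const c i j hΔ
  | pi _ _ ihA ihB =>
    exact fun Δ σ hΔ hσ => .pi (ihA Δ σ hΔ hσ)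
      (ihB _ _ (.cons hΔ (ihA Δ σ hΔ hσ)) (hσ.lift (.cons hΔ (ihA Δ σ hΔ hσ))))
  | lam _ _ ihA ihB =>
    exact fun Δ σ hΔ hσ => .lam (ihA Δ σ hΔ hσ)
      (ihB _ _ (.cons hΔ (ihA Δ σ hΔ hσ)) (hσ.lift (.cons hΔ (ihA Δ σ hΔ hσ))))
  | app _ _ ihf iha =>
    intro Δ σ hΔ hσ
    rw [inst_subst]
    exact .app (ihf Δ σ hΔ hσ) (iha Δ σ hΔ hσ)
  | conv _ _ iht ihA => exact fun Δ σ hΔ hσ => .conv (iht Δ σ hΔ hσ) (ihA Δ σ hΔ hσ)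
  | eqConv _ _ iht ihA => exact fun Δ σ hΔ hσ => .eqConv (iht Δ σ hΔ hσ) (ihA Δ σ hΔ hσ)
  | eqCumul _ ih => exact fun Δ σ hΔ hσ => .eqCumul (ih Δ σ hΔ hσ)
  | eqRefl _ ih => exact fun Δ σ hΔ hσ => .eqRefl (ih Δ σ hΔ hσ)
  | eqSymm _ ih => exact fun Δ σ hΔ hσ => .eqSymm (ih Δ σ hΔ hσ)
  | eqTrans _ _ ih ih' => exact fun Δ σ hΔ hσ => .eqTrans (ih Δ σ hΔ hσ) (ih' Δ σ hΔ hσ)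
  | eqPi _ _ _ ihA ihA' ihB =>
    exact fun Δ σ hΔ hσ => .eqPi (ihA Δ σ hΔ hσ) (ihA' Δ σ hΔ hσ)
      (ihB _ _ (.cons hΔ (ihA Δ σ hΔ hσ)) (hσ.lift (.cons hΔ (ihA Δ σ hΔ hσ))))
  | eqLam _ _ _ ihA ihA' ihB =>
    exact fun Δ σ hΔ hσ => .eqLam (ihA Δ σ hΔ hσ) (ihA' Δ σ hΔ hσ)
      (ihB _ _ (.cons hΔ (ihA Δ σ hΔ hσ)) (hσ.lift (.cons hΔ (ihA Δ σ hΔ hσ))))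
  | eqApp _ _ ihf iha =>
    intro Δ σ hΔ hσ
    rw [inst_subst]
    exact .eqApp (ihf Δ σ hΔ hσ) (iha Δ σ hΔ hσ)
  | beta _ _ _ ihA ihb iha =>
    intro Δ σ hΔ hσ
    rw [inst_subst, inst_subst]
    exact .beta (ihA Δ σ hΔ hσ)
      (ihb _ _ (.cons hΔ (ihA Δ σ hΔ hσ)) (hσ.lift (.cons hΔ (ihA Δ σ hΔ hσ)))) (iha Δ σ hΔ hσ)
  | @eta Γ A B f _ ih =>
    intro Δ σ hΔ hσ
    have := Derivable.eta (ih Δ σ hΔ hσ)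
    simpa [Tm.subst, rename_subst, subst_rename, liftSub] using this
  | comp i j _ hr _ =>
    intro Δ σ hΔ _
    obtain ⟨h₁, h₂, h₃⟩ := closed_rule hr
    rw [h₁, h₂, h₃]
    exact .comp i j hΔ hr

end HoTT

namespace HoTT

/-! ## A type checker

The numerals of universes are read as codes: `univ 0` is the lowest universe, `univ (n + 1)` for
`n < 7` is the universe `i + n` for a fixed but arbitrary `i`, and `univ (n + 8)` is the `n`-th
global constant of an environment.

The checker is run by the kernel.  It is therefore written with recursors, and case distinctions
are made by the following functions. -/

noncomputable section

def caseBool {R : Type} (b : Bool) (y n : R) : R := Bool.rec n y b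

def caseOpt {α R : Type} (o : Option α) (s : α → R) (n : R) : R := Option.rec n s o

def caseList {α R : Type} (l : List α) (n : R) (k : α → List α → R) : R :=
  List.rec n (fun a l _ => k a l) l

def casePair {α β R : Type} (p : α × β) (k : α → β → R) : R := Prod.rec k p

/-- The continuation `k` is applied to the numeral that `n` evaluates to. -/
def forceNat {R : Type} (n : ℕ) (k : ℕ → R) : R := Nat.rec (k 0) (fun m _ => k m) n.succ

/-- The `n`-th entry of a list. -/
def nth {α : Type} (l : List α) : ℕ → Option α :=
  List.rec (fun _ => none) (fun a _ ih n => Nat.rec (some a) (fun n _ => ih n) n) l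

namespace Tm

def caseVar {R : Type} (t : Tm) (k : ℕ → R) (d : R) : R :=
  Tm.rec k (fun _ => d) (fun _ _ _ _ => d) (fun _ _ _ _ => d) (fun _ _ _ _ => d) (fun _ => d) t

def caseApp {R : Type} (t : Tm) (k : Tm → Tm → R) (d : R) : R :=
  Tm.rec (fun _ => d) (fun _ => d) (fun _ _ _ _ => d) (fun _ _ _ _ => d) (fun A B _ _ => k A B) (fun _ => d) t

def caseUniv {R : Type} (t : Tm) (k : ℕ → R) (d : R) : R :=
  Tm.rec (fun _ => d) k (fun _ _ _ _ => d) (fun _ _ _ _ => d) (fun _ _ _ _ => d) (fun _ => d) t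

def casePi {R : Type} (t : Tm) (k : Tm → Tm → R) (d : R) : R :=
  Tm.rec (fun _ => d) (fun _ => d) (fun A B _ _ => k A B) (fun _ _ _ _ => d) (fun _ _ _ _ => d) (fun _ => d) t

def caseLam {R : Type} (t : Tm) (k : Tm → Tm → R) (d : R) : R :=
  Tm.rec (fun _ => d) (fun _ => d) (fun _ _ _ _ => d) (fun A B _ _ => k A B) (fun _ _ _ _ => d) (fun _ => d) t

def caseConst {R : Type} (t : Tm) (k : Const → R) (d : R) : R :=
  Tm.rec (fun _ => d) (fun _ => d) (fun _ _ _ _ => d) (fun _ _ _ _ => d) (fun _ _ _ _ => d) k t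

def caseHead {R : Type} (t : Tm) (var univ : ℕ → R) (pi lam : Tm → Tm → R) (const : Const → R)
    (d : R) : R :=
  Tm.rec var univ (fun A B _ _ => pi A B) (fun A B _ _ => lam A B) (fun _ _ _ _ => d) const t

/-- The continuation `k` is applied to the term that `t` evaluates to. -/
def force {R : Type} (t : Tm) : (Tm → R) → R := Tm.rec
  (fun n k => forceNat n fun n => k (var n)) (fun n k => forceNat n fun n => k (univ n))
  (fun _ _ f g k => f fun A => g fun B => k (pi A B))
  (fun _ _ f g k => f fun A => g fun B => k (lam A B))
  (fun _ _ f g k => f fun A => g fun B => k (app A B))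
  (fun c k => k (const c)) t

/-- The continuation `k` is applied to the list that `l` evaluates to. -/
def forceList {R : Type} (l : List Tm) : (List Tm → R) → R := List.rec (fun k => k [])
  (fun a _ ih k => force a fun a => ih fun l => k (a :: l)) l

/-- Syntactic equality. -/
def beq (t : Tm) : Tm → Bool := Tm.rec
  (fun n u => caseVar u (fun m => Nat.beq n m) false)
  (fun n u => caseUniv u (fun m => Nat.beq n m) false)
  (fun _ _ f g u => casePi u (fun A B => caseBool (f A) (g B) false) false)
  (fun _ _ f g u => caseLam u (fun A B => caseBool (f A) (g B) false) false)
  (fun _ _ f g u => caseApp u (fun A B => caseBool (f A) (g B) false) false)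
  (fun c u => caseConst u (fun c' => Nat.beq c.ctorIdx c'.ctorIdx) false) t

/-- Syntactic equality of lists. -/
def beqList (as : List Tm) : List Tm → Bool := List.rec
  (fun bs => caseList bs true fun _ _ => false)
  (fun a _ ih bs => caseList bs false fun b bs => caseBool (beq a b) (ih bs) false) as

/-- Raises the variables from `c` on by `k`. -/
def shift (k : ℕ) (t : Tm) : ℕ → Tm := Tm.rec
  (fun n c => caseBool (Nat.ble c n) (var (n.add k)) (var n)) (fun n _ => univ n)
  (fun _ _ f g c => pi (f c) (g c.succ))
  (fun _ _ f g c => lam (f c) (g c.succ))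
  (fun _ _ f g c => app (f c) (g c)) (fun a _ => const a) t

/-- Substitutes the entries of `σ` for the variables from `c` on. -/
def instAux (σ : List Tm) (t : Tm) : ℕ → Tm := Tm.rec
  (fun n c => caseBool (Nat.ble c n)
    (caseOpt (nth σ (n.sub c)) (fun a => shift c a 0) (var (n.sub σ.length))) (var n))
  (fun n _ => univ n)
  (fun _ _ f g c => pi (f c) (g c.succ))
  (fun _ _ f g c => lam (f c) (g c.succ))
  (fun _ _ f g c => app (f c) (g c)) (fun a _ => const a) t

/-- Substitutes the entries of `σ` for the first variables. -/
def insts (σ : List Tm) (t : Tm) : Tm := caseList σ t fun a σ => instAux (a :: σ) t 0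

/-- Head and arguments of an application. -/
def spine (t : Tm) : List Tm → Tm × List Tm := Tm.rec
  (fun n as => (var n, as)) (fun n as => (univ n, as)) (fun A B _ _ as => (pi A B, as))
  (fun A b _ _ as => (lam A b, as)) (fun _ a f _ as => f (a :: as)) (fun c as => (const c, as)) t

/-- Iterated application. -/
def apps (f : Tm) (as : List Tm) : Tm := as.foldl app f

/-- Are all variables of a term among the first `c`, and all its global constants among the first
`n`? -/
def bounded (n : ℕ) (t : Tm) : ℕ → Bool := Tm.rec (fun m c => Nat.ble m.succ c)
  (fun i _ => Nat.ble i (n + 7))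
  (fun _ _ f g c => caseBool (f c) (g c.succ) false)
  (fun _ _ f g c => caseBool (f c) (g c.succ) false)
  (fun _ _ f g c => caseBool (f c) (g c) false) (fun _ _ => true) t

/-- The first `n` domains of an iterated function type, and the remaining codomain. -/
def splitPi (n : ℕ) : Tm → List Tm × Tm := Nat.rec (fun t => ([], t))
  (fun _ ih t => casePi t (fun A B => (A :: (ih B).1, (ih B).2)) ([], t)) n

/-- The first `n` domains of an iterated abstraction, and its body. -/
def splitLam (n : ℕ) : Tm → List Tm × Tm := Nat.rec (fun t => ([], t))
  (fun _ ih t => caseLam t (fun A b => (A :: (ih b).1, (ih b).2)) ([], t)) n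

/-- The number of leading abstractions. -/
def numLams (t : Tm) : ℕ := Tm.rec (fun _ => 0) (fun _ => 0) (fun _ _ _ _ => 0)
  (fun _ _ _ n => n + 1) (fun _ _ _ _ => 0) (fun _ => 0) t

/-- The universe at the end of iterated function types. -/
def codLevel (t : Tm) : ℕ := Tm.rec (fun _ => 4) (fun i => i) (fun _ _ _ n => n) (fun _ _ _ _ => 4)
  (fun _ _ _ _ => 4) (fun _ => 4) t

end Tm

open Tm

/-- A global constant: its type, its value, and if the checker may unfold it, the number of
arguments that this takes. -/
structure Entry where
  type : Tm
  value : Tm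
  arity : Option ℕ

/-- The entry of the `k`-th global constant; the last entry comes first. -/
def lookup (L : List Entry) (k : ℕ) : Option Entry :=
  List.rec none (fun e L ih => caseBool (Nat.beq k L.length) (some e) ih) L

def caseEntry {R : Type} (e : Entry) (k : Tm → Tm → Option ℕ → R) : R := Entry.rec k e

/-- Telescope, sides and type of a computation rule. -/
def Rule.raw (r : Rule) : ℕ → List Tm × Tm × Tm × Tm := Rule.rec
  (fun A _ ih d => (A d :: (ih (Exp.bound d) (d + 1)).1, (ih (Exp.bound d) (d + 1)).2))
  (fun l r T d => ([], l d, r d, T d)) r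

/-- How the universe levels of an applied constant are found: the arguments whose levels are to be
joined, the type family among the arguments that are formed, and the motive. -/
structure LevelInfo where
  types : List ℕ
  family : Option ℕ
  motive : Option ℕ

/-- The levels found in this way are only a guess. A constant has its type at every level, so a
wrong guess can make the checker reject, but never accept something underivable. -/
def levelInfo : Const → LevelInfo
  | .sum => ⟨[0, 1], none, none⟩
  | .id => ⟨[0], none, none⟩
  | .push => ⟨[0, 1, 2], none, none⟩
  | .trunc => ⟨[1], none, none⟩
  | .sigma => ⟨[0], some 1, none⟩
  | .pair => ⟨[], some 1, none⟩
  | .sigmaInd => ⟨[], some 1, some 2⟩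
  | .emptyInd => ⟨[], none, some 0⟩
  | .unitInd => ⟨[], none, some 0⟩
  | .natInd => ⟨[], none, some 0⟩
  | .sumInd => ⟨[], none, some 2⟩
  | .pathInd => ⟨[], none, some 2⟩
  | .pushInd => ⟨[], none, some 5⟩
  | .pushIndGlue => ⟨[], none, some 5⟩
  | .truncInd => ⟨[], none, some 2⟩
  | .truncIndSpoke => ⟨[], none, some 2⟩
  | _ => ⟨[], none, none⟩

/-- For an eliminator: the number of its arguments that are arguments of the computation rules,
and the position of the argument that is analysed. -/
def elimArity : Const → Option (ℕ × ℕ)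
  | .unitInd => some (2, 2)
  | .sumInd => some (5, 5)
  | .natInd => some (3, 3)
  | .sigmaInd => some (4, 4)
  | .pathInd => some (4, 5)
  | .pushInd => some (9, 9)
  | .truncInd => some (6, 6)
  | _ => none

/-- The number of the computation rule for an eliminator and a constructor, and the number of
parameters of the constructor. -/
def ruleIndex : Const → Const → Option (ℕ × ℕ)
  | .unitInd, .star => some (0, 0)
  | .sumInd, .inl => some (1, 2)
  | .sumInd, .inr => some (2, 2)
  | .natInd, .zero => some (3, 0)
  | .natInd, .succ => some (4, 0)
  | .sigmaInd, .pair => some (5, 2)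
  | .pathInd, .refl => some (6, 2)
  | .pushInd, .pushInl => some (7, 5)
  | .pushInd, .pushInr => some (8, 5)
  | .truncInd, .truncIn => some (9, 2)
  | .truncInd, .hub => some (10, 2)
  | _, _ => none

def evalConst (i j : ℕ) (c : Const) : Option Tm := force (constType i j c).close some

/-- A computation rule: telescope, sides and type. -/
inductive RawRule
  | mk (Δ : List Tm) (l r T : Tm)

def caseRule {R : Type} (r : RawRule) (k : List Tm → Tm → Tm → Tm → R) : R := RawRule.rec k r

def evalRule (i j k : ℕ) : Option RawRule :=
  caseOpt (nth (computation i j) k) (fun r => casePair (r.raw 0) fun Δ p => casePair p fun l p =>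
    casePair p fun r T => forceList Δ fun Δ => force l fun l => force r fun r => force T fun T =>
      some ⟨Δ, l, r, T⟩) none

def larger (i j : ℕ) : ℕ := caseBool (Nat.ble i j) j i

/-- The functions of the checker. -/
structure Checker where
  /-- The type of a term. -/
  infer : List Tm → Tm → Option Tm
  /-- Does the term have the type? -/
  check : List Tm → Tm → Tm → Bool
  /-- Weak head normal form, with the type at which it is equal to the term, or with no type if
  it is the term itself. -/
  red : List Tm → Tm → Tm × Option Tm
  /-- A type at which the terms are equal. -/
  equal : List Tm → Tm → Tm → Option Tm
  /-- Are the terms equal at the type? -/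
  checkEqual : List Tm → Tm → Tm → Tm → Bool

namespace Checker

variable (F : Checker)

/-- The universe that a type is equal to. -/
def asUniv (Γ : List Tm) (K : Tm) : Option ℕ :=
  caseUniv K (fun n => caseBool (Nat.ble n 7) (some n) none) <|
    casePair (F.red Γ K) fun K' o => caseUniv K' (fun n => caseBool (Nat.ble n 7)
      -- The equality of `K` with its reduct may be used to convert types only if it holds in a
      -- universe.
      (caseOpt o
        (fun L => caseUniv L (fun m => caseBool (Nat.ble m 7) (some n) none) none) (some n)) none)
      none

/-- The dependent function type that a type is equal to. -/
def asPi {R : Type} (Γ : List Tm) (K : Tm) (k : Tm → Tm → R) (d : R) : R :=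
  casePi K k <|
    casePair (F.red Γ K) fun K' o => casePi K' (fun A B => caseOpt o
      (fun L => caseOpt (F.asUniv Γ L) (fun _ => k A B) d) (k A B)) d

/-- The universe of a type. -/
def level (Γ : List Tm) (A : Tm) : Option ℕ :=
  caseOpt (F.infer Γ A) (fun K => F.asUniv Γ K) none

/-- The universe in which two types are equal. -/
def equalTypes (Γ : List Tm) (A B : Tm) : Option ℕ :=
  caseOpt (F.equal Γ A B) (fun K => F.asUniv Γ K) none

/-- Is every term of type `(x : A') → B` also of type `(x : A) → B`? -/
def subDomain (Γ : List Tm) (A' A B : Tm) : Bool :=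
  caseBool (beq A' A) true <| caseOpt (F.equalTypes Γ A' A)
    (fun _ => caseOpt (F.level (A' :: Γ) B) (fun _ => true) false) false

/-- Is every term of type `S` also of type `T`? -/
def sub (Γ : List Tm) (S T : Tm) : Bool :=
  caseBool (beq S T) true <|
  caseBool (caseUniv S (fun n => caseUniv T (fun m =>
    caseBool (Nat.ble n m) (Nat.ble m 7) false) false) false) true <|
  caseOpt (F.equalTypes Γ S T) (fun _ => true) <|
  caseOpt (F.asUniv Γ S) (fun n => caseOpt (F.asUniv Γ T) (fun m => Nat.ble n m) false) false

/-- The type of `f as` for `f` of type `T[σ]`. -/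
def inferArgs (Γ as : List Tm) : Tm → List Tm → Option Tm := List.rec
  (fun T σ => force (insts σ T) some)
  (fun a _ ih T σ => casePi T
    (fun A B => force (insts σ A) fun A => caseBool (F.check Γ a A) (ih B (a :: σ)) none)
    (force (insts σ T) fun T => F.asPi Γ T
      (fun A B => caseBool (F.check Γ a A) (ih B [a]) none) none)) as

/-- The type at which `f as` and `f bs` are equal for `f` of type `T[σ]`. -/
def equalArgs (Γ as : List Tm) : List Tm → Tm → List Tm → Option Tm := List.rec
  (fun bs T σ => caseList bs (force (insts σ T) some) fun _ _ => none)
  (fun a _ ih bs T σ => caseList bs none fun b bs => casePi T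
    (fun A B => force (insts σ A) fun A => caseBool (F.checkEqual Γ a b A) (ih bs B (a :: σ)) none)
    (force (insts σ T) fun T => F.asPi Γ T
      (fun A B => caseBool (F.checkEqual Γ a b A) (ih bs B [a]) none) none)) as

/-- Is `as` an instance of the telescope `Δ[σ]`?  The instance is added to `σ`. -/
def checkTelescope (Γ Δ : List Tm) : List Tm → List Tm → Option (List Tm) := List.rec
  (fun as σ => caseList as (some σ) fun _ _ => none)
  (fun A _ ih as σ => caseList as none fun a as =>
    force (insts σ A) fun A => caseBool (F.check Γ a A) (ih as (a :: σ)) none) Δ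

/-- The level at which a type family is to be used. -/
def famLevel (Γ : List Tm) (B : Tm) : ℕ :=
  caseLam B (fun _ _ => 4) (caseOpt (F.infer Γ B) codLevel 4)

/-- The default 4 is the largest code at which the computation rules are verified. -/
def levelOr (Γ : List Tm) (A : Tm) : ℕ := caseOpt (F.level Γ A) (fun n => n) 4

/-- The joint level of some of the arguments. -/
def argsLevel (Γ args : List Tm) (ps : List ℕ) : ℕ :=
  ps.foldr (fun p n => caseOpt (nth args p) (fun A => larger (F.levelOr Γ A) n) n) 0

/-- The universe levels for a constant that is applied to `args`. -/
def levels (Γ : List Tm) (i : LevelInfo) (args : List Tm) : ℕ × ℕ :=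
  (caseOpt i.family (fun p => caseOpt (nth args p) (fun B => caseList i.types (F.famLevel Γ B)
      fun _ _ => caseLam B
        (fun A b => larger (F.argsLevel Γ args i.types) (F.levelOr (A :: Γ) b))
        (F.famLevel Γ B)) 4)
    (caseList i.types 4 fun _ _ => F.argsLevel Γ args i.types),
   caseOpt i.motive (fun p => caseOpt (nth args p) (F.famLevel Γ) 4) 4)

def inferUniv (L : List Entry) (n : ℕ) : Option Tm :=
  caseBool (Nat.ble n 7)
    -- Code 0 is the universe 0, and code 1 may denote the same universe, so the least code that is
    -- sure to lie above code 0 is 2.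
    (caseBool (Nat.beq n 0) (force (.univ 2) some)
      (caseBool (Nat.ble n 6) (force (.univ n.succ) some) none))
    (caseOpt (lookup L (n.sub 8)) (fun e => caseEntry e fun T _ _ => some T) none)

def inferPi (Γ : List Tm) (A B : Tm) : Option Tm :=
  caseOpt (F.level Γ A) (fun i => caseOpt (F.level (A :: Γ) B)
    (fun j => force (.univ (larger i j)) some) none) none

def inferLam (Γ : List Tm) (A b : Tm) : Option Tm :=
  caseOpt (F.level Γ A) (fun _ => caseOpt (F.infer (A :: Γ) b)
    (fun B => some (.pi A B)) none) none

def inferConst (Γ args : List Tm) (c : Const) : Option Tm :=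
  casePair (F.levels Γ (levelInfo c) args) fun i j => forceNat i fun i => forceNat j fun j =>
    caseBool (Nat.ble i 7) (caseBool (Nat.ble j 7) (evalConst i j c) none) none

/-- The type of a head that is not an application. -/
def inferHead (L : List Entry) (Γ : List Tm) (h : Tm) (args : List Tm) : Option Tm :=
  caseHead h (fun n => caseOpt (nth Γ n) (fun A => force (shift n.succ A 0) some) none)
    (inferUniv L) (F.inferPi Γ) (F.inferLam Γ) (F.inferConst Γ args) none

/-- A type at which two equalities can be composed. -/
def join (Γ : List Tm) (S T : Tm) : Option Tm :=
  caseBool (F.sub Γ S T) (some T) (caseBool (F.sub Γ T S) (some S) none)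

/-- The computation rule `k` for the instance `args`, applied to the term `t`. -/
def stepRule (Γ : List Tm) (i j k : ℕ) (args : List Tm) (t : Tm) : Option (Tm × Tm) :=
  caseBool (Nat.ble i 4) (caseBool (Nat.ble j 4)
    (caseOpt (evalRule i j k) (fun r => caseRule r fun Δ l r T =>
      caseOpt (F.checkTelescope Γ Δ args [])
      -- The analysed argument may become a constructor only after reduction. Then `t` is not
      -- literally the left-hand side of the rule, and their equality has to be checked.
      (fun σ => caseBool (beq t (insts σ l)) (some (insts σ r, insts σ T))
        (force t fun t => force (insts σ l) fun l => force (insts σ T) fun T =>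
          caseOpt (F.equal Γ t l) (fun S =>
            caseBool (F.sub Γ S T) (some (insts σ r, T)) none) none)) none) none)
    none) none

/-- A step of weak head reduction for an applied eliminator: the reduct, its type, and the remaining
arguments. -/
def stepConst (Γ : List Tm) (c : Const) (as : List Tm) : Option (Tm × Tm × List Tm) :=
  caseOpt (elimArity c) (fun np => casePair np fun n p => caseOpt (nth as p) (fun x =>
    casePair (F.red Γ x) fun x' _ => casePair (spine x' []) fun h bs =>
    caseConst h (fun k => caseOpt (ruleIndex c k) (fun rn => casePair rn fun r q =>
      casePair (F.levels Γ (levelInfo c) as) fun i j => forceNat i fun i => forceNat j fun j =>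
      caseOpt (F.stepRule Γ i j r (as.take n ++ bs.drop q) (apps (.const c) (as.take (p + 1))))
        (fun r => casePair r fun r T => some (r, T, as.drop (p + 1))) none) none) none) none) none

/-- Reduction of `t[σ] as` for a term `t` in the context `Δ`, where `σ` consists of terms in the
context `Γ`: the reduct, its type, and the remaining arguments. -/
def stepBeta (Γ as : List Tm) : List Tm → Tm → List Tm → Option (Tm × Tm × List Tm) := List.rec
  (fun Δ t σ => caseOpt (F.infer Δ t) (fun B => some (insts σ t, insts σ B, [])) none)
  (fun a as ih Δ t σ => caseLam t
    (fun A b => caseOpt (F.level Δ A) (fun _ => force (insts σ A) fun A' =>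
      caseBool (F.check Γ a A') (ih (A :: Δ) b (a :: σ)) none) none)
    (caseOpt (F.infer Δ t) (fun B => some (insts σ t, insts σ B, a :: as)) none)) as

/-- Unfolding of a global constant. -/
def stepGlobal (Γ : List Tm) (e : Entry) (as : List Tm) : Option (Tm × Tm × List Tm) :=
  caseEntry e fun T v o => caseOpt o (fun n =>
    casePair (splitPi n T) fun Δ T => casePair (splitLam n v) fun _ b =>
    caseOpt (F.checkTelescope Γ Δ (as.take n) [])
      (fun σ => some (insts σ b, insts σ T, as.drop n)) none) none

/-- One step of weak head reduction of `h as`, with a type of both sides.  The computation rules are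
not used in the empty environment. -/
def step (L : List Entry) (Γ : List Tm) (h : Tm) (as : List Tm) : Option (Tm × Tm) :=
  caseOpt (caseHead h (fun _ => none)
    (fun n => caseBool (Nat.ble n 7) none
      (caseOpt (lookup L (n.sub 8)) (fun e => F.stepGlobal Γ e as) none))
    (fun _ _ => none)
    (fun A b => caseList as none fun a as => F.stepBeta Γ (a :: as) Γ (.lam A b) [])
    (fun c => caseList L none fun _ _ => F.stepConst Γ c as) none)
  (fun r => casePair r fun r p => casePair p fun T as => force T fun T =>
    caseOpt (F.inferArgs Γ as T []) (fun T => force (apps r as) fun r => some (r, T)) none) none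

/-- Structural comparison of two terms with the same head. -/
def equalSpines (L : List Entry) (Γ : List Tm) (t u : Tm) : Option Tm :=
  casePair (spine t []) fun h as => casePair (spine u []) fun h' bs =>
  caseLam h (fun _ _ => none) <| casePi h (fun _ _ => none) <| caseBool (beq h h')
    (caseOpt (F.inferHead L Γ h as) (fun T => F.equalArgs Γ as bs T []) none) none

/-- Comparison of an abstraction with a term that is not an abstraction. -/
def equalEta (Γ : List Tm) (A b u : Tm) : Option Tm :=
  caseOpt (F.level Γ A) (fun _ => caseOpt (F.infer Γ u) (fun U => F.asPi Γ U
    (fun A' B => caseOpt (F.equalTypes Γ A A') (fun _ => force (.app (shift 1 u 0) (.var 0)) fun u =>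
      caseOpt (F.equal (A :: Γ) b u) (fun B' =>
        caseOpt (F.equalTypes (A :: Γ) B B') (fun _ => some (.pi A B')) none) none) none) none) none)
    none

/-- Structural comparison of two terms. -/
def equalWhnf (L : List Entry) (Γ : List Tm) (t u : Tm) : Option Tm :=
  casePi t
    (fun A B => casePi u
      (fun A' B' => caseOpt (F.level Γ A) (fun i => caseOpt (F.equalTypes Γ A A') (fun i' =>
        caseOpt (F.equalTypes (A :: Γ) B B') (fun j => force (.univ (larger i (larger i' j))) some)
          none) none) none) none) <|
  caseLam t
    (fun A b => caseLam u
      (fun A' b' => caseOpt (F.level Γ A) (fun _ => caseOpt (F.equalTypes Γ A A') (fun _ =>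
        caseOpt (F.equal (A :: Γ) b b') (fun B => some (.pi A B)) none) none) none)
      (F.equalEta Γ A b u)) <|
  caseLam u (fun A b => F.equalEta Γ A b t) <|
  F.equalSpines L Γ t u

/-- The equality `t = t' = u' = u`, where the three equalities hold at the given types. -/
def chain (Γ : List Tm) (o : Option Tm) (T : Tm) (o' : Option Tm) : Option Tm :=
  caseOpt (caseOpt o (fun S => F.join Γ S T) (some T))
    (fun T => caseOpt o' (fun S => F.join Γ S T) (some T)) none

/-- Which of two terms is reduced first?  An abstraction with arguments, and next the later one of
the globals that can be unfolded. -/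
def rank (L : List Entry) (h : Tm) (as : List Tm) : ℕ := caseHead h (fun _ => 0)
  (fun n => caseBool (Nat.ble n 7) 0
    (caseOpt (lookup L (n.sub 8)) (fun e => caseEntry e fun _ _ o => caseOpt o (fun _ => n) 0) 0))
  (fun _ _ => 0) (fun _ _ => caseList as 0 fun _ _ => 100000) (fun _ => 0) 0

/-- Comparison after weak head reduction. -/
def equalRed (L : List Entry) (Γ : List Tm) (t u : Tm) : Option Tm :=
  casePair (F.red Γ t) fun t' o => casePair (F.red Γ u) fun u' o' =>
    caseOpt (caseBool (beq t' u') (F.infer Γ t') (F.equalWhnf L Γ t' u'))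
      (fun T => F.chain Γ o T o') none

/-- Comparison of two terms that are not equal argument by argument. -/
def equalStep (L : List Entry) (Γ : List Tm) (t u : Tm) : Option Tm :=
  casePair (spine t []) fun h as => casePair (spine u []) fun h' bs =>
  forceNat (rank L h as) fun m => forceNat (rank L h' bs) fun n =>
  caseBool (Nat.ble (larger m n) 0) (F.equalRed L Γ t u) <|
  caseBool (Nat.ble n m)
    (caseOpt (F.step L Γ h as) (fun r => casePair r fun r T =>
      caseOpt (F.equal Γ r u) (fun S => F.join Γ S T) none) (F.equalRed L Γ t u))
    (caseOpt (F.step L Γ h' bs) (fun r => casePair r fun r T =>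
      caseOpt (F.equal Γ t r) (fun S => F.join Γ S T) none) (F.equalRed L Γ t u))

/-- The functions of the checker with one more unit of fuel. -/
def next (L : List Entry) : Checker where
  infer Γ t := casePair (spine t []) fun h as => caseOpt (F.inferHead L Γ h as)
    (fun T => F.inferArgs Γ as T []) none
  check Γ a A := caseLam a
    (fun A' b => F.asPi Γ A (fun A B => caseOpt (F.level Γ A')
      (fun _ => caseBool (F.check (A' :: Γ) b B) (F.subDomain Γ A' A B) false) false) false) <|
    -- The constant stands alone, without arguments that would show its level; the level is read off
    -- from the domain of the expected type. There is no motive, so the second level is arbitrary.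
    caseBool (beq a (.const .univalence)) (casePi A (fun D _ => caseUniv D (fun n =>
      caseBool (Nat.ble n 7) (caseOpt (evalConst n 0 .univalence) (fun T => F.sub Γ T A) false)
        false) false) false) <|
    caseOpt (F.infer Γ a) (fun A' => F.sub Γ A' A) false
  red Γ t := casePair (spine t []) fun h as => caseOpt (F.step L Γ h as)
    (fun r => casePair r fun r T => casePair (F.red Γ r) fun r' o => caseOpt o
      -- Two equalities compose only at a common type. If none is found, the result is the reduct
      -- after one step.
      (fun T' => caseOpt (F.join Γ T' T) (fun T => (r', some T)) (r, some T))
      (r, some T))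
    (t, none)
  equal Γ t u := caseBool (beq t u) (F.infer Γ t) <|
    caseOpt (F.equalSpines L Γ t u) some <| F.equalStep L Γ t u
  checkEqual Γ t u A := caseBool (beq t u) (F.check Γ t A) <|
    caseLam t
      (fun A' b => caseLam u
        (fun A'' b' => F.asPi Γ A (fun A B => caseOpt (F.level Γ A') (fun _ =>
          caseBool (F.subDomain Γ A' A B)
            (caseOpt (F.equalTypes Γ A' A'') (fun _ => F.checkEqual (A' :: Γ) b b' B) false) false)
          false) false)
        (caseOpt (F.equal Γ t u) (fun T => F.sub Γ T A) false))
      (caseOpt (F.equal Γ t u) (fun T => F.sub Γ T A) false)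

end Checker

/-- The checker with the environment `L` and `n` units of fuel. -/
def checker (L : List Entry) (n : ℕ) : Checker := Nat.rec
  ⟨fun _ _ => none, fun _ _ _ => false, fun _ t => (t, none), fun _ _ _ => none,
    fun _ _ _ _ => false⟩ (fun _ F => F.next L) n

/-- May the entry be added to the environment? -/
def Entry.ok (L : List Entry) (e : Entry) : Bool :=
  caseBool (bounded L.length e.type 0) (caseBool (bounded L.length e.value 0)
    (caseOpt ((checker L 1000).level [] e.type)
      (fun _ => caseBool ((checker L 1000).check [] e.value e.type)
        (caseOpt e.arity (fun n => caseBool (beqList (splitPi n e.type).1 (splitLam n e.value).1)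
          (Nat.beq (splitPi n e.type).1.length n) false) true) false) false) false) false

end

end HoTT

namespace HoTT

open Judgment Tm

/-! ## The functions of the checker in terms of the usual ones -/

theorem caseBool_eq_some {α : Type} {b : Bool} {y : Option α} {x : α} :
    caseBool b y none = some x ↔ b = true ∧ y = some x := by
  cases b <;> simp [caseBool]

theorem caseBool_eq_true {b y : Bool} : caseBool b y false = true ↔ b = true ∧ y = true := by
  cases b <;> simp [caseBool]

theorem caseBool_true_eq_true {b y : Bool} :
    caseBool b true y = true ↔ b = true ∨ y = true := by
  cases b <;> simp [caseBool]

theorem caseOpt_eq_some {α β : Type} {o : Option α} {s : α → Option β} {x : β} :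
    caseOpt o s none = some x ↔ ∃ a, o = some a ∧ s a = some x := by
  cases o <;> simp [caseOpt]

theorem caseOpt_eq_true {α : Type} {o : Option α} {s : α → Bool} :
    caseOpt o s false = true ↔ ∃ a, o = some a ∧ s a = true := by
  cases o <;> simp [caseOpt]

theorem casePair_eq {α β R : Type} (p : α × β) (k : α → β → R) : casePair p k = k p.1 p.2 := rfl

theorem forceNat_eq {R : Type} (n : ℕ) (k : ℕ → R) : forceNat n k = k n := by
  cases n <;> rfl

theorem nth_eq {α : Type} (l : List α) (n : ℕ) : nth l n = l[n]? := by
  induction l generalizing n with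
  | nil => rfl
  | cons a l ih =>
    cases n with
    | zero => rfl
    | succ n => exact (ih n).trans (by simp)

theorem larger_eq (m n : ℕ) : larger m n = max m n := by
  unfold larger
  rcases h : Nat.ble m n
  · have : ¬ m ≤ n := fun h' => by simp [Nat.ble_eq.mpr h'] at h
    simp [caseBool]; omega
  · have := Nat.ble_eq.mp h
    simp [caseBool]; omega

namespace Tm

theorem caseUniv_ne {R : Type} {t : Tm} {k : ℕ → R} {d r : R} (h : caseUniv t k d = r)
    (hr : r ≠ d) : ∃ n, t = univ n ∧ k n = r := by
  cases t <;> first | exact absurd h.symm hr | exact ⟨_, rfl, h⟩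

theorem casePi_ne {R : Type} {t : Tm} {k : Tm → Tm → R} {d r : R} (h : casePi t k d = r)
    (hr : r ≠ d) : ∃ A B, t = pi A B ∧ k A B = r := by
  cases t <;> first | exact absurd h.symm hr | exact ⟨_, _, rfl, h⟩

theorem force_eq {R : Type} (t : Tm) (k : Tm → R) : t.force k = k t := by
  induction t generalizing R with
  | var n => exact forceNat_eq n fun n => k (var n)
  | univ n => exact forceNat_eq n fun n => k (univ n)
  | pi A B ihA ihB => exact (ihA _).trans (ihB _)
  | lam A B ihA ihB => exact (ihA _).trans (ihB _)
  | app A B ihA ihB => exact (ihA _).trans (ihB _)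
  | const => rfl

theorem forceList_eq {R : Type} (l : List Tm) (k : List Tm → R) : forceList l k = k l := by
  induction l generalizing R with
  | nil => rfl
  | cons a l ih => exact (force_eq a _).trans (ih _)

theorem eq_of_beq {t u : Tm} (h : beq t u = true) : t = u := by
  induction t generalizing u with
  | var n =>
    cases u with
    | var m => exact congrArg var (Nat.eq_of_beq_eq_true h)
    | _ => exact absurd h Bool.false_ne_true
  | univ n =>
    cases u with
    | univ m => exact congrArg univ (Nat.eq_of_beq_eq_true h)
    | _ => exact absurd h Bool.false_ne_true
  | pi A B ihA ihB =>
    cases u with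
    | pi => exact congrArg₂ pi (ihA (caseBool_eq_true.mp h).1) (ihB (caseBool_eq_true.mp h).2)
    | _ => exact absurd h Bool.false_ne_true
  | lam A B ihA ihB =>
    cases u with
    | lam => exact congrArg₂ lam (ihA (caseBool_eq_true.mp h).1) (ihB (caseBool_eq_true.mp h).2)
    | _ => exact absurd h Bool.false_ne_true
  | app A B ihA ihB =>
    cases u with
    | app => exact congrArg₂ app (ihA (caseBool_eq_true.mp h).1) (ihB (caseBool_eq_true.mp h).2)
    | _ => exact absurd h Bool.false_ne_true
  | const c =>
    cases u with
    | const c' =>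
      have : c.ctorIdx = c'.ctorIdx := Nat.eq_of_beq_eq_true h
      revert this
      cases c <;> cases c' <;> first | exact fun _ => rfl | exact fun h => absurd h (by decide)
    | _ => exact absurd h Bool.false_ne_true

theorem eq_of_beqList {l m : List Tm} (h : beqList l m = true) : l = m := by
  induction l generalizing m with
  | nil => cases m <;> first | rfl | exact absurd h Bool.false_ne_true
  | cons a l ih =>
    cases m with
    | nil => exact absurd h Bool.false_ne_true
    | cons b m =>
      have := caseBool_eq_true.mp h
      rw [eq_of_beq this.1, ih this.2]

/-- The renaming that raises the variables from `c` on by `k`. -/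
def liftFrom (k c : ℕ) (n : ℕ) : ℕ := if c ≤ n then n + k else n

theorem shift_eq (k : ℕ) (t : Tm) (c : ℕ) : shift k t c = t.rename (liftFrom k c) := by
  have lift : ∀ c, liftRen (liftFrom k c) = liftFrom k (c + 1) := fun c => funext fun n => by
    cases n with
    | zero => simp [liftRen, liftFrom]
    | succ n => simp only [liftRen, liftFrom]; split_ifs <;> omega
  induction t generalizing c with
  | var n =>
    show caseBool (Nat.ble c n) (var (n.add k)) (var n) = var (liftFrom k c n)
    unfold liftFrom
    rcases h : Nat.ble c n
    · rw [if_neg fun h' => by simp [Nat.ble_eq.mpr h'] at h]; rfl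
    · rw [if_pos (Nat.ble_eq.mp h)]; rfl
  | pi A B ihA ihB => exact congrArg₂ pi (ihA c) ((ihB _).trans (by rw [← lift]))
  | lam A B ihA ihB => exact congrArg₂ lam (ihA c) ((ihB _).trans (by rw [← lift]))
  | app A B ihA ihB => exact congrArg₂ app (ihA c) (ihB c)
  | _ => rfl

theorem shift_zero (k : ℕ) (t : Tm) : shift k t 0 = t.rename (· + k) := by
  rw [shift_eq]
  exact rename_ext (fun n => by simp [liftFrom]) t

/-- The substitution of the entries of a list for the first variables. -/
def toSub : List Tm → ℕ → Tm
  | [] => var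
  | a :: σ => Tm.cons a (toSub σ)

theorem toSub_apply (σ : List Tm) (n : ℕ) :
    toSub σ n = caseOpt (nth σ n) (fun a => a) (var (n - σ.length)) := by
  induction σ generalizing n with
  | nil => rfl
  | cons a σ ih =>
    cases n with
    | zero => rfl
    | succ n =>
      simp only [toSub, Tm.cons, ih, List.length_cons, Nat.add_sub_add_right]
      rfl

/-- A substitution under `c` binders. -/
def liftSubs (σ : ℕ → Tm) : ℕ → ℕ → Tm
  | 0 => σ
  | c + 1 => liftSub (liftSubs σ c)

theorem liftSubs_apply (σ : ℕ → Tm) (c n : ℕ) :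
    liftSubs σ c n = if c ≤ n then (σ (n - c)).rename (· + c) else var n := by
  induction c generalizing n with
  | zero =>
    simp only [liftSubs, Nat.zero_le, if_true, Nat.sub_zero, Nat.add_zero]
    rw [rename_eq_subst]
    exact (subst_var _ fun _ => rfl).symm
  | succ c ih =>
    cases n with
    | zero => rfl
    | succ n =>
      simp only [liftSubs, liftSub, ih, Nat.add_le_add_iff_right, Nat.add_sub_add_right]
      split_ifs
      · rw [rename_rename]
        exact rename_ext (fun n => by omega) _
      · rfl

theorem instAux_eq (σ : List Tm) (t : Tm) (c : ℕ) :
    instAux σ t c = t.subst (liftSubs (toSub σ) c) := by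
  induction t generalizing c with
  | var n =>
    show caseBool (Nat.ble c n) (caseOpt (nth σ (n.sub c)) (fun a => shift c a 0)
      (var (n.sub σ.length))) (var n) = liftSubs (toSub σ) c n
    rw [liftSubs_apply, toSub_apply]
    rcases h : Nat.ble c n
    · rw [if_neg fun h' => by simp [Nat.ble_eq.mpr h'] at h]; rfl
    · have hc := Nat.ble_eq.mp h
      rw [if_pos hc]
      show caseOpt (nth σ (n - c)) _ (var (n - σ.length)) = _
      rcases h' : nth σ (n - c) with _ | a
      · rw [nth_eq, List.getElem?_eq_none_iff] at h'
        exact congrArg var (show n - σ.length = n - c - σ.length + c by omega)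
      · exact shift_zero c a
  | pi A B ihA ihB => exact congrArg₂ pi (ihA c) (ihB _)
  | lam A B ihA ihB => exact congrArg₂ lam (ihA c) (ihB _)
  | app A B ihA ihB => exact congrArg₂ app (ihA c) (ihB c)
  | _ => rfl

theorem insts_eq (σ : List Tm) (t : Tm) : insts σ t = t.subst (toSub σ) := by
  cases σ with
  | nil => exact (subst_var t fun _ => rfl).symm
  | cons a σ => exact instAux_eq _ t 0

theorem apps_append (f : Tm) (as bs : List Tm) : apps f (as ++ bs) = apps (apps f as) bs :=
  List.foldl_append

theorem apps_spine (t : Tm) (as : List Tm) : apps (spine t as).1 (spine t as).2 = apps t as := by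
  induction t generalizing as with
  | app f a ihf _ => exact ihf (a :: as)
  | _ => rfl

theorem eq_apps_spine (t : Tm) : t = apps (spine t []).1 (spine t []).2 := (apps_spine t []).symm

/-- Iterated function type. -/
def pis (Δ : List Tm) (T : Tm) : Tm := Δ.foldr pi T

/-- Iterated abstraction. -/
def lams (Δ : List Tm) (b : Tm) : Tm := Δ.foldr lam b

theorem pis_splitPi (n : ℕ) (t : Tm) : pis (splitPi n t).1 (splitPi n t).2 = t := by
  induction n generalizing t with
  | zero => rfl
  | succ n ih =>
    cases t with
    | pi A B => exact congrArg (pi A) (ih B)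
    | _ => rfl

theorem lams_splitLam (n : ℕ) (t : Tm) : lams (splitLam n t).1 (splitLam n t).2 = t := by
  induction n generalizing t with
  | zero => rfl
  | succ n ih =>
    cases t with
    | lam A b => exact congrArg (lam A) (ih b)
    | _ => rfl

end Tm

theorem Rule.close_raw (r : Rule) (d : ℕ) :
    r.lhs d = lams (r.raw d).1 (r.raw d).2.1 ∧ r.rhs d = lams (r.raw d).1 (r.raw d).2.2.1 ∧
      r.type d = pis (r.raw d).1 (r.raw d).2.2.2 := by
  induction r generalizing d with
  | all A r ih =>
    obtain ⟨h₁, h₂, h₃⟩ := ih (Exp.bound d) (d + 1)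
    exact ⟨congrArg (lam (A d)) h₁, congrArg (lam (A d)) h₂, congrArg (pi (A d)) h₃⟩
  | eqn l r T => exact ⟨rfl, rfl, rfl⟩

/-! ## The interpretation of codes -/

/-- A lowest universe for the codes, and the values of the global constants. -/
structure Model where
  base : ℕ
  val : ℕ → Tm
  closed : ∀ k, (val k).Closed

namespace Model

variable (M : Model)

/-- The universe with the code `n`. -/
def code : ℕ → ℕ
  | 0 => 0
  | n + 1 => M.base + n

/-- The term with the given code. -/
def interp : Tm → Tm
  | var n => var n
  | univ n => if n ≤ 7 then univ (M.code n) else M.val (n - 8)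
  | pi A B => pi (interp A) (interp B)
  | lam A b => lam (interp A) (interp b)
  | app f a => app (interp f) (interp a)
  | const c => const c

theorem interp_univ {n : ℕ} (hn : n ≤ 7) : M.interp (univ n) = univ (M.code n) := if_pos hn

theorem code_mono {m n : ℕ} (h : m ≤ n) : M.code m ≤ M.code n := by
  cases m <;> cases n <;> simp [code] <;> omega

theorem interp_rename (t : Tm) (ρ : ℕ → ℕ) : M.interp (t.rename ρ) = (M.interp t).rename ρ := by
  induction t generalizing ρ with
  | univ n =>
    simp only [Tm.rename, interp]
    split_ifs
    · rfl
    · exact ((M.closed _).rename _).symm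
  | pi A B ihA ihB => exact congrArg₂ pi (ihA _) (ihB _)
  | lam A B ihA ihB => exact congrArg₂ lam (ihA _) (ihB _)
  | app A B ihA ihB => exact congrArg₂ app (ihA _) (ihB _)
  | _ => rfl

theorem interp_subst (t : Tm) (σ : ℕ → Tm) :
    M.interp (t.subst σ) = (M.interp t).subst fun n => M.interp (σ n) := by
  have lift : ∀ σ : ℕ → Tm, (fun n => M.interp (liftSub σ n)) = liftSub fun n => M.interp (σ n) :=
    fun σ => funext fun n => by
      cases n with
      | zero => rfl
      | succ n => exact M.interp_rename _ _
  induction t generalizing σ with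
  | univ n =>
    simp only [Tm.subst, interp]
    split_ifs
    · rfl
    · exact (M.closed _ _).symm
  | pi A B ihA ihB => exact congrArg₂ pi (ihA _) ((ihB (liftSub σ)).trans (by rw [lift]))
  | lam A B ihA ihB => exact congrArg₂ lam (ihA _) ((ihB (liftSub σ)).trans (by rw [lift]))
  | app A B ihA ihB => exact congrArg₂ app (ihA _) (ihB _)
  | _ => rfl

theorem interp_inst (b a : Tm) : M.interp (b.inst a) = (M.interp b).inst (M.interp a) := by
  rw [Tm.inst, interp_subst]
  exact subst_ext (fun n => by cases n <;> rfl) _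

theorem interp_bounded {n : ℕ} {t : Tm} {c : ℕ} (h : bounded n t c = true) {σ : ℕ → Tm}
    (hσ : ∀ m < c, σ m = var m) : (M.interp t).subst σ = M.interp t := by
  have lift : ∀ {c : ℕ} {σ : ℕ → Tm}, (∀ m < c, σ m = var m) →
      ∀ m < c + 1, liftSub σ m = var m := fun hσ m hm => by
    cases m with
    | zero => rfl
    | succ m => simp [liftSub, hσ m (by omega), Tm.rename]
  induction t generalizing c σ with
  | var m => exact hσ m (Nat.ble_eq.mp h)
  | univ m =>
    simp only [interp]
    split_ifs
    · rfl
    · exact M.closed _ _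
  | pi A B ihA ihB =>
    obtain ⟨hA, hB⟩ := caseBool_eq_true.mp h
    exact congrArg₂ pi (ihA hA hσ) (ihB hB (lift hσ))
  | lam A B ihA ihB =>
    obtain ⟨hA, hB⟩ := caseBool_eq_true.mp h
    exact congrArg₂ lam (ihA hA hσ) (ihB hB (lift hσ))
  | app A B ihA ihB =>
    obtain ⟨hA, hB⟩ := caseBool_eq_true.mp h
    exact congrArg₂ app (ihA hA hσ) (ihB hB hσ)
  | const => rfl

theorem closed_interp {n : ℕ} {t : Tm} (h : bounded n t 0 = true) : (M.interp t).Closed :=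
  fun _ => M.interp_bounded h fun m hm => absurd hm (Nat.not_lt_zero m)

/-- A bounded term sees only the first `n` global constants. This allows the values of later ones to
be chosen afterwards. -/
theorem interp_congr {M M' : Model} (hb : M.base = M'.base) {n : ℕ}
    (hv : ∀ k < n, M.val k = M'.val k) {t : Tm} {c : ℕ} (h : bounded n t c = true) :
    M.interp t = M'.interp t := by
  induction t generalizing c with
  | univ m =>
    have : m ≤ n + 7 := Nat.ble_eq.mp h
    simp only [interp]
    split_ifs
    · cases m <;> simp [code, hb]
    · exact hv _ (by omega)
  | pi A B ihA ihB =>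
    exact congrArg₂ pi (ihA (caseBool_eq_true.mp h).1) (ihB (caseBool_eq_true.mp h).2)
  | lam A B ihA ihB =>
    exact congrArg₂ lam (ihA (caseBool_eq_true.mp h).1) (ihB (caseBool_eq_true.mp h).2)
  | app A B ihA ihB =>
    exact congrArg₂ app (ihA (caseBool_eq_true.mp h).1) (ihB (caseBool_eq_true.mp h).2)
  | _ => rfl

/-- The types of the constants contain, besides the two given levels, the universe 0. Because of it
the lowest universe has a code of its own, with a value that does not depend on the base. -/
theorem interp_constType (i j : ℕ) (hi : i ≤ 7) (hj : j ≤ 7) (c : Const) :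
    M.interp (constType i j c).close = (constType (M.code i) (M.code j) c).close := by
  interval_cases i <;> interval_cases j <;> cases c <;> rfl

/-- Rules contain Lean functions and cannot be interpreted themselves, so the comparison is made
between the closed terms that they denote. -/
theorem interp_computation (i j : ℕ) (hi : i ≤ 4) (hj : j ≤ 4) :
    (computation i j).map (fun r => (M.interp r.lhs.close, M.interp r.rhs.close,
      M.interp r.type.close)) = (computation (M.code i) (M.code j)).map fun r =>
      (r.lhs.close, r.rhs.close, r.type.close) := by
  interval_cases i <;> interval_cases j <;> rfl

end Model

end HoTT

namespace HoTT

open Judgment Tm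

theorem Derivable.cumul_le {Γ : List Tm} {A : Tm} {m n : ℕ} (h : Derivable (typ Γ A (.univ m)))
    (hmn : m ≤ n) : Derivable (typ Γ A (.univ n)) := by
  induction hmn with
  | refl => exact h
  | step _ ih => exact .cumul ih

theorem Derivable.eqCumul_le {Γ : List Tm} {A B : Tm} {m n : ℕ}
    (h : Derivable (eq Γ A B (.univ m))) (hmn : m ≤ n) : Derivable (eq Γ A B (.univ n)) := by
  induction hmn with
  | refl => exact h
  | step _ ih => exact .eqCumul ih

namespace Model

variable {M : Model}

/-! ## Judgments about codes -/

variable (M)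

def Ctx (Γ : List Tm) : Prop := Derivable (ctx (Γ.map M.interp))

def Ty (Γ : List Tm) (t A : Tm) : Prop :=
  Derivable (typ (Γ.map M.interp) (M.interp t) (M.interp A))

def Eq (Γ : List Tm) (t u A : Tm) : Prop :=
  Derivable (eq (Γ.map M.interp) (M.interp t) (M.interp u) (M.interp A))

def IsType (Γ : List Tm) (A : Tm) : Prop :=
  ∃ n, Derivable (typ (Γ.map M.interp) (M.interp A) (.univ n))

def EqType (Γ : List Tm) (A B : Tm) : Prop :=
  ∃ n, Derivable (eq (Γ.map M.interp) (M.interp A) (M.interp B) (.univ n))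

/-- `σ` assigns to the variables of `Δ` terms in the context `Γ`. -/
def Subst (Δ Γ : List Tm) (σ : ℕ → Tm) : Prop :=
  IsSub (Δ.map M.interp) (Γ.map M.interp) fun n => M.interp (σ n)

/-- Every term of type `S` is also of type `T`. -/
def Sub (Γ : List Tm) (S T : Tm) : Prop :=
  (∀ t, M.Ty Γ t S → M.Ty Γ t T) ∧ ∀ t u, M.Eq Γ t u S → M.Eq Γ t u T

/-- The types `S` and `T` have the same terms. -/
def Same (Γ : List Tm) (S T : Tm) : Prop := M.Sub Γ S T ∧ M.Sub Γ T S

variable {M} {Γ Δ : List Tm} {t u w A A' B B' f g a b S T R : Tm} {m n : ℕ}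

theorem Sub.refl : M.Sub Γ S S := ⟨fun _ h => h, fun _ _ h => h⟩

theorem Sub.trans (h : M.Sub Γ S T) (h' : M.Sub Γ T R) : M.Sub Γ S R :=
  ⟨fun t ht => h'.1 t (h.1 t ht), fun t u ht => h'.2 t u (h.2 t u ht)⟩

theorem EqType.sub : M.EqType Γ S T → M.Sub Γ S T := fun ⟨_, h⟩ =>
  ⟨fun _ ht => Derivable.conv ht h, fun _ _ ht => Derivable.eqConv ht h⟩

theorem EqType.symm : M.EqType Γ S T → M.EqType Γ T S := fun ⟨n, h⟩ => ⟨n, Derivable.eqSymm h⟩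

theorem EqType.same (h : M.EqType Γ S T) : M.Same Γ S T := ⟨h.sub, h.symm.sub⟩

theorem Same.refl : M.Same Γ S S := ⟨.refl, .refl⟩

theorem sub_univ (h : m ≤ n) (hn : n ≤ 7) : M.Sub Γ (univ m) (univ n) := by
  refine ⟨fun t ht => ?_, fun t u ht => ?_⟩
  · unfold Ty at ht ⊢
    rw [M.interp_univ (h.trans hn)] at ht
    rw [M.interp_univ hn]
    exact ht.cumul_le (M.code_mono h)
  · unfold Eq at ht ⊢
    rw [M.interp_univ (h.trans hn)] at ht
    rw [M.interp_univ hn]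
    exact ht.eqCumul_le (M.code_mono h)

theorem Ty.isType (h : M.Ty Γ A (univ n)) (hn : n ≤ 7) : M.IsType Γ A := by
  unfold Ty at h
  rw [M.interp_univ hn] at h
  exact ⟨_, h⟩

theorem Eq.eqType (h : M.Eq Γ A B (univ n)) (hn : n ≤ 7) : M.EqType Γ A B := by
  unfold Eq at h
  rw [M.interp_univ hn] at h
  exact ⟨_, h⟩

theorem Ctx.cons (h : M.Ctx Γ) : M.IsType Γ A → M.Ctx (A :: Γ) := fun ⟨_, hA⟩ => Derivable.cons h hA

theorem Ctx.inv (h : M.Ctx (A :: Γ)) : M.Ctx Γ ∧ M.IsType Γ A := by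
  unfold Ctx at h
  rw [List.map_cons] at h
  cases h with
  | cons h hA => exact ⟨h, _, hA⟩

theorem Eq.symm (h : M.Eq Γ t u A) : M.Eq Γ u t A := Derivable.eqSymm h

theorem Eq.trans (h : M.Eq Γ t u A) (h' : M.Eq Γ u w A) : M.Eq Γ t w A := Derivable.eqTrans h h'

theorem Ty.refl (h : M.Ty Γ t A) : M.Eq Γ t t A := Derivable.eqRefl h

theorem Ty.var (h : M.Ctx Γ) (hn : Γ[n]? = some A) :
    M.Ty Γ (Tm.var n) (A.rename (· + (n + 1))) := by
  unfold Ty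
  rw [M.interp_rename]
  exact Derivable.var h (by simp [hn])

theorem Ty.pi (hA : M.Ty Γ A (univ n)) (hB : M.Ty (A :: Γ) B (univ n)) (hn : n ≤ 7) :
    M.Ty Γ (Tm.pi A B) (univ n) := by
  unfold Ty at *
  rw [M.interp_univ hn] at *
  exact Derivable.pi hA hB

theorem Ty.lam : M.IsType Γ A → M.Ty (A :: Γ) b B → M.Ty Γ (Tm.lam A b) (Tm.pi A B) :=
  fun ⟨_, hA⟩ hb => Derivable.lam hA hb

theorem Ty.app (hf : M.Ty Γ f (Tm.pi A B)) (ha : M.Ty Γ a A) :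
    M.Ty Γ (Tm.app f a) (B.inst a) := by
  unfold Ty
  rw [M.interp_inst]
  exact Derivable.app hf ha

theorem Eq.app (hf : M.Eq Γ f g (Tm.pi A B)) (ha : M.Eq Γ a b A) :
    M.Eq Γ (Tm.app f a) (Tm.app g b) (B.inst a) := by
  unfold Eq
  rw [M.interp_inst]
  exact Derivable.eqApp hf ha

theorem Eq.lam {b' : Tm} : M.IsType Γ A → M.EqType Γ A A' → M.Eq (A :: Γ) b b' B →
    M.Eq Γ (Tm.lam A b) (Tm.lam A' b') (Tm.pi A B) := by
  rintro ⟨k, hA⟩ ⟨l, hA'⟩ hb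
  exact Derivable.eqLam (hA.cumul_le (le_max_left k l)) (hA'.eqCumul_le (le_max_right k l)) hb

theorem Eq.pi (hA : M.Ty Γ A (univ n)) (hA' : M.Eq Γ A A' (univ n))
    (hB : M.Eq (A :: Γ) B B' (univ n)) (hn : n ≤ 7) :
    M.Eq Γ (Tm.pi A B) (Tm.pi A' B') (univ n) := by
  unfold Ty at hA
  unfold Eq at *
  rw [M.interp_univ hn] at *
  exact Derivable.eqPi hA hA' hB

theorem EqType.pi : M.IsType Γ A → M.EqType Γ A A' → M.EqType (A :: Γ) B B' →
    M.EqType Γ (Tm.pi A B) (Tm.pi A' B') := by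
  rintro ⟨k, hA⟩ ⟨l, hA'⟩ ⟨m, hB⟩
  exact ⟨max k (max l m), Derivable.eqPi (hA.cumul_le (by omega)) (hA'.eqCumul_le (by omega))
    (hB.eqCumul_le (by omega))⟩

theorem IsType.refl : M.IsType Γ A → M.EqType Γ A A := fun ⟨n, h⟩ => ⟨n, Derivable.eqRefl h⟩

theorem Eq.beta : M.IsType Γ A → M.Ty (A :: Γ) b B → M.Ty Γ a A →
    M.Eq Γ (Tm.app (Tm.lam A b) a) (b.inst a) (B.inst a) := by
  rintro ⟨k, hA⟩ hb ha
  unfold Eq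
  rw [M.interp_inst, M.interp_inst]
  exact Derivable.beta hA hb ha

theorem Ty.eta (h : M.Ty Γ f (Tm.pi A B)) :
    M.Eq Γ f (Tm.lam A (.app (f.rename (· + 1)) (.var 0))) (Tm.pi A B) := by
  have := Derivable.eta h
  rw [← M.interp_rename] at this
  exact this

theorem Ty.univ_zero (h : M.Ctx Γ) : M.Ty Γ (univ 0) (univ 2) := by
  unfold Ty
  rw [M.interp_univ (by omega), M.interp_univ (by omega)]
  exact (Derivable.univ 0 h).cumul_le (by simp [code])

theorem Ty.univ_succ (h : M.Ctx Γ) (hn : n ≤ 5) : M.Ty Γ (univ (n + 1)) (univ (n + 2)) := by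
  unfold Ty
  rw [M.interp_univ (by omega), M.interp_univ (by omega)]
  exact Derivable.univ _ h

theorem Ty.const (h : M.Ctx Γ) (c : Const) (hm : m ≤ 7) (hn : n ≤ 7) :
    M.Ty Γ (Tm.const c) (constType m n c).close := by
  unfold Ty
  rw [M.interp_constType m n hm hn]
  exact Derivable.const c _ _ h

theorem Ty.subst {σ : ℕ → Tm} (h : M.Ty Δ t A) (hΓ : M.Ctx Γ) (hσ : M.Subst Δ Γ σ) :
    M.Ty Γ (t.subst σ) (A.subst σ) := by
  unfold Ty
  rw [M.interp_subst, M.interp_subst]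
  exact Derivable.subOK h _ _ hΓ hσ

theorem IsType.subst {σ : ℕ → Tm} (hΓ : M.Ctx Γ) (hσ : M.Subst Δ Γ σ) :
    M.IsType Δ A → M.IsType Γ (A.subst σ) := fun ⟨n, h⟩ => ⟨n, by
  rw [M.interp_subst]
  exact Derivable.subOK h _ _ hΓ hσ⟩

theorem Subst.cons {σ : ℕ → Tm} (hσ : M.Subst Δ Γ σ) (ha : M.Ty Γ a (A.subst σ)) :
    M.Subst (A :: Δ) Γ (Tm.cons a σ) := by
  unfold Ty at ha
  rw [M.interp_subst] at ha
  have e : (fun n => M.interp (Tm.cons a σ n)) = Tm.cons (M.interp a) fun n => M.interp (σ n) :=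
    funext fun n => by cases n <;> rfl
  unfold Subst
  rw [e]
  exact IsSub.cons hσ ha

theorem Subst.lift {σ : ℕ → Tm} (hσ : M.Subst Δ Γ σ) (h : M.Ctx (A.subst σ :: Γ)) :
    M.Subst (A :: Δ) (A.subst σ :: Γ) (liftSub σ) := by
  have e : (fun n => M.interp (liftSub σ n)) = liftSub fun n => M.interp (σ n) :=
    funext fun n => by
      cases n with
      | zero => rfl
      | succ n => exact M.interp_rename _ _
  unfold Ctx at h
  unfold Subst
  rw [e]
  simp only [List.map_cons, M.interp_subst] at h ⊢
  exact IsSub.lift hσ h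

theorem subst_var (h : M.Ctx Γ) : M.Subst Γ Γ Tm.var := isSub_var h

theorem subst_nil (σ : ℕ → Tm) : M.Subst [] Γ σ := isSub_nil _ _

/-- An application of an abstraction under a substitution. -/
theorem Eq.beta_subst {σ : ℕ → Tm} (hΓ : M.Ctx Γ) (hσ : M.Subst Δ Γ σ) (hA : M.IsType Δ A)
    (hb : M.Ty (A :: Δ) b B) (ha : M.Ty Γ a (A.subst σ))
    (hf : M.Eq Γ f ((Tm.lam A b).subst σ) ((Tm.pi A B).subst σ)) :
    M.Eq Γ (.app f a) (b.subst (Tm.cons a σ)) (B.subst (Tm.cons a σ)) := by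
  have hA' := hA.subst hΓ hσ
  have h := (Eq.app hf ha.refl).trans
    (Eq.beta hA' (hb.subst (hΓ.cons hA') (hσ.lift (hΓ.cons hA'))) ha)
  rwa [subst_liftSub_inst, subst_liftSub_inst] at h

end Model
end HoTT

/-! ### Soundness of type conversion, of argument lists and of telescopes. -/

namespace HoTT

open Tm Model

namespace Model

variable {M : Model} {F : Checker} {Γ Δ Ξ : List Tm} {t u A A' B B' f g a b S T R K : Tm} {n : ℕ}

variable (M) in
/-- The reduct of a term is equal to it. -/
def Reduct (Γ : List Tm) (t t' : Tm) (o : Option Tm) : Prop :=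
  (o = none → t' = t) ∧ ∀ T, o = some T → M.Eq Γ t t' T

variable (M) in
/-- Correctness of the functions of the checker. -/
structure Sound (F : Checker) : Prop where
  infer {Γ : List Tm} {t A : Tm} : M.Ctx Γ → F.infer Γ t = some A → M.Ty Γ t A
  check {Γ : List Tm} {t A : Tm} : M.Ctx Γ → F.check Γ t A = true → M.Ty Γ t A
  red {Γ : List Tm} (t : Tm) : M.Ctx Γ → M.Reduct Γ t (F.red Γ t).1 (F.red Γ t).2
  equal {Γ : List Tm} {t u A : Tm} : M.Ctx Γ → F.equal Γ t u = some A → M.Eq Γ t u A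
  checkEqual {Γ : List Tm} {t u A : Tm} : M.Ctx Γ → F.checkEqual Γ t u A = true → M.Eq Γ t u A

theorem Reduct.same {k : Tm} {o : Option Tm} (h : M.Reduct Γ K k o)
    (ho : o = none ∨ ∃ m ≤ 7, ∃ L, o = some L ∧ M.Sub Γ L (univ m)) : M.Same Γ K k := by
  rcases ho with ho | ⟨m, hm, L, ho, hL⟩
  · rw [h.1 ho]
    exact .refl
  · exact ((hL.2 _ _ (h.2 _ ho)).eqType hm).same

theorem lams_typ (hΔ : M.Ctx (Δ.reverse ++ Ξ)) (hb : M.Ty (Δ.reverse ++ Ξ) b T) :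
    M.Ctx Ξ ∧ M.Ty Ξ (lams Δ b) (pis Δ T) := by
  induction Δ generalizing Ξ with
  | nil => exact ⟨hΔ, hb⟩
  | cons A Δ ih =>
    rw [List.reverse_cons, List.append_assoc] at hΔ hb
    obtain ⟨h, h'⟩ := ih hΔ hb
    exact ⟨h.inv.1, .lam h.inv.2 h'⟩

namespace Sound

variable (hF : M.Sound F) (hΓ : M.Ctx Γ)
include hF hΓ

theorem asUniv (h : F.asUniv Γ K = some n) : n ≤ 7 ∧ M.Same Γ K (univ n) := by
  by_cases h' : (∃ m, K = univ m)
  · obtain ⟨m, rfl⟩ := h'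
    obtain ⟨hm, e⟩ := caseBool_eq_some.mp h
    obtain rfl := Option.some.inj e
    exact ⟨Nat.ble_eq.mp hm, .refl⟩
  · have h2 : caseUniv (F.red Γ K).1 (fun n => caseBool (Nat.ble n 7)
        (caseOpt (F.red Γ K).2
          (fun L => caseUniv L (fun m => caseBool (Nat.ble m 7) (some n) none) none) (some n)) none)
        none = some n := by
      cases K with
      | univ m => exact absurd ⟨m, rfl⟩ h'
      | _ => exact h
    obtain ⟨m, e, h2⟩ := caseUniv_ne h2 (by simp)
    obtain ⟨hm, h2⟩ := caseBool_eq_some.mp h2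
    have hr := hF.red K hΓ
    rw [e] at hr
    rcases ho : (F.red Γ K).2 with _ | L
    · rw [ho] at h2
      obtain rfl := Option.some.inj h2
      exact ⟨Nat.ble_eq.mp hm, hr.same (.inl ho)⟩
    · rw [ho] at h2
      obtain ⟨l, rfl, h2⟩ := caseUniv_ne h2 (by simp)
      obtain ⟨hl, h2⟩ := caseBool_eq_some.mp h2
      obtain rfl := Option.some.inj h2
      exact ⟨Nat.ble_eq.mp hm, hr.same (.inr ⟨l, Nat.ble_eq.mp hl, _, ho, .refl⟩)⟩

theorem asPi {R : Type} {k : Tm → Tm → R} {d r : R} (h : F.asPi Γ K k d = r) (hr : r ≠ d) :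
    ∃ A B, M.Same Γ K (pi A B) ∧ k A B = r := by
  by_cases h' : (∃ A B, K = pi A B)
  · obtain ⟨A, B, rfl⟩ := h'
    exact ⟨A, B, .refl, h⟩
  · have h2 : casePi (F.red Γ K).1 (fun A B => caseOpt (F.red Γ K).2
        (fun L => caseOpt (F.asUniv Γ L) (fun _ => k A B) d) (k A B)) d = r := by
      cases K with
      | pi A B => exact absurd ⟨A, B, rfl⟩ h'
      | _ => exact h
    obtain ⟨A, B, e, h2⟩ := casePi_ne h2 hr
    have hred := hF.red K hΓ
    rw [e] at hred
    rcases ho : (F.red Γ K).2 with _ | L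
    · rw [ho] at h2
      exact ⟨A, B, hred.same (.inl ho), h2⟩
    · rw [ho] at h2
      rcases hL : F.asUniv Γ L with _ | m
      · simp only [caseOpt, hL] at h2
        exact absurd h2.symm hr
      · simp only [caseOpt, hL] at h2
        have hm := hF.asUniv hΓ hL
        exact ⟨A, B, hred.same (.inr ⟨m, hm.1, L, ho, hm.2.1⟩), h2⟩

theorem level (h : F.level Γ A = some n) : n ≤ 7 ∧ M.Ty Γ A (univ n) := by
  obtain ⟨K, hK, h⟩ := caseOpt_eq_some.mp h
  have := hF.asUniv hΓ h
  exact ⟨this.1, this.2.1.1 _ (hF.infer hΓ hK)⟩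

theorem isType (h : F.level Γ A = some n) : M.IsType Γ A :=
  (hF.level hΓ h).2.isType (hF.level hΓ h).1

theorem equalTypes (h : F.equalTypes Γ A B = some n) : n ≤ 7 ∧ M.Eq Γ A B (univ n) := by
  obtain ⟨K, hK, h⟩ := caseOpt_eq_some.mp h
  have := hF.asUniv hΓ h
  exact ⟨this.1, this.2.1.2 _ _ (hF.equal hΓ hK)⟩

theorem eqType (h : F.equalTypes Γ A B = some n) : M.EqType Γ A B :=
  (hF.equalTypes hΓ h).2.eqType (hF.equalTypes hΓ h).1

theorem subDomain (hA : M.IsType Γ A') (h : F.subDomain Γ A' A B = true) :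
    M.Sub Γ (pi A' B) (pi A B) := by
  rcases caseBool_true_eq_true.mp h with h | h
  · rw [eq_of_beq h]
    exact .refl
  · obtain ⟨n, hn, h⟩ := caseOpt_eq_true.mp h
    obtain ⟨m, hm, -⟩ := caseOpt_eq_true.mp h
    exact (EqType.pi hA (hF.eqType hΓ hn) (hF.isType (hΓ.cons hA) hm).refl).sub

theorem sub (h : F.sub Γ S T = true) : M.Sub Γ S T := by
  rcases caseBool_true_eq_true.mp h with h | h
  · rw [eq_of_beq h]
    exact .refl
  rcases caseBool_true_eq_true.mp h with h | h
  · obtain ⟨n, rfl, h₁⟩ := caseUniv_ne h (by simp)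
    obtain ⟨m, rfl, h₂⟩ := caseUniv_ne h₁ (by simp)
    obtain ⟨h₃, h₄⟩ := caseBool_eq_true.mp h₂
    exact sub_univ (Nat.ble_eq.mp h₃) (Nat.ble_eq.mp h₄)
  rcases h' : F.equalTypes Γ S T with _ | n
  · simp only [caseOpt, h'] at h
    obtain ⟨n, hn, h⟩ := caseOpt_eq_true.mp h
    obtain ⟨m, hm, h⟩ := caseOpt_eq_true.mp h
    exact (hF.asUniv hΓ hn).2.1.trans ((sub_univ (Nat.ble_eq.mp h) (hF.asUniv hΓ hm).1).trans
      (hF.asUniv hΓ hm).2.2)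
  · exact (hF.eqType hΓ h').sub

theorem join (h : F.join Γ S T = some R) : M.Sub Γ S R ∧ M.Sub Γ T R := by
  unfold Checker.join at h
  rcases h' : F.sub Γ S T
  · rw [h'] at h
    obtain ⟨hs, e⟩ := caseBool_eq_some.mp (h : caseBool (F.sub Γ T S) (some S) none = some R)
    obtain rfl := Option.some.inj e
    exact ⟨.refl, hF.sub hΓ hs⟩
  · rw [h'] at h
    obtain rfl := Option.some.inj h
    exact ⟨hF.sub hΓ h', .refl⟩

/-- The substitution of the earlier arguments is kept pending while the type is visibly a function
type. Otherwise it is carried out, the result is reduced to a function type, and a new pending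
substitution starts with the present argument alone. Both cases give the same conclusion, which
serves inference and comparison alike. -/
theorem argsStep {σ : List Tm} {c : Tm → Bool} {k : Tm → List Tm → Option Tm}
    (h : casePi T
      (fun A B => Tm.force (insts σ A) fun A => caseBool (c A) (k B (a :: σ)) none)
      (Tm.force (insts σ T) fun T => F.asPi Γ T
        (fun A B => caseBool (c A) (k B [a]) none) none) = some R) :
    ∃ A B B' τ, M.Sub Γ (T.subst (toSub σ)) (pi A B) ∧ c A = true ∧ k B' τ = some R ∧
      B'.subst (toSub τ) = B.inst a := by
  by_cases h' : (∃ A B, T = pi A B)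
  · obtain ⟨A, B, rfl⟩ := h'
    change Tm.force (insts σ A) _ = _ at h
    rw [force_eq, insts_eq] at h
    obtain ⟨hc, h⟩ := caseBool_eq_some.mp h
    exact ⟨_, B.subst (liftSub (toSub σ)), B, a :: σ, .refl, hc, h,
      (subst_liftSub_inst _ _ _).symm⟩
  · have h2 : Tm.force (insts σ T) (fun T => F.asPi Γ T
        (fun A B => caseBool (c A) (k B [a]) none) none) = some R := by
      cases T with
      | pi A B => exact absurd ⟨A, B, rfl⟩ h'
      | _ => exact h
    rw [force_eq, insts_eq] at h2
    obtain ⟨A, B, hs, h2⟩ := hF.asPi hΓ h2 (by simp)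
    obtain ⟨hc, h2⟩ := caseBool_eq_some.mp h2
    exact ⟨A, B, B, [a], hs.1, hc, h2, (inst_eq _ _).symm⟩

theorem equalArgs {as bs σ : List Tm} (h : F.equalArgs Γ as bs T σ = some R)
    (hf : M.Eq Γ f g (T.subst (toSub σ))) : M.Eq Γ (apps f as) (apps g bs) R := by
  induction as generalizing bs T σ f g with
  | nil =>
    cases bs with
    | nil =>
      change Tm.force (insts σ T) some = _ at h
      rw [force_eq, insts_eq] at h
      obtain rfl := Option.some.inj h
      exact hf
    | cons b bs => exact absurd h (by simp [Checker.equalArgs, caseList])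
  | cons a as ih =>
    cases bs with
    | nil => exact absurd h (by simp [Checker.equalArgs, caseList])
    | cons b bs =>
      obtain ⟨A, B, B', τ, hs, hc, h, e⟩ := hF.argsStep hΓ
        (k := fun B σ => F.equalArgs Γ as bs B σ) (c := fun A => F.checkEqual Γ a b A) h
      have hf' := (hs.2 _ _ hf).app (hF.checkEqual hΓ hc)
      rw [← e] at hf'
      have := ih h hf'
      exact this

theorem inferArgs_eq {as σ : List Tm} (h : F.inferArgs Γ as T σ = some R)
    (hf : M.Eq Γ f g (T.subst (toSub σ))) : M.Eq Γ (apps f as) (apps g as) R := by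
  induction as generalizing T σ f g with
  | nil =>
    change Tm.force (insts σ T) some = _ at h
    rw [force_eq, insts_eq] at h
    obtain rfl := Option.some.inj h
    exact hf
  | cons a as ih =>
    obtain ⟨A, B, B', τ, hs, hc, h, e⟩ := hF.argsStep hΓ
      (k := fun B σ => F.inferArgs Γ as B σ) (c := fun A => F.check Γ a A) h
    refine ih h ?_
    rw [e]
    exact (hs.2 _ _ hf).app (hF.check hΓ hc).refl

theorem inferArgs {as σ : List Tm} (h : F.inferArgs Γ as T σ = some R)
    (hf : M.Ty Γ f (T.subst (toSub σ))) : M.Ty Γ (apps f as) R := by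
  induction as generalizing T σ f with
  | nil =>
    change Tm.force (insts σ T) some = _ at h
    rw [force_eq, insts_eq] at h
    obtain rfl := Option.some.inj h
    exact hf
  | cons a as ih =>
    obtain ⟨A, B, B', τ, hs, hc, h, e⟩ := hF.argsStep hΓ
      (k := fun B σ => F.inferArgs Γ as B σ) (c := fun A => F.check Γ a A) h
    refine ih h ?_
    rw [e]
    exact (hs.1 _ hf).app (hF.check hΓ hc)

/-- Application of iterated abstractions to an instance of their telescope. -/
theorem checkTelescope {as σ τ : List Tm} (h : F.checkTelescope Γ Δ as σ = some τ)
    (hΔ : M.Ctx (Δ.reverse ++ Ξ)) (hb : M.Ty (Δ.reverse ++ Ξ) b T)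
    (hσ : M.Subst Ξ Γ (toSub σ))
    (hf : M.Eq Γ f ((lams Δ b).subst (toSub σ)) ((pis Δ T).subst (toSub σ))) :
    M.Eq Γ (apps f as) (b.subst (toSub τ)) (T.subst (toSub τ)) := by
  induction Δ generalizing as σ Ξ f with
  | nil =>
    cases as with
    | nil =>
      obtain rfl := Option.some.inj h
      exact hf
    | cons a as => exact absurd h (by simp [Checker.checkTelescope, caseList])
  | cons A Δ ih =>
    cases as with
    | nil => exact absurd h (by simp [Checker.checkTelescope, caseList])
    | cons a as =>
      change Tm.force (insts σ A) (fun A => caseBool (F.check Γ a A)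
        (F.checkTelescope Γ Δ as (a :: σ)) none) = _ at h
      rw [force_eq, insts_eq] at h
      obtain ⟨ha, h⟩ := caseBool_eq_some.mp h
      have ha := hF.check hΓ ha
      rw [List.reverse_cons, List.append_assoc] at hΔ hb
      obtain ⟨hA, hl⟩ := lams_typ hΔ hb
      have := ih h hΔ hb (hσ.cons ha) (Eq.beta_subst hΓ hσ hA.inv.2 hl ha hf)
      exact this

end Sound
end Model
end HoTT

/-! ### Soundness of reduction steps and of the comparison of terms. -/

namespace HoTT

open Tm Model

namespace Model

variable {M : Model} {F : Checker} {L : List Entry} {Γ Δ Ξ : List Tm}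
  {t u t' u' A A' B B' f g a b h S T R K : Tm} {n : ℕ}

variable (M) in
/-- The sides of the computation rules are well typed. -/
def RulesSound : Prop := ∀ ⦃i j k Δ l r T⦄, i ≤ 4 → j ≤ 4 → evalRule i j k = some ⟨Δ, l, r, T⟩ →
  M.Ctx Δ.reverse ∧ M.Ty Δ.reverse l T ∧ M.Ty Δ.reverse r T

variable (M) in
/-- The `k`-th global constant has the type and the value given by an entry. -/
structure EntrySound (k : ℕ) (e : Entry) : Prop where
  closed : (M.interp e.type).Closed
  typ : M.Ty [] (univ (k + 8)) e.type
  unfold {n : ℕ} : e.arity = some n →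
    M.Ctx (splitPi n e.type).1.reverse ∧
    M.Ty (splitPi n e.type).1.reverse (splitLam n e.value).2 (splitPi n e.type).2 ∧
    M.interp (univ (k + 8)) = M.interp (lams (splitPi n e.type).1 (splitLam n e.value).2)

variable (M) in
def EnvSound (L : List Entry) : Prop := ∀ ⦃k e⦄, lookup L k = some e → M.EntrySound k e

theorem Ty.weaken_nil (h : M.Ty [] t A) (ht : (M.interp t).Closed) (hA : (M.interp A).Closed)
    (hΓ : M.Ctx Γ) : M.Ty Γ t A := by
  have := Derivable.subOK h _ Tm.var hΓ (isSub_nil _ _)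
  rwa [ht, hA] at this

theorem closed_global (k : ℕ) : (M.interp (univ (k + 8))).Closed := by
  rw [interp, if_neg (by omega)]
  exact M.closed _

theorem EntrySound.weaken {k : ℕ} {e : Entry} (h : M.EntrySound k e) (hΓ : M.Ctx Γ) :
    M.Ty Γ (univ (k + 8)) e.type :=
  h.typ.weaken_nil (closed_global k) h.closed hΓ

theorem evalConst_eq {i j : ℕ} {c : Const} (h : evalConst i j c = some T) :
    T = (constType i j c).close := by
  unfold evalConst at h
  rw [force_eq] at h
  exact (Option.some.inj h).symm

/-- The rule `Derivable.comp` concerns actual universe levels; `interp_computation` identifies its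
instance with the interpretation of the rule at codes. -/
theorem evalRule_eq {i j k : ℕ} {l r : Tm} (hi : i ≤ 4) (hj : j ≤ 4)
    (h : evalRule i j k = some ⟨Δ, l, r, T⟩) (hΓ : M.Ctx Γ) :
    M.Eq Γ (lams Δ l) (lams Δ r) (pis Δ T) := by
  obtain ⟨q, hq, h⟩ := caseOpt_eq_some.mp h
  simp only [casePair_eq, forceList_eq, force_eq, Option.some.injEq, RawRule.mk.injEq] at h
  obtain ⟨rfl, rfl, rfl, rfl⟩ := h
  obtain ⟨h₁, h₂, h₃⟩ := q.close_raw 0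
  rw [← h₁, ← h₂, ← h₃]
  rw [nth_eq] at hq
  have key := congrArg (fun l => l[k]?) (M.interp_computation i j hi hj)
  simp only [List.getElem?_map, hq, Option.map_some] at key
  rcases hq' : (computation (M.code i) (M.code j))[k]? with _ | q'
  · simp [hq'] at key
  · simp only [hq', Option.map_some, Option.some.injEq, Prod.mk.injEq] at key
    have := Derivable.comp _ _ hΓ (List.mem_of_getElem? hq')
    rw [← key.1, ← key.2.1, ← key.2.2] at this
    exact this

theorem Eq.sub (h : M.Eq Γ t u S) (hs : M.Sub Γ S T) : M.Eq Γ t u T := hs.2 _ _ h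

theorem some_triple {α β γ : Type} {a a' : α} {b b' : β} {c c' : γ}
    (h : some (a, b, c) = some (a', b', c')) : a = a' ∧ b = b' ∧ c = c' := by
  simpa using h

namespace Sound

variable (hF : M.Sound F) (hΓ : M.Ctx Γ)
include hF hΓ

theorem stepRule {i j k : ℕ} {as : List Tm} (hR : M.RulesSound)
    (h : F.stepRule Γ i j k as t = some (R, T)) : M.Eq Γ t R T := by
  obtain ⟨hi, h⟩ := caseBool_eq_some.mp h
  obtain ⟨hj, h⟩ := caseBool_eq_some.mp h
  have hi := Nat.ble_eq.mp hi
  have hj := Nat.ble_eq.mp hj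
  obtain ⟨⟨Δ, l, r, K⟩, hr, h⟩ := caseOpt_eq_some.mp h
  obtain ⟨σ, hσ, h⟩ := caseOpt_eq_some.mp h
  obtain ⟨hΔ, hl, hr'⟩ := hR hi hj hr
  rw [← List.append_nil Δ.reverse] at hΔ hl hr'
  have e : M.Eq Γ (lams Δ l) (lams Δ r) (pis Δ K) := evalRule_eq hi hj hr hΓ
  -- A computation rule equates two closed abstractions. To apply them to an instance and contract
  -- the redexes, both bodies must be well typed over the telescope, which is what `RulesSound`
  -- provides.
  have key : ∀ {b : Tm}, M.Ty (Δ.reverse ++ []) b K → M.Eq Γ (lams Δ l) (lams Δ b) (pis Δ K) →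
      M.Eq Γ (apps (lams Δ l) as) (b.subst (toSub σ)) (K.subst (toSub σ)) := fun {b} hb he =>
    hF.checkTelescope hΓ hσ hΔ hb (subst_nil _) (by
      rwa [show toSub [] = Tm.var from rfl, Tm.subst_var _ fun _ => rfl,
        Tm.subst_var _ fun _ => rfl])
  have hlr := (key hl (e.trans e.symm)).symm.trans (key hr' e)
  simp only [insts_eq, force_eq] at h
  rcases ht : beq t (l.subst (toSub σ))
  · rw [ht] at h
    obtain ⟨S, hS, h⟩ := caseOpt_eq_some.mp (h : caseOpt (F.equal Γ t _) _ none = _)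
    obtain ⟨hs, h⟩ := caseBool_eq_some.mp h
    obtain ⟨rfl, rfl⟩ := Prod.mk.inj (Option.some.inj h)
    exact ((hF.equal hΓ hS).sub (hF.sub hΓ hs)).trans hlr
  · rw [ht] at h
    obtain ⟨rfl, rfl⟩ := Prod.mk.inj (Option.some.inj h)
    rwa [eq_of_beq ht]

/-- Reduction of the analysed argument and the tables of arities serve only to find a candidate
rule, so nothing about them has to be proved; `stepRule` verifies the candidate. -/
theorem stepConst {c : Const} {as as' : List Tm} (hR : M.RulesSound)
    (h : F.stepConst Γ c as = some (R, T, as')) :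
    ∃ bs, as = bs ++ as' ∧ M.Eq Γ (apps (.const c) bs) R T := by
  obtain ⟨⟨n, p⟩, -, h⟩ := caseOpt_eq_some.mp h
  obtain ⟨x, -, h⟩ := caseOpt_eq_some.mp h
  simp only [casePair_eq, forceNat_eq] at h
  generalize (spine (F.red Γ x).1 []).1 = hd at h
  cases hd with
  | const k =>
    obtain ⟨rn, -, h⟩ := caseOpt_eq_some.mp h
    obtain ⟨r, hr, h⟩ := caseOpt_eq_some.mp h
    obtain ⟨rfl, rfl, rfl⟩ := some_triple h
    exact ⟨_, (List.take_append_drop (p + 1) as).symm, hF.stepRule hΓ hR hr⟩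
  | _ => exact absurd h (by simp [caseConst])

omit hΓ in
theorem stepBeta_stop {as as' σ : List Tm} (h : caseOpt (F.infer Δ t)
      (fun B => some (insts σ t, insts σ B, as)) none = some (R, T, as')) (hΔ : M.Ctx Δ) :
    ∃ bs K, as = bs ++ as' ∧ M.Ty Δ t K ∧
      ∀ f, M.Eq Γ f (t.subst (toSub σ)) (K.subst (toSub σ)) → M.Eq Γ (apps f bs) R T := by
  obtain ⟨K, hK, h⟩ := caseOpt_eq_some.mp h
  obtain ⟨rfl, rfl, rfl⟩ := some_triple h
  refine ⟨[], K, rfl, hF.infer hΔ hK, fun f hf => ?_⟩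
  rw [insts_eq, insts_eq]
  exact hf

/-- Several redexes are contracted at once under a pending substitution, and the type of the body is
inferred only at the end. The claim is made for every `f` equal to the instance, because in the
induction `f` is the application to the arguments already consumed. -/
theorem stepBeta {as as' σ : List Tm} (h : F.stepBeta Γ as Δ t σ = some (R, T, as'))
    (hΔ : M.Ctx Δ) (hσ : M.Subst Δ Γ (toSub σ)) :
    ∃ bs K, as = bs ++ as' ∧ M.Ty Δ t K ∧
      ∀ f, M.Eq Γ f (t.subst (toSub σ)) (K.subst (toSub σ)) → M.Eq Γ (apps f bs) R T := by
  induction as generalizing Δ t σ with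
  | nil => exact hF.stepBeta_stop h hΔ
  | cons a as ih =>
    by_cases h' : (∃ A b, t = lam A b)
    · obtain ⟨A, b, rfl⟩ := h'
      obtain ⟨n, hn, h⟩ := caseOpt_eq_some.mp (h : caseOpt (F.level Δ A) _ none = _)
      rw [force_eq, insts_eq] at h
      obtain ⟨ha, h⟩ := caseBool_eq_some.mp h
      have hA := hF.isType hΔ hn
      have ha := hF.check hΓ ha
      obtain ⟨bs, K, rfl, hb, H⟩ := ih h (hΔ.cons hA) (hσ.cons ha)
      exact ⟨a :: bs, pi A K, rfl, .lam hA hb, fun f hf =>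
        H _ (Eq.beta_subst hΓ hσ hA hb ha hf)⟩
    · refine hF.stepBeta_stop (as := a :: as) ?_ hΔ
      cases t with
      | lam A b => exact absurd ⟨A, b, rfl⟩ h'
      | _ => exact h

/-- After interpretation a global constant is literally its value, so unfolding is just β-reduction
of iterated abstractions along the telescope of its type. -/
theorem stepGlobal {k : ℕ} {e : Entry} {as as' : List Tm} (he : M.EntrySound k e)
    (h : F.stepGlobal Γ e as = some (R, T, as')) :
    ∃ bs, as = bs ++ as' ∧ M.Eq Γ (apps (univ (k + 8)) bs) R T := by
  obtain ⟨A, v, o⟩ := e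
  obtain ⟨n, rfl, h₁⟩ := caseOpt_eq_some.mp (h : caseOpt o _ none = _)
  simp only [casePair_eq] at h₁
  obtain ⟨σ, hσ, h₂⟩ := caseOpt_eq_some.mp h₁
  obtain ⟨rfl, rfl, rfl⟩ := some_triple h₂
  obtain ⟨hΔ, hb, e⟩ := he.unfold rfl
  have hA : M.Ty Γ (univ (k + 8)) A := he.weaken hΓ
  refine ⟨_, (List.take_append_drop n as).symm, ?_⟩
  rw [insts_eq, insts_eq]
  rw [← List.append_nil (List.reverse _)] at hΔ hb
  refine hF.checkTelescope hΓ hσ hΔ hb (subst_nil _) ?_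
  rw [show toSub [] = Tm.var from rfl, Tm.subst_var _ fun _ => rfl, Tm.subst_var _ fun _ => rfl]
  unfold Eq
  rw [← e]
  have := hA.refl
  rwa [← pis_splitPi n A] at this

theorem step (hL : M.EnvSound L) (hR : L ≠ [] → M.RulesSound) {as : List Tm}
    (h : F.step L Γ t as = some (R, T)) : M.Eq Γ (apps t as) R T := by
  obtain ⟨⟨r, S, as'⟩, h₁, h₂⟩ := caseOpt_eq_some.mp h
  simp only [casePair_eq, force_eq] at h₂
  obtain ⟨K, hK, h₃⟩ := caseOpt_eq_some.mp h₂
  obtain ⟨rfl, rfl⟩ := Prod.mk.inj (Option.some.inj h₃)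
  suffices H : ∃ bs, as = bs ++ as' ∧ M.Eq Γ (apps t bs) r S by
    obtain ⟨bs, rfl, hr⟩ := H
    rw [apps_append]
    refine hF.inferArgs_eq hΓ hK ?_
    rwa [show toSub [] = Tm.var from rfl, Tm.subst_var _ fun _ => rfl]
  cases t with
  | univ n =>
    change caseBool (Nat.ble n 7) none _ = _ at h₁
    rcases hn : Nat.ble n 7
    · rw [hn] at h₁
      obtain ⟨e, he, h₁⟩ := caseOpt_eq_some.mp (h₁ : caseOpt (lookup L (n.sub 8)) _ none = _)
      have := hF.stepGlobal hΓ (hL he) h₁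
      have hn : ¬ n ≤ 7 := fun h' => by simp [Nat.ble_eq.mpr h'] at hn
      rwa [show n.sub 8 + 8 = n from Nat.sub_add_cancel (by omega)] at this
    · rw [hn] at h₁
      exact absurd h₁ (by simp [caseBool])
  | lam A b =>
    cases as with
    | nil => exact absurd h₁ (by simp [caseHead, caseList])
    | cons a as =>
      change F.stepBeta Γ (a :: as) Γ (lam A b) [] = _ at h₁
      obtain ⟨bs, K, e, hK, H⟩ := hF.stepBeta hΓ h₁ hΓ (subst_var hΓ)
      refine ⟨bs, e, H _ ?_⟩
      rw [show toSub [] = Tm.var from rfl, Tm.subst_var _ fun _ => rfl,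
        Tm.subst_var _ fun _ => rfl]
      exact hK.refl
  | const c =>
    cases L with
    | nil => exact absurd h₁ (by simp [caseHead, caseList])
    | cons e L => exact hF.stepConst hΓ (hR (by simp)) h₁
  | _ => exact absurd h₁ (by simp [caseHead])

theorem inferHead (hL : M.EnvSound L) {as : List Tm} (h : F.inferHead L Γ t as = some T) :
    M.Ty Γ t T := by
  cases t with
  | var n =>
    obtain ⟨A, hA, h⟩ := caseOpt_eq_some.mp (h : caseOpt (nth Γ n) _ none = _)
    rw [force_eq, shift_zero] at h
    obtain rfl := Option.some.inj h
    exact .var hΓ ((nth_eq _ _).symm.trans hA)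
  | univ n =>
    change caseBool (Nat.ble n 7) (caseBool (Nat.beq n 0) (Tm.force (.univ 2) some)
      (caseBool (Nat.ble n 6) (Tm.force (.univ n.succ) some) none)) _ = _ at h
    simp only [force_eq] at h
    rcases hn : Nat.ble n 7
    · rw [hn] at h
      obtain ⟨e, he, h⟩ := caseOpt_eq_some.mp (h : caseOpt (lookup L (n.sub 8)) _ none = _)
      obtain rfl : e.type = T := Option.some.inj h
      have := (hL he).weaken hΓ
      have hn : ¬ n ≤ 7 := fun h' => by simp [Nat.ble_eq.mpr h'] at hn
      rwa [show n.sub 8 + 8 = n from Nat.sub_add_cancel (by omega)] at this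
    · rw [hn] at h
      cases n with
      | zero =>
        obtain rfl := Option.some.inj h
        exact .univ_zero hΓ
      | succ n =>
        obtain ⟨hn, h⟩ := caseBool_eq_some.mp
          (h : caseBool (Nat.ble (n + 1) 6) (some (univ (n + 2))) none = _)
        obtain rfl := Option.some.inj h
        have := Nat.ble_eq.mp hn
        exact .univ_succ hΓ (by omega)
  | pi A B =>
    obtain ⟨i, hi, h⟩ := caseOpt_eq_some.mp (h : F.inferPi Γ A B = _)
    obtain ⟨j, hj, h⟩ := caseOpt_eq_some.mp h
    rw [force_eq, larger_eq] at h
    obtain rfl := Option.some.inj h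
    have hA := hF.level hΓ hi
    have hB := hF.level (hΓ.cons (hF.isType hΓ hi)) hj
    have hm := max_le hA.1 hB.1
    exact .pi ((sub_univ (le_max_left i j) hm).1 _ hA.2)
      ((sub_univ (le_max_right i j) hm).1 _ hB.2) hm
  | lam A b =>
    obtain ⟨i, hi, h⟩ := caseOpt_eq_some.mp (h : F.inferLam Γ A b = _)
    obtain ⟨B, hB, h⟩ := caseOpt_eq_some.mp h
    obtain rfl := Option.some.inj h
    have hA := hF.isType hΓ hi
    exact .lam hA (hF.infer (hΓ.cons hA) hB)
  | app f a => exact absurd h (by simp [Checker.inferHead, caseHead])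
  | const c =>
    change F.inferConst Γ as c = _ at h
    simp only [Checker.inferConst, casePair_eq, forceNat_eq] at h
    obtain ⟨hi, h⟩ := caseBool_eq_some.mp h
    obtain ⟨hj, h⟩ := caseBool_eq_some.mp h
    rw [evalConst_eq h]
    exact .const hΓ c (Nat.ble_eq.mp hi) (Nat.ble_eq.mp hj)

theorem equalSpines (hL : M.EnvSound L) (h : F.equalSpines L Γ t u = some T) : M.Eq Γ t u T := by
  rw [eq_apps_spine t, eq_apps_spine u]
  simp only [Checker.equalSpines, casePair_eq] at h
  generalize (spine t []).1 = a, (spine t []).2 = as, (spine u []).1 = b, (spine u []).2 = bs at *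
  have h' : caseBool (beq a b)
      (caseOpt (F.inferHead L Γ a as) (fun T => F.equalArgs Γ as bs T []) none) none = some T := by
    cases a with
    | pi => exact absurd h (by simp [caseLam, casePi])
    | lam => exact absurd h (by simp [caseLam])
    | _ => exact h
  obtain ⟨hb, h₁⟩ := caseBool_eq_some.mp h'
  obtain ⟨A, hA, h₂⟩ := caseOpt_eq_some.mp h₁
  rw [← eq_of_beq hb]
  refine hF.equalArgs hΓ h₂ ?_
  rw [show toSub [] = Tm.var from rfl, Tm.subst_var _ fun _ => rfl]
  exact (hF.inferHead hΓ hL hA).refl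

/-- By η the term `u` is the abstraction of its application to a fresh variable, so it suffices to
compare bodies. -/
theorem equalEta (h : F.equalEta Γ A b u = some T) : M.Eq Γ (lam A b) u T := by
  obtain ⟨n, hn, h⟩ := caseOpt_eq_some.mp h
  obtain ⟨U, hU, h⟩ := caseOpt_eq_some.mp h
  obtain ⟨A', B, hs, h⟩ := hF.asPi hΓ h (by simp)
  obtain ⟨m, hm, h⟩ := caseOpt_eq_some.mp h
  rw [force_eq, shift_zero] at h
  obtain ⟨B', hB', h⟩ := caseOpt_eq_some.mp h
  obtain ⟨l, hl, h⟩ := caseOpt_eq_some.mp h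
  obtain rfl := Option.some.inj h
  have hA := hF.isType hΓ hn
  have hAA' := hF.eqType hΓ hm
  have hΓA := hΓ.cons hA
  exact (Eq.lam hA hAA' (hF.equal hΓA hB')).trans
    ((Ty.eta (hs.1.1 _ (hF.infer hΓ hU))).sub
      (EqType.pi hA hAA' (hF.eqType hΓA hl).symm).symm.sub).symm

theorem equalWhnf (hL : M.EnvSound L) (h : F.equalWhnf L Γ t u = some T) : M.Eq Γ t u T := by
  have last : ∀ {t u : Tm}, caseLam u (fun A b => F.equalEta Γ A b t) (F.equalSpines L Γ t u) =
      some T → M.Eq Γ t u T := fun {t u} h => by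
    cases u with
    | lam A b => exact (hF.equalEta hΓ h).symm
    | _ => exact hF.equalSpines hΓ hL h
  cases t with
  | pi A B =>
    cases u with
    | pi A' B' =>
      obtain ⟨i, hi, h⟩ := caseOpt_eq_some.mp (h : caseOpt (F.level Γ A) _ none = _)
      obtain ⟨i', hi', h⟩ := caseOpt_eq_some.mp h
      obtain ⟨j, hj, h⟩ := caseOpt_eq_some.mp h
      rw [force_eq, larger_eq, larger_eq] at h
      obtain rfl := Option.some.inj h
      have hA := hF.level hΓ hi
      have hA' := hF.equalTypes hΓ hi'
      have hB := hF.equalTypes (hΓ.cons (hF.isType hΓ hi)) hj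
      have hm := max_le hA.1 (max_le hA'.1 hB.1)
      exact Eq.pi ((sub_univ (by omega) hm).1 _ hA.2) ((sub_univ (by omega) hm).2 _ _ hA'.2)
        ((sub_univ (by omega) hm).2 _ _ hB.2) hm
    | _ => exact absurd h (by simp [Checker.equalWhnf, casePi])
  | lam A b =>
    by_cases h' : (∃ A' b', u = lam A' b')
    · obtain ⟨A', b', rfl⟩ := h'
      obtain ⟨i, hi, h⟩ := caseOpt_eq_some.mp (h : caseOpt (F.level Γ A) _ none = _)
      obtain ⟨i', hi', h⟩ := caseOpt_eq_some.mp h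
      obtain ⟨B, hB, h⟩ := caseOpt_eq_some.mp h
      obtain rfl := Option.some.inj h
      have hA := hF.isType hΓ hi
      exact Eq.lam hA (hF.eqType hΓ hi') (hF.equal (hΓ.cons hA) hB)
    · refine hF.equalEta hΓ ?_
      cases u with
      | lam A' b' => exact absurd ⟨A', b', rfl⟩ h'
      | _ => exact h
  | _ => exact last h

omit hF hΓ in
theorem reduct_chain {o : Option Tm} (h : M.Reduct Γ t t' o) (hs : ∀ S, o = some S → M.Sub Γ S R)
    (he : M.Eq Γ t' u R) : M.Eq Γ t u R := by
  rcases o with _ | S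
  · rwa [← h.1 rfl]
  · exact ((h.2 S rfl).sub (hs S rfl)).trans he

theorem chain {o o' : Option Tm} (h : F.chain Γ o T o' = some R) (ht : M.Reduct Γ t t' o)
    (hu : M.Reduct Γ u u' o') (he : M.Eq Γ t' u' T) : M.Eq Γ t u R := by
  obtain ⟨S, hS, h⟩ := caseOpt_eq_some.mp h
  have h₁ : M.Sub Γ T S ∧ ∀ K, o = some K → M.Sub Γ K S := by
    rcases o with _ | K
    · obtain rfl := Option.some.inj hS
      exact ⟨.refl, by simp⟩
    · have := hF.join hΓ hS
      exact ⟨this.2, fun _ e => Option.some.inj e ▸ this.1⟩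
  have h₂ : M.Sub Γ S R ∧ ∀ K, o' = some K → M.Sub Γ K R := by
    rcases o' with _ | K
    · obtain rfl := Option.some.inj h
      exact ⟨.refl, by simp⟩
    · have := hF.join hΓ h
      exact ⟨this.2, fun _ e => Option.some.inj e ▸ this.1⟩
  refine reduct_chain ht (fun K hK => (h₁.2 K hK).trans h₂.1) ?_
  exact (reduct_chain hu h₂.2 (he.sub (h₁.1.trans h₂.1)).symm).symm

theorem equalRed (hL : M.EnvSound L) (h : F.equalRed L Γ t u = some T) : M.Eq Γ t u T := by
  simp only [Checker.equalRed, casePair_eq] at h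
  obtain ⟨S, hS, h⟩ := caseOpt_eq_some.mp h
  refine hF.chain hΓ h (hF.red t hΓ) (hF.red u hΓ) ?_
  rcases hb : beq (F.red Γ t).1 (F.red Γ u).1
  · rw [hb] at hS
    exact hF.equalWhnf hΓ hL hS
  · rw [hb] at hS
    rw [← eq_of_beq hb]
    exact (hF.infer hΓ hS).refl

theorem equalStep (hL : M.EnvSound L) (hR : L ≠ [] → M.RulesSound)
    (h : F.equalStep L Γ t u = some T) : M.Eq Γ t u T := by
  simp only [Checker.equalStep, casePair_eq, forceNat_eq] at h
  generalize Checker.rank L (spine t []).1 (spine t []).2 = m,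
    Checker.rank L (spine u []).1 (spine u []).2 = n at h
  rcases h₁ : Nat.ble (larger m n) 0
  · rw [h₁] at h
    rcases h₂ : Nat.ble n m
    · rw [h₂] at h
      rcases h₃ : F.step L Γ (spine u []).1 (spine u []).2 with _ | ⟨r, S⟩
      · rw [h₃] at h
        exact hF.equalRed hΓ hL h
      · rw [h₃] at h
        obtain ⟨K, hK, h⟩ := caseOpt_eq_some.mp (h : caseOpt (F.equal Γ t r) _ none = _)
        have hs := hF.join hΓ h
        have := hF.step hΓ hL hR h₃
        rw [← eq_apps_spine u] at this
        exact ((hF.equal hΓ hK).sub hs.1).trans (this.sub hs.2).symm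
    · rw [h₂] at h
      rcases h₃ : F.step L Γ (spine t []).1 (spine t []).2 with _ | ⟨r, S⟩
      · rw [h₃] at h
        exact hF.equalRed hΓ hL h
      · rw [h₃] at h
        obtain ⟨K, hK, h⟩ := caseOpt_eq_some.mp (h : caseOpt (F.equal Γ r u) _ none = _)
        have hs := hF.join hΓ h
        have := hF.step hΓ hL hR h₃
        rw [← eq_apps_spine t] at this
        exact (this.sub hs.2).trans ((hF.equal hΓ hK).sub hs.1)
  · rw [h₁] at h
    exact hF.equalRed hΓ hL h

end Sound
end Model
end HoTT

namespace HoTT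

noncomputable section

open Tm Checker

/-! ## The computation rules are well typed -/

/-- Are the domains types? -/
def Checker.telescope (F : Checker) (Δ : List Tm) : List Tm → Bool := List.rec (fun _ => true)
  (fun A _ ih Γ => caseOpt (F.level Γ A) (fun _ => ih (A :: Γ)) false) Δ

/-- Are both sides of a computation rule well typed? -/
def ruleOk (i j k : ℕ) : Bool := caseOpt (evalRule i j k) (fun r => caseRule r fun Δ l r T =>
  caseBool ((checker [] 50).telescope Δ []) (caseBool ((checker [] 50).check (Δ.reverse) l T)
    ((checker [] 50).check (Δ.reverse) r T) false) false) true

set_option maxRecDepth 100000 in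
-- There are five codes for either level and eleven rules. The empty environment is essential: with
-- it the checker never invokes the computation rules that are being verified.
theorem ruleOk_true : (List.range 5).all (fun i => (List.range 5).all fun j =>
    (List.range 11).all fun k => ruleOk i j k) = true := by
  decide +kernel

end

end HoTT

noncomputable section

namespace HoTT

/-! ## Writing typed terms

Types and terms are wrapped, so that Lean's elaborator finds implicit arguments.  The type of a
wrapped term is only a hint; what counts is the verdict of the checker. -/

/-- A type. -/
structure Ty where
  e : Exp

/-- A term of the type `A`. -/
structure El (A : Ty) where
  e : Exp

/-- The type `Ty` under a name for each universe, by which `Quote` tells the universe. -/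
class Level (n : ℕ) where
  types : Type

instance (n : ℕ) : Level n := ⟨Ty⟩

/-- A type in the universe with code `n`. -/
abbrev TyAt (n : ℕ) : Type := Level.types n

/-- Lean types that stand for types of the theory. -/
class Quote (α : Type) where
  ty : Exp
  quote : α → Exp
  unquote : Exp → α

instance (A : Ty) : Quote (El A) := ⟨A.e, El.e, El.mk⟩
instance (n : ℕ) : Quote (TyAt n) := ⟨Exp.U n, Ty.e, Ty.mk⟩
-- A type variable without a stated level ranges over the universe with code 4; by cumulativity such
-- a definition applies to types at all lower codes.
instance : Quote Ty := ⟨Exp.U 4, Ty.e, Ty.mk⟩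
instance {α : Type} {β : α → Type} [Quote α] [∀ a, Quote (β a)] : Quote ((a : α) → β a) where
  ty := Exp.pi (Quote.ty α) fun x => Quote.ty (β (Quote.unquote x))
  quote f := Exp.lam (Quote.ty α) fun x => Quote.quote (f (Quote.unquote x))
  unquote e := fun a => Quote.unquote (e ⬝ Quote.quote a)

/-- The entry of the environment with the value `a`. -/
def entry {α : Type} [Quote α] (a : α) (arity : Option ℕ := none) : Entry :=
  ⟨(Quote.ty α).close, (Quote.quote a).close, arity⟩

/-- An entry that the checker unfolds when it has all arguments. -/
def reducible (e : Entry) : Entry := ⟨e.type, e.value, some e.value.numLams⟩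

/-- The `k`-th global constant, whose value is `a`. -/
def glb {α : Type} [Quote α] (k : ℕ) (_ : α) : α := Quote.unquote fun _ => .univ (k + 8)

/-- A term that has two types, which are judgmentally equal. -/
def El.as {A : Ty} (t : El A) {B : Ty} : El B := ⟨t.e⟩

/-- The type that a Lean type stands for. -/
def Q (α : Type) [Quote α] : Ty := ⟨Quote.ty α⟩
def qu {α : Type} [Quote α] (a : α) : El (Q α) := ⟨Quote.quote a⟩
def un {α : Type} [Quote α] (a : El (Q α)) : α := Quote.unquote a.e

/-- The universe with code `n`. -/
def Un (n : ℕ) : Ty := ⟨Exp.U n⟩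
/-- A type as an element of a universe. -/
def Ty.el (n : ℕ) (A : Ty) : El (Un n) := ⟨A.e⟩
/-- The type given by an element of a universe. -/
def El.ty {n : ℕ} (A : El (Un n)) : TyAt n := Ty.mk A.e

/-- Dependent functions. -/
def Fn (A : Ty) (B : El A → Ty) : Ty := ⟨Exp.pi A.e fun x => (B ⟨x⟩).e⟩
infixr:45 " ⇾ " => fun A B => Fn A fun _ => B

def Lam {A : Ty} {B : El A → Ty} (b : (x : El A) → El (B x)) : El (Fn A B) :=
  ⟨Exp.lam A.e fun x => (b ⟨x⟩).e⟩

/-- Application. -/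
def El.app {A : Ty} {B : El A → Ty} (f : El (Fn A B)) (x : El A) : El (B x) :=
  ⟨f.e ⬝ x.e⟩
infixl:100 " ⦿ " => El.app

/-- Identity types. -/
def Eqq {A : Ty} (x y : El A) : Ty := ⟨Id A.e x.e y.e⟩
infix:50 " ≐ " => Eqq
/-- Reflexivity. -/
def rfl' {A : Ty} {x : El A} : El (x ≐ x) := ⟨refl A.e x.e⟩

/-- Reflexivity at terms that are judgmentally equal. -/
def triv {A : Ty} {x y : El A} : El (x ≐ y) := ⟨refl A.e x.e⟩

/-- Path induction. -/
def J {A : Ty} {a : El A} (P : (x : El A) → El (a ≐ x) → Ty) (d : El (P a rfl')) {b : El A}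
    (p : El (a ≐ b)) : El (P b p) :=
  ⟨pathInd A.e a.e (fun x p => (P ⟨x⟩ ⟨p⟩).e) d.e b.e p.e⟩

/-- Here the motive is a type of Lean functions, so hypotheses that depend on the endpoint can be
generalised in the motive without explicit abstractions. -/
def J' {A : Ty} {a : El A} (P : (x : El A) → El (a ≐ x) → Type) [∀ x p, Quote (P x p)]
    (d : P a rfl') {b : El A} (p : El (a ≐ b)) : P b p :=
  un (J (fun x p => Q (P x p)) (qu d) p)

/-- Dependent pairs. -/
def Sg (A : Ty) (B : El A → Ty) : Ty := ⟨SigmaT A.e fun x => (B ⟨x⟩).e⟩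
infixr:70 " ⊗ " => fun A B => Sg A fun _ => B
def mk {A : Ty} {B : El A → Ty} (a : El A) (b : El (B a)) : El (Sg A B) :=
  ⟨pair A.e (fun x => (B ⟨x⟩).e) a.e b.e⟩
abbrev Contr (A : Ty) : Ty := Sg A fun a => Fn A fun x => a ≐ x

/-- Induction on pairs. -/
def Sg.ind {A : Ty} {B : El A → Ty} (P : El (Sg A B) → Ty)
    (d : (a : El A) → (b : El (B a)) → El (P (mk a b))) (u : El (Sg A B)) : El (P u) :=
  ⟨Exp.con .sigmaInd [A.e, Exp.lam A.e fun x => (B ⟨x⟩).e, Exp.lam (Sg A B).e fun u => (P ⟨u⟩).e,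
    Exp.lam A.e fun a => Exp.lam (B ⟨a⟩).e fun b => (d ⟨a⟩ ⟨b⟩).e, u.e]⟩

/-- The functions with a left inverse and a right inverse. -/
abbrev IsEqu {A B : Ty} (f : El (A ⇾ B)) : Ty :=
  Sg (Sg (B ⇾ A) fun g => Fn A fun a => g ⦿ (f ⦿ a) ≐ a) fun _ =>
    Sg (B ⇾ A) fun h => Fn B fun b => f ⦿ (h ⦿ b) ≐ b

/-- Equivalences. -/
abbrev Equ (A B : Ty) : Ty := Sg (A ⇾ B) fun f => IsEqu f

/-- The unit type. -/
def One : Ty := ⟨UnitT⟩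
def one : El One := ⟨star⟩
def One.ind (P : El One → Ty) (d : El (P one)) (u : El One) : El (P u) :=
  ⟨Exp.con .unitInd [Exp.lam UnitT fun u => (P ⟨u⟩).e, d.e, u.e]⟩

/-- Disjoint sums. -/
def Sm (A B : Ty) : Ty := ⟨SumT A.e B.e⟩
def inl' {A B : Ty} (a : El A) : El (Sm A B) := ⟨Exp.con .inl [A.e, B.e, a.e]⟩
def inr' {A B : Ty} (b : El B) : El (Sm A B) := ⟨Exp.con .inr [A.e, B.e, b.e]⟩
def Sm.ind {A B : Ty} (P : El (Sm A B) → Ty) (l : (a : El A) → El (P (inl' a)))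
    (r : (b : El B) → El (P (inr' b))) (u : El (Sm A B)) : El (P u) :=
  ⟨Exp.con .sumInd [A.e, B.e, Exp.lam (Sm A B).e fun u => (P ⟨u⟩).e,
    Exp.lam A.e fun a => (l ⟨a⟩).e, Exp.lam B.e fun b => (r ⟨b⟩).e, u.e]⟩

/-- The natural numbers. -/
def Nt : Ty := ⟨NatT⟩
def O : El Nt := ⟨zero⟩
def S (n : El Nt) : El Nt := ⟨succ n.e⟩
def Nt.ind (P : El Nt → Ty) (z : El (P O)) (s : (n : El Nt) → El (P n) → El (P (S n)))
    (n : El Nt) : El (P n) :=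
  ⟨Exp.con .natInd [Exp.lam NatT fun n => (P ⟨n⟩).e, z.e,
    Exp.lam NatT fun n => Exp.lam (P ⟨n⟩).e fun r => (s ⟨n⟩ ⟨r⟩).e, n.e]⟩
-- As for `J'`, the motive may be a type of Lean functions, which gives induction hypotheses that
-- quantify over types and families.
def Nt.ind' (P : El Nt → Type) [∀ n, Quote (P n)] (z : P O)
    (s : (n : El Nt) → P n → P (S n)) (n : El Nt) : P n :=
  un (Nt.ind (fun n => Q (P n)) (qu z) (fun n r => qu (s n (un r))) n)

end HoTT

end

namespace HoTT

noncomputable section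

/-! ## Environments -/

/-- The continuation `k` is applied to the entry that `e` evaluates to. -/
def Entry.force {R : Type} (e : Entry) (k : Entry → R) : R := caseEntry e fun T v o =>
  T.force fun T => v.force fun v => caseOpt o (fun n => forceNat n fun n => k ⟨T, v, some n⟩)
    (k ⟨T, v, none⟩)

/-- The continuation `k` is applied to the list that `L` evaluates to. -/
def forceEntries {R : Type} (L : List Entry) : (List Entry → R) → R := List.rec (fun k => k [])
  (fun e _ ih k => e.force fun e => ih fun L => k (e :: L)) L

/-- May the entries be added one after the other? -/
def okAll (es L : List Entry) : Bool := forceEntries L <| List.rec (fun _ => true)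
  (fun e _ ih L => e.force fun e => caseBool (e.ok L) (ih (e :: L)) false) es

end

end HoTT

/-! ### Soundness of the whole checker and of environments. -/

namespace HoTT

open Tm Model

namespace Model

variable {M : Model} {F : Checker} {L : List Entry} {Γ Δ : List Tm} {A B T a b t : Tm} {n : ℕ}

theorem Sound.next (hF : M.Sound F) (hL : M.EnvSound L) (hR : L ≠ [] → M.RulesSound) :
    M.Sound (F.next L) where
  infer {Γ t A} hΓ h := by
    obtain ⟨T, hT, h⟩ := caseOpt_eq_some.mp
      (h : caseOpt (F.inferHead L Γ (spine t []).1 (spine t []).2) _ none = _)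
    rw [eq_apps_spine t]
    refine hF.inferArgs hΓ h ?_
    rw [show toSub [] = Tm.var from rfl, Tm.subst_var _ fun _ => rfl]
    exact hF.inferHead hΓ hL hT
  check {Γ a A} hΓ h := by
    have last : caseBool (beq a (.const .univalence)) (casePi A (fun D _ => caseUniv D (fun n =>
        caseBool (Nat.ble n 7) (caseOpt (evalConst n 0 .univalence) (fun T => F.sub Γ T A) false)
          false) false) false)
        (caseOpt (F.infer Γ a) (fun A' => F.sub Γ A' A) false) = true → M.Ty Γ a A := fun h => by
      rcases hb : beq a (.const .univalence)
      · rw [hb] at h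
        obtain ⟨S, hS, h⟩ := caseOpt_eq_true.mp (h : caseOpt (F.infer Γ a) _ false = _)
        exact (hF.sub hΓ h).1 _ (hF.infer hΓ hS)
      · rw [hb] at h
        change casePi A _ false = true at h
        obtain ⟨D, B, hA, h₁⟩ := casePi_ne h (by simp)
        obtain ⟨n, hD, h₂⟩ := caseUniv_ne h₁ (by simp)
        obtain ⟨hn, h₃⟩ := caseBool_eq_true.mp h₂
        obtain ⟨T, hT, h₄⟩ := caseOpt_eq_true.mp h₃
        rw [eq_of_beq hb]
        refine (hF.sub hΓ h₄).1 _ ?_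
        rw [evalConst_eq hT]
        exact .const hΓ _ (Nat.ble_eq.mp hn) (by omega)
    cases a with
    | lam A' b =>
      change F.asPi Γ A _ false = true at h
      obtain ⟨A₁, B, hs, h⟩ := hF.asPi hΓ h (by simp)
      obtain ⟨n, hn, h⟩ := caseOpt_eq_true.mp h
      obtain ⟨hb, h⟩ := caseBool_eq_true.mp h
      have hA := hF.isType hΓ hn
      exact hs.2.1 _ ((hF.subDomain hΓ hA h).1 _ (.lam hA (hF.check (hΓ.cons hA) hb)))
    | _ => exact last h
  red {Γ} t hΓ := by
    change M.Reduct Γ t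
      (caseOpt (F.step L Γ (spine t []).1 (spine t []).2)
        (fun r => casePair r fun r T => casePair (F.red Γ r) fun r' o => caseOpt o
          (fun T' => caseOpt (F.join Γ T' T) (fun T => (r', some T)) (r, some T))
          (r, some T)) (t, none)).1
      (caseOpt (F.step L Γ (spine t []).1 (spine t []).2)
        (fun r => casePair r fun r T => casePair (F.red Γ r) fun r' o => caseOpt o
          (fun T' => caseOpt (F.join Γ T' T) (fun T => (r', some T)) (r, some T))
          (r, some T)) (t, none)).2
    rcases h : F.step L Γ (spine t []).1 (spine t []).2 with _ | ⟨r, T⟩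
    · exact ⟨fun _ => rfl, fun T h => by simp [caseOpt] at h⟩
    · have hr := hF.step hΓ hL hR h
      rw [← eq_apps_spine t] at hr
      have kept : M.Reduct Γ t r (some T) :=
        ⟨fun h => by simp at h, fun _ e => Option.some.inj e ▸ hr⟩
      simp only [caseOpt, casePair_eq]
      rcases ho : (F.red Γ r).2 with _ | T'
      · exact kept
      · rcases hj : F.join Γ T' T with _ | S
        · simpa [hj] using kept
        · simp only [hj]
          have hs := hF.join hΓ hj
          exact ⟨fun h => by simp at h, fun _ e => Option.some.inj e ▸
            (hr.sub hs.2).trans (((hF.red r hΓ).2 _ ho).sub hs.1)⟩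
  equal {Γ t u A} hΓ h := by
    change caseBool (beq t u) (F.infer Γ t) (caseOpt (F.equalSpines L Γ t u) some
      (F.equalStep L Γ t u)) = _ at h
    rcases hb : beq t u
    · rw [hb] at h
      rcases hs : F.equalSpines L Γ t u with _ | S
      · rw [hs] at h
        exact hF.equalStep hΓ hL hR h
      · rw [hs] at h
        obtain rfl := Option.some.inj h
        exact hF.equalSpines hΓ hL hs
    · rw [hb] at h
      rw [← eq_of_beq hb]
      exact (hF.infer hΓ h).refl
  checkEqual {Γ t u A} hΓ h := by
    have last : caseOpt (F.equal Γ t u) (fun T => F.sub Γ T A) false = true → M.Eq Γ t u A :=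
      fun h => by
        obtain ⟨S, hS, h⟩ := caseOpt_eq_true.mp h
        exact (hF.equal hΓ hS).sub (hF.sub hΓ h)
    change caseBool (beq t u) (F.check Γ t A) (caseLam t _ _) = _ at h
    rcases hb : beq t u
    · rw [hb] at h
      cases t with
      | lam A' b =>
        cases u with
        | lam A'' b' =>
          change F.asPi Γ A _ false = true at h
          obtain ⟨A₁, B, hs, h⟩ := hF.asPi hΓ h (by simp)
          obtain ⟨n, hn, h⟩ := caseOpt_eq_true.mp h
          obtain ⟨hd, h⟩ := caseBool_eq_true.mp h
          obtain ⟨m, hm, h⟩ := caseOpt_eq_true.mp h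
          have hA := hF.isType hΓ hn
          exact ((Eq.lam hA (hF.eqType hΓ hm) (hF.checkEqual (hΓ.cons hA) h)).sub
            (hF.subDomain hΓ hA hd)).sub hs.2
        | _ => exact last h
      | _ => exact last h
    · rw [hb] at h
      rw [← eq_of_beq hb]
      exact (hF.check hΓ h).refl

/-- Induction on the fuel; without fuel nothing is accepted. Well-typedness of the computation rules
is required only for nonempty environments, since `rulesSound` itself relies on the checker with the
empty one. -/
theorem sound_checker (hL : M.EnvSound L) (hR : L ≠ [] → M.RulesSound) (n : ℕ) :
    M.Sound (checker L n) := by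
  induction n with
  | zero =>
    exact {
      infer := fun _ h => absurd h (by simp [checker])
      check := fun _ h => absurd h (by simp [checker])
      red := fun t _ => ⟨fun _ => rfl, fun T h => absurd h (by simp [checker])⟩
      equal := fun _ h => absurd h (by simp [checker])
      checkEqual := fun _ h => absurd h (by simp [checker]) }
  | succ n ih => exact ih.next hL hR

/-! ## The computation rules -/

theorem Sound.telescope (hF : M.Sound F) (hΓ : M.Ctx Γ) (h : F.telescope Δ Γ = true) :
    M.Ctx (Δ.reverse ++ Γ) := by
  induction Δ generalizing Γ with
  | nil => exact hΓ
  | cons A Δ ih =>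
    obtain ⟨n, hn, h⟩ := caseOpt_eq_true.mp h
    rw [List.reverse_cons, List.append_assoc]
    exact ih (hΓ.cons (hF.isType hΓ hn)) h

theorem ctx_nil : M.Ctx [] := .nil

variable (M) in
theorem rulesSound : M.RulesSound := by
  intro i j k Δ l r T hi hj h
  have hF : M.Sound (checker [] 50) := sound_checker (fun _ _ h => by simp [lookup] at h)
    (fun h => absurd rfl h) 50
  -- There are eleven computation rules, so the finite table `ruleOk_true` covers every index with
  -- an entry.
  have hk : k < 11 := by
    by_contra hk
    have : nth (computation i j) k = none := by
      rw [nth_eq, List.getElem?_eq_none_iff]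
      exact Nat.le_of_not_lt hk
    simp [evalRule, this, caseOpt] at h
  have ok := List.all_eq_true.mp (List.all_eq_true.mp (List.all_eq_true.mp ruleOk_true i
    (List.mem_range.mpr (by omega))) j (List.mem_range.mpr (by omega))) k (List.mem_range.mpr hk)
  rw [ruleOk, h] at ok
  obtain ⟨h₁, ok⟩ := caseBool_eq_true.mp (ok : caseBool _ (caseBool _ _ false) false = true)
  obtain ⟨h₂, h₃⟩ := caseBool_eq_true.mp ok
  have hΔ := hF.telescope ctx_nil h₁
  rw [List.append_nil] at hΔ
  exact ⟨hΔ, hF.check hΔ h₂, hF.check hΔ h₃⟩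

/-! ## The global constants -/

/-- An abstraction is accepted only if its body was accepted against the codomain. Following this
through the binders, each of which uses one unit of fuel, gives the typing of the body over the
telescope that unfolding needs. -/
theorem check_lams (hL : M.EnvSound L) {m n : ℕ} {v : Tm} (hΓ : M.Ctx Γ)
    (h : (checker L m).check Γ v T = true) (e : (splitPi n T).1 = (splitLam n v).1)
    (hn : (splitPi n T).1.length = n) :
    M.Ctx ((splitPi n T).1.reverse ++ Γ) ∧
      M.Ty ((splitPi n T).1.reverse ++ Γ) (splitLam n v).2 (splitPi n T).2 := by
  induction n generalizing m Γ T v with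
  | zero => exact ⟨hΓ, (sound_checker hL (fun _ => M.rulesSound) m).check hΓ h⟩
  | succ n ih =>
    cases m with
    | zero => exact absurd h (by simp [checker])
    | succ m =>
      have hF := sound_checker hL (fun _ => M.rulesSound) m
      cases T with
      | pi A B =>
        cases v with
        | lam A' b =>
          obtain ⟨rfl, e'⟩ := List.cons.inj (e : A :: (splitPi n B).1 = A' :: (splitLam n b).1)
          have hn : (splitPi n B).1.length = n := Nat.succ.inj hn
          obtain ⟨k, hk, h⟩ := caseOpt_eq_true.mp
            (h : caseOpt ((checker L m).level Γ A) _ false = true)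
          obtain ⟨hb, -⟩ := caseBool_eq_true.mp h
          change M.Ctx ((A :: (splitPi n B).1).reverse ++ Γ) ∧
            M.Ty ((A :: (splitPi n B).1).reverse ++ Γ) (splitLam n b).2 (splitPi n B).2
          rw [List.reverse_cons, List.append_assoc]
          exact ih (hΓ.cons (hF.isType hΓ hk)) hb e' hn
        | _ => exact absurd e (List.cons_ne_nil _ _)
      | _ => exact absurd hn (by simp [splitPi, casePi])

/-- The entries of an environment that were checked one after the other. -/
def okChain : List Entry → Prop
  | [] => True
  | e :: L => e.ok L = true ∧ okChain L

variable (M) in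
/-- The global constants have the values that are given by an environment. -/
def Solves : List Entry → Prop
  | [] => True
  | e :: L => M.val L.length = M.interp e.value ∧ Solves L

theorem entry_ok {e : Entry} (h : e.ok L = true) :
    bounded L.length e.type 0 = true ∧ bounded L.length e.value 0 = true ∧
      (checker L 1000).check [] e.value e.type = true ∧ ∀ n, e.arity = some n →
        (splitPi n e.type).1 = (splitLam n e.value).1 ∧ (splitPi n e.type).1.length = n := by
  obtain ⟨h₁, h⟩ := caseBool_eq_true.mp h
  obtain ⟨h₂, h⟩ := caseBool_eq_true.mp h
  obtain ⟨n, -, h⟩ := caseOpt_eq_true.mp h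
  obtain ⟨h₃, h⟩ := caseBool_eq_true.mp h
  refine ⟨h₁, h₂, h₃, fun n hn => ?_⟩
  rw [hn] at h
  obtain ⟨h₄, h₅⟩ := caseBool_eq_true.mp
    (h : caseBool (beqList _ _) (Nat.beq (splitPi n e.type).1.length n) false = true)
  exact ⟨eq_of_beqList h₄, Nat.eq_of_beq_eq_true h₅⟩

theorem envSound (h : okChain L) (hM : M.Solves L) : M.EnvSound L := by
  induction L with
  | nil => exact fun _ _ h => by simp [lookup] at h
  | cons e L ih =>
    have hL := ih h.2 hM.2
    intro k e' he
    change caseBool (Nat.beq k L.length) (some e) (lookup L k) = some e' at he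
    rcases hk : Nat.beq k L.length
    · rw [hk] at he
      exact hL he
    · rw [hk] at he
      obtain rfl := Option.some.inj he
      obtain rfl := Nat.eq_of_beq_eq_true hk
      obtain ⟨h₁, h₂, h₃, h₄⟩ := entry_ok h.1
      have hv : M.interp (univ (L.length + 8)) = M.interp e.value := by
        rw [← hM.1, interp, if_neg (by omega)]
        rfl
      refine ⟨M.closed_interp h₁, ?_, fun {n} hn => ?_⟩
      · have := (sound_checker hL (fun _ => M.rulesSound) 1000).check ctx_nil h₃
        unfold Ty at this ⊢
        rwa [hv]
      · obtain ⟨h₅, h₆⟩ := h₄ n hn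
        have := check_lams hL ctx_nil h₃ h₅ h₆
        rw [List.append_nil] at this
        refine ⟨this.1, this.2, ?_⟩
        rw [hv, h₅, lams_splitLam]

theorem solves_congr {M' : Model} (hb : M.base = M'.base)
    (hv : ∀ k < L.length, M.val k = M'.val k) (h : okChain L) (hM : M.Solves L) :
    M'.Solves L := by
  induction L with
  | nil => trivial
  | cons e L ih =>
    refine ⟨?_, ih (fun k hk => hv k (hk.trans (Nat.lt_succ_self _))) h.2 hM.2⟩
    rw [← hv _ (Nat.lt_succ_self _), hM.1]
    exact interp_congr hb (fun k hk => hv k (hk.trans (Nat.lt_succ_self _))) (entry_ok h.1).2.1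

/-- Each value mentions only earlier constants. So the values are determined in order of definition,
and adding a new one leaves the interpretation of the earlier entries unchanged. -/
theorem exists_solves (i : ℕ) (h : okChain L) : ∃ M : Model, M.base = i ∧ M.Solves L := by
  induction L with
  | nil => exact ⟨⟨i, fun _ => univ 0, fun _ _ => rfl⟩, rfl, trivial⟩
  | cons e L ih =>
    obtain ⟨M, hM, hs⟩ := ih h.2
    have hc : (M.interp e.value).Closed := M.closed_interp (entry_ok h.1).2.1
    let M' : Model := ⟨i, fun k => if k = L.length then M.interp e.value else M.val k, fun k => by
      split_ifs
      · exact hc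
      · exact M.closed k⟩
    have hv : ∀ k < L.length, M.val k = M'.val k := fun k hk =>
      (if_neg (by omega : ¬ k = L.length)).symm
    refine ⟨M', rfl, ?_, solves_congr hM hv h.2 hs⟩
    exact (if_pos rfl).trans (interp_congr hM hv (entry_ok h.1).2.1)

end Model

/-! ### From a checked environment to a derivable term. -/

theorem Entry.force_eq {R : Type} (e : Entry) (k : Entry → R) : e.force k = k e := by
  obtain ⟨T, v, o⟩ := e
  simp only [Entry.force, caseEntry, Tm.force_eq]
  cases o <;> simp [caseOpt, forceNat_eq]

theorem forceEntries_eq {R : Type} (L : List Entry) (k : List Entry → R) :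
    forceEntries L k = k L := by
  induction L generalizing R with
  | nil => rfl
  | cons e L ih => exact (Entry.force_eq e fun e => forceEntries L fun L => k (e :: L)).trans (ih _)

theorem okChain_of_okAll {es L : List Entry} (h : okAll es L = true) (hL : okChain L) :
    okChain (es.reverse ++ L) := by
  unfold okAll at h
  rw [forceEntries_eq] at h
  induction es generalizing L with
  | nil => exact hL
  | cons e es ih =>
    have h' : caseBool (e.ok L) (List.rec (fun _ => true)
        (fun e _ ih L => e.force fun e => caseBool (e.ok L) (ih (e :: L)) false) es (e :: L))
        false = true := (Entry.force_eq e _).symm.trans h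
    have h₁ := caseBool_eq_true.mp h'
    rw [List.reverse_cons, List.append_assoc]
    exact ih h₁.2 ⟨h₁.1, hL⟩

/-- The last entry of an environment gives an inhabitant of its type. -/
theorem isInhabited_of_okChain {e : Entry} {L : List Entry} (h : okChain (e :: L)) {T : Exp} (i : ℕ)
    (hT : ∀ M : Model, M.base = i → M.interp e.type = T.close) : IsInhabited T := by
  obtain ⟨M, hM, hs⟩ := exists_solves i h
  have : lookup (e :: L) L.length = some e := by
    show caseBool (Nat.beq L.length L.length) (some e) (lookup L L.length) = _
    rw [show Nat.beq L.length L.length = true from Nat.beq_eq.mpr rfl]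
    rfl
  have := (envSound h hs this).typ
  unfold Model.Ty at this
  rw [hT M hM] at this
  exact ⟨_, this⟩

/-- The only universe in the statement has code 1, which is read as the base. This is where a single
checked term yields the theorem at every level. -/
theorem interp_freudenthal (M : Model) :
    M.interp (Freudenthal 1).close = (Freudenthal M.base).close := rfl

end HoTT

noncomputable section
set_option linter.unusedVariables false
set_option synthInstance.maxHeartbeats 200000
set_option synthInstance.maxSize 1000
namespace HoTT
namespace Th
/-! ### Paths -/

def sym.val {A : Ty} {x y : El A} (p : El (x ≐ y)) : El (y ≐ x) :=
  ⟨inv A.e x.e y.e p.e⟩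
def sym := @glb _ _ 0 @sym.val

def cat.val {A : Ty} {x y z : El A} (p : El (x ≐ y)) (q : El (y ≐ z)) : El (x ≐ z) :=
  ⟨concat A.e x.e y.e z.e p.e q.e⟩
def cat := @glb _ _ 1 @cat.val

def tr.val {A : Ty} (P : El A → Ty) {x y : El A} (p : El (x ≐ y)) (u : El (P x)) : El (P y) :=
  ⟨transport A.e (Exp.lam A.e fun x => (P ⟨x⟩).e) x.e y.e p.e ⬝ u.e⟩
def tr := @glb _ _ 2 @tr.val

def ap.val {A B : Ty} (f : El A → El B) {x y : El A} (p : El (x ≐ y)) : El (f x ≐ f y) :=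
  J (fun y _ => f x ≐ f y) rfl' p
def ap := @glb _ _ 3 @ap.val

def dap.val {A : Ty} {P : El A → Ty} (f : (x : El A) → El (P x)) {x y : El A} (p : El (x ≐ y)) :
    El (tr P p (f x) ≐ f y) :=
  J (fun y p => tr P p (f x) ≐ f y) triv p
def dap := @glb _ _ 4 @dap.val

def cat_rfl.val {A : Ty} {x y : El A} (p : El (x ≐ y)) : El (cat p rfl' ≐ p) :=
  J (fun _ p => cat p rfl' ≐ p) triv p
def cat_rfl := @glb _ _ 5 @cat_rfl.val

def rfl_cat.val {A : Ty} {x y : El A} (p : El (x ≐ y)) : El (cat rfl' p ≐ p) :=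
  J (fun _ p => cat rfl' p ≐ p) triv p
def rfl_cat := @glb _ _ 6 @rfl_cat.val

def cat_sym.val {A : Ty} {x y : El A} (p : El (x ≐ y)) : El (cat p (sym p) ≐ rfl') :=
  J (fun _ p => cat p (sym p) ≐ rfl') triv p
def cat_sym := @glb _ _ 7 @cat_sym.val

def sym_cat.val {A : Ty} {x y : El A} (p : El (x ≐ y)) : El (cat (sym p) p ≐ rfl') :=
  J (fun _ p => cat (sym p) p ≐ rfl') triv p
def sym_cat := @glb _ _ 8 @sym_cat.val

def tr_const.val {A B : Ty} {x y : El A} (p : El (x ≐ y)) (b : El B) : El (tr (fun _ => B) p b ≐ b) :=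
  J (fun _ p => tr (fun _ => B) p b ≐ b) triv p
def tr_const := @glb _ _ 9 @tr_const.val

/-- A dependent path over a constant family. -/
def dap_const.val {A B : Ty} (f : El A → El B) {x y : El A} (p : El (x ≐ y)) :
    El (dap f p ≐ cat (tr_const p (f x)) (ap f p)) :=
  J (fun _ p => dap f p ≐ cat (tr_const p (f x)) (ap f p)) triv p
def dap_const := @glb _ _ 10 @dap_const.val

def pathEntries : List Entry := [
    reducible (entry @sym.val), reducible (entry @cat.val), reducible (entry @tr.val),
    reducible (entry @ap.val), reducible (entry @dap.val), reducible (entry @cat_rfl.val),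
    reducible (entry @rfl_cat.val), reducible (entry @cat_sym.val),
    reducible (entry @sym_cat.val), reducible (entry @tr_const.val), entry @dap_const.val]

/-- The environment so far. -/
def pathEnv : List Entry := pathEntries.reverse ++ []

set_option maxRecDepth 100000 in
theorem pathEnv_ok : okAll pathEntries [] = true := by decide +kernel

/-! ### Contractible types, and types of bounded truncation level -/

def fst.val {A : Ty} {B : El A → Ty} (u : El (Sg A B)) : El A :=
  Sg.ind (fun _ => A) (fun a _ => a) u
def fst := @glb _ _ 11 @fst.val

def snd.val {A : Ty} {B : El A → Ty} (u : El (Sg A B)) : El (B (fst u)) :=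
  Sg.ind (fun u => B (fst u)) (fun _ b => b.as) u
def snd := @glb _ _ 12 @snd.val

def contr_path.val {A : Ty} (c : El (Contr A)) (x y : El A) : El (x ≐ y) :=
  cat (sym (snd c ⦿ x)) (snd c ⦿ y)
def contr_path := @glb _ _ 13 @contr_path.val

def contr_path_rfl.val {A : Ty} (c : El (Contr A)) (x : El A) : El (contr_path c x x ≐ rfl') :=
  (sym_cat (snd c ⦿ x)).as
def contr_path_rfl := @glb _ _ 14 @contr_path_rfl.val

/-- The type `A` is an `(k - 2)`-type. -/
def isTy.val (k : El Nt) (A : TyAt 2) : TyAt 2 :=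
  (Nt.ind (fun _ => Un 2 ⇾ Un 2) (Lam fun A => (Contr A.ty).el 2)
    (fun _ r => Lam fun A => (Fn A.ty fun x => Fn A.ty fun y => (r ⦿ (x ≐ y).el 2).ty).el 2) k ⦿
    Ty.el 2 A).ty
def isTy := @glb _ _ 15 @isTy.val

def isTyO.val {A : TyAt 2} (h : El (Contr A)) : El (isTy O A) := h.as
def isTyO := @glb _ _ 16 @isTyO.val

def contr_of.val {A : TyAt 2} (h : El (isTy O A)) : El (Contr A) := h.as
def contr_of := @glb _ _ 17 @contr_of.val

def isTyS.val {k : El Nt} {A : TyAt 2} (h : (x y : El A) → El (isTy k (x ≐ y))) :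
    El (isTy (S k) A) :=
  (Lam fun x => Lam fun y => h x y : El (Fn A fun x => Fn A fun y => isTy k (x ≐ y))).as
def isTyS := @glb _ _ 18 @isTyS.val

def isTy_paths.val {k : El Nt} {A : TyAt 2} (h : El (isTy (S k) A)) (x y : El A) :
    El (isTy k (x ≐ y)) :=
  (h.as : El (Fn A fun x => Fn A fun y => isTy k (x ≐ y))) ⦿ x ⦿ y
def isTy_paths := @glb _ _ 19 @isTy_paths.val

def isTy_up.val {k : El Nt} {A : TyAt 2} (h : El (isTy k A)) : El (isTy (S k) A) :=
  Nt.ind' (fun k => (A : TyAt 2) → El (isTy k A) → El (isTy (S k) A))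
    (fun _ h => isTyS fun x y => isTyO (mk (contr_path (contr_of h) x y)
      (Lam fun q => J (fun y q => contr_path (contr_of h) x y ≐ q)
        (contr_path_rfl (contr_of h) x) q)))
    (fun _ ih _ h => isTyS fun x y => ih (x ≐ y) (isTy_paths h x y)) k A h
def isTy_up := @glb _ _ 20 @isTy_up.val

def conj_rfl.val {A : Ty} {x y : El A} (p : El (x ≐ y)) : El (cat (sym p) (cat rfl' p) ≐ rfl') :=
  J (fun _ p => cat (sym p) (cat rfl' p) ≐ rfl') triv p
def conj_rfl := @glb _ _ 21 @conj_rfl.val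

/-- On path types the retraction sends `q` to `h(x)⁻¹ · r(q) · h(y)`, by naturality of the homotopy
`h`, so the induction on the level goes through. -/
def isTy_retract.val {k : El Nt} {A B : TyAt 2} (s : El A → El B) (r : El B → El A)
    (h : (a : El A) → El (r (s a) ≐ a)) (hB : El (isTy k B)) : El (isTy k A) :=
  Nt.ind' (fun k => (A B : TyAt 2) → (s : El A → El B) → (r : El B → El A) →
      (h : (a : El A) → El (r (s a) ≐ a)) → El (isTy k B) → El (isTy k A))
    (fun _ _ s r h hB => isTyO (mk (r (fst (contr_of hB)))
      (Lam fun a => cat (ap r (snd (contr_of hB) ⦿ s a)) (h a))))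
    (fun _ ih _ _ s r h hB => isTyS fun x y => ih (x ≐ y) (s x ≐ s y) (fun p => ap s p)
      (fun q => cat (sym (h x)) (cat (ap r q) (h y)))
      (fun p => J (fun y p => cat (sym (h x)) (cat (ap r (ap s p)) (h y)) ≐ p)
        (conj_rfl (h x)).as p)
      (isTy_paths hB (s x) (s y)))
    k A B s r h hB
def isTy_retract := @glb _ _ 22 @isTy_retract.val

def pair_eq.val {A : Ty} {B : El A → Ty} {a a' : El A} (p : El (a ≐ a')) {b : El (B a)}
    {b' : El (B a')} (q : El (tr B p b ≐ b')) : El (mk (B := B) a b ≐ mk a' b') :=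
  J' (fun a' p => (b' : El (B a')) → El (tr B p b ≐ b') → El (mk (B := B) a b ≐ mk a' b'))
    (fun _ q => J (fun b' _ => mk (B := B) a b ≐ mk a b') rfl' (q.as : El (b ≐ _))) p b' q
def pair_eq := @glb _ _ 23 @pair_eq.val

/-- Paths from a given pair are described by a path of first components and a dependent path of
second components. Only one of the two composites of splitting and recombining is ever needed, since
truncation levels pass to retracts. -/
def pair_code.val {A : TyAt 2} {B : El A → TyAt 2} (a : El A) (b : El (B a)) (v : El (Sg A B)) :
    TyAt 2 :=
  (Sg.ind (fun _ => Un 2) (fun a' b' => (Sg (a ≐ a') fun q => tr B q b ≐ b').el 2) v).ty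
def pair_code := @glb _ _ 24 @pair_code.val

def pair_split.val {A : TyAt 2} {B : El A → TyAt 2} {a : El A} {b : El (B a)} {v : El (Sg A B)}
    (p : El (mk a b ≐ v)) : El (pair_code a b v) :=
  J (fun v _ => pair_code a b v) (mk rfl' triv : El (Sg (a ≐ a) fun q => tr B q b ≐ b)).as p
def pair_split := @glb _ _ 25 @pair_split.val

def pair_unsplit.val {A : TyAt 2} {B : El A → TyAt 2} {a : El A} {b : El (B a)} {v : El (Sg A B)}
    (w : El (pair_code a b v)) : El (mk a b ≐ v) :=
  Sg.ind (fun v => pair_code a b v ⇾ mk a b ≐ v)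
    (fun a' b' => Lam fun w => Sg.ind (fun _ => mk a b ≐ mk a' b') (fun p q => pair_eq p q)
      (w.as : El (Sg (a ≐ a') fun q => tr B q b ≐ b'))) v ⦿ w
def pair_unsplit := @glb _ _ 26 @pair_unsplit.val

def pair_unsplit_split.val {A : TyAt 2} {B : El A → TyAt 2} {a : El A} {b : El (B a)}
    {v : El (Sg A B)} (p : El (mk a b ≐ v)) : El (pair_unsplit (pair_split p) ≐ p) :=
  J (fun _ p => pair_unsplit (pair_split p) ≐ p) triv p
def pair_unsplit_split := @glb _ _ 27 @pair_unsplit_split.val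

def isTy_pair_paths.val {k : El Nt} {A : TyAt 2} {B : El A → TyAt 2} {a : El A} {b : El (B a)}
    {a' : El A} {b' : El (B a')} (h : El (isTy k (Sg (a ≐ a') fun q => tr B q b ≐ b'))) :
    El (isTy k (mk (B := B) a b ≐ mk a' b')) :=
  isTy_retract (fun p => pair_split p) (fun w => pair_unsplit w) (fun p => pair_unsplit_split p)
    (h.as : El (isTy k (pair_code a b (mk a' b'))))
def isTy_pair_paths := @glb _ _ 28 @isTy_pair_paths.val

def isTy_sg.val {k : El Nt} {A : TyAt 2} {B : El A → TyAt 2} (hA : El (isTy k A))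
    (hB : (a : El A) → El (isTy k (B a))) : El (isTy k (Sg A B)) :=
  Nt.ind' (fun k => (A : TyAt 2) → (B : El A → TyAt 2) → El (isTy k A) →
      ((a : El A) → El (isTy k (B a))) → El (isTy k (Sg A B)))
    (fun A B hA hB => isTyO (mk
      (mk (fst (contr_of hA)) (fst (contr_of (hB (fst (contr_of hA))))))
      (Lam fun u => Sg.ind (fun u => mk (B := B) (fst (contr_of hA))
          (fst (contr_of (hB (fst (contr_of hA))))) ≐ u)
        (fun a b => pair_eq (snd (contr_of hA) ⦿ a) (contr_path (contr_of (hB a)) _ b)) u)))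
    (fun k ih A B hA hB => isTyS fun u v => Sg.ind (fun u => isTy k (u ≐ v))
      (fun a b => Sg.ind (fun v => isTy k (mk a b ≐ v)) (fun a' b' => isTy_pair_paths
        (ih (a ≐ a') (fun q => tr B q b ≐ b') (isTy_paths hA a a')
          (fun q => isTy_paths (hB a') (tr B q b) b'))) v) u)
    k A B hA hB
def isTy_sg := @glb _ _ 29 @isTy_sg.val

def contrEntries : List Entry := [
    reducible (entry @fst.val), reducible (entry @snd.val), reducible (entry @contr_path.val),
    entry @contr_path_rfl.val, reducible (entry @isTy.val), entry @isTyO.val,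
    entry @contr_of.val, entry @isTyS.val, entry @isTy_paths.val, entry @isTy_up.val,
    entry @conj_rfl.val, entry @isTy_retract.val, reducible (entry @pair_eq.val),
    reducible (entry @pair_code.val), reducible (entry @pair_split.val),
    reducible (entry @pair_unsplit.val), entry @pair_unsplit_split.val,
    entry @isTy_pair_paths.val, entry @isTy_sg.val]

/-- The environment so far. -/
def contrEnv : List Entry := contrEntries.reverse ++ pathEnv

set_option maxRecDepth 100000 in
theorem contrEnv_ok : okAll contrEntries pathEnv = true := by decide +kernel

/-! ### Function extensionality -/

/-- Transport along an equality of types. -/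
def coe3.val {A B : TyAt 3} (p : El (Ty.el 3 A ≐ Ty.el 3 B)) : El (A ⇾ B) :=
  ⟨coe 3 (Ty.e A) (Ty.e B) p.e⟩
def coe3 := @glb _ _ 30 @coe3.val

/-- The equivalence given by an equality of types. -/
def idtoeqv3.val {A B : TyAt 3} (p : El (Ty.el 3 A ≐ Ty.el 3 B)) : El (Equ A B) :=
  ⟨idtoeqv 3 (Ty.e A) (Ty.e B) p.e⟩
def idtoeqv3 := @glb _ _ 31 @idtoeqv3.val

def univalence3.val : El (Fn (Un 3) fun A => Fn (Un 3) fun B =>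
    IsEqu (Lam fun p : El (A ≐ B) => idtoeqv3 (A := A.ty) (B := B.ty) p)) :=
  ⟨Exp.con .univalence⟩
def univalence3 := @glb _ _ 32 @univalence3.val

def univalence3_inverse.val {A B : TyAt 3} : El (Sg (Equ A B ⇾ Ty.el 3 A ≐ Ty.el 3 B) fun s =>
    Fn (Equ A B) fun w => idtoeqv3 (s ⦿ w) ≐ w) :=
  (snd (⟨univalence3.e ⬝ Ty.e A ⬝ Ty.e B⟩ :
    El (IsEqu (Lam fun p : El (Ty.el 3 A ≐ Ty.el 3 B) => idtoeqv3 p)))).as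
def univalence3_inverse := @glb _ _ 33 @univalence3_inverse.val

def ua3.val {A B : TyAt 3} (f : El (A ⇾ B)) (g : El (B ⇾ A)) (h : (a : El A) → El (g ⦿ (f ⦿ a) ≐ a))
    (k : (b : El B) → El (f ⦿ (g ⦿ b) ≐ b)) :
    El (Sg (Ty.el 3 A ≐ Ty.el 3 B) fun p => coe3 p ≐ f) :=
  Sg.ind (fun _ => Sg (Ty.el 3 A ≐ Ty.el 3 B) fun p => coe3 p ≐ f)
    (fun (s : El (Equ A B ⇾ Ty.el 3 A ≐ Ty.el 3 B)) (q : El (Fn (Equ A B) fun w => idtoeqv3 (s ⦿ w) ≐ w)) =>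
      mk (s ⦿ mk f (mk (mk g (Lam h)) (mk g (Lam k))))
        (ap (fun w => fst w) (q ⦿ mk f (mk (mk g (Lam h)) (mk g (Lam k))))).as)
    univalence3_inverse
def ua3 := @glb _ _ 34 @ua3.val

/-- Composition with an equivalence is injective. -/
def coe3_injective.val {A B C : TyAt 3} (p : El (Ty.el 3 B ≐ Ty.el 3 C)) {u v : El (A ⇾ B)}
    (h : El ((Lam fun a => coe3 p ⦿ (u ⦿ a)) ≐ Lam fun a => coe3 p ⦿ (v ⦿ a))) : El (u ≐ v) :=
  J (fun C p => ((Lam fun a => coe3 (B := C.ty) p ⦿ (u ⦿ a)) ≐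
      Lam fun a => coe3 (B := C.ty) p ⦿ (v ⦿ a)) ⇾ u ≐ v)
    -- Along reflexivity `coe3` is the identity, and by η the hypothesis is the claim itself.
    (Lam fun h => h.as) p ⦿ h
def coe3_injective := @glb _ _ 35 @coe3_injective.val

def equiv_injective.val {A B C : TyAt 3} {f : El (B ⇾ C)} (w : El (Sg (Ty.el 3 B ≐ Ty.el 3 C) fun p => coe3 p ≐ f))
    {u v : El (A ⇾ B)} (h : El ((Lam fun a => f ⦿ (u ⦿ a)) ≐ Lam fun a => f ⦿ (v ⦿ a))) : El (u ≐ v) :=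
  coe3_injective (fst w) (cat (ap (fun k => Lam fun a => k ⦿ (u ⦿ a)) (snd w))
    (cat h (sym (ap (fun k => Lam fun a => k ⦿ (v ⦿ a)) (snd w)))))
def equiv_injective := @glb _ _ 36 @equiv_injective.val

/-- Pairs of equal elements. -/
abbrev Pairs (B : Ty) : Ty := Sg B fun x => Sg B fun y => x ≐ y

def pairs_fst.val {B : TyAt 3} : El (Sg (Ty.el 3 (Pairs B) ≐ Ty.el 3 B) fun p =>
    coe3 p ≐ Lam fun z : El (Pairs B) => fst z) :=
  ua3 (Lam fun z : El (Pairs B) => fst z) (Lam fun b => (mk b (mk b rfl') : El (Pairs B)))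
    (fun z => (Sg.ind (fun z => (mk (fst z) (mk (fst z) rfl') : El (Pairs B)) ≐ z)
      (fun x w => (Sg.ind (fun w => (mk x (mk x rfl') : El (Pairs B)) ≐ mk x w)
        (fun y p => J (fun y p => (mk x (mk x rfl') : El (Pairs B)) ≐ mk x (mk y p)) rfl' p) w).as)
      z).as)
    (fun b => triv)
def pairs_fst := @glb _ _ 37 @pairs_fst.val

/-- Voevodsky's argument: `a ↦ (f a, f a, refl)` and `a ↦ (f a, g a, h a)` have the same composite
with the first projection from pairs of equal elements. That projection is an equivalence, so
composition with it is injective and the two maps are equal; their second components are `f` and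
`g`. -/
def funext_const.val {A B : TyAt 3} {f g : El (A ⇾ B)} (h : (a : El A) → El (f ⦿ a ≐ g ⦿ a)) : El (f ≐ g) :=
  (ap (fun k => Lam fun a => fst (snd (k ⦿ a)))
    (equiv_injective (pairs_fst (B := B))
      (u := Lam fun a => mk (f ⦿ a) (mk (f ⦿ a) rfl')) (v := Lam fun a => mk (f ⦿ a) (mk (g ⦿ a) (h a)))
      -- Both composites with the first projection compute to `f`.
      triv)).as
def funext_const := @glb _ _ 38 @funext_const.val

def funextEntries : List Entry := [
    reducible (entry @coe3.val), reducible (entry @idtoeqv3.val), entry @univalence3.val,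
    entry @univalence3_inverse.val, entry @ua3.val, entry @coe3_injective.val,
    entry @equiv_injective.val, entry @pairs_fst.val, entry @funext_const.val]

/-- The environment so far. -/
def funextEnv : List Entry := funextEntries.reverse ++ contrEnv

set_option maxRecDepth 100000 in
theorem funextEnv_ok : okAll funextEntries contrEnv = true := by decide +kernel

/-! ### Function extensionality for dependent functions. -/

def idtoeqv2.val {A B : TyAt 2} (p : El (Ty.el 2 A ≐ Ty.el 2 B)) : El (Equ A B) :=
  ⟨idtoeqv 2 (Ty.e A) (Ty.e B) p.e⟩
def idtoeqv2 := @glb _ _ 39 @idtoeqv2.val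

def univalence2.val : El (Fn (Un 2) fun A => Fn (Un 2) fun B =>
    IsEqu (Lam fun p : El (A ≐ B) => idtoeqv2 (A := A.ty) (B := B.ty) p)) :=
  ⟨Exp.con .univalence⟩
def univalence2 := @glb _ _ 40 @univalence2.val

def univalence2_inverse.val {A B : TyAt 2} (w : El (Equ A B)) : El (Ty.el 2 A ≐ Ty.el 2 B) :=
  fst (fst (⟨univalence2.e ⬝ Ty.e A ⬝ Ty.e B⟩ :
    El (IsEqu (Lam fun p : El (Ty.el 2 A ≐ Ty.el 2 B) => idtoeqv2 p)))) ⦿ w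
def univalence2_inverse := @glb _ _ 41 @univalence2_inverse.val

def unit_eq.val {A : TyAt 2} (c : El (Contr A)) : El (Ty.el 2 One ≐ Ty.el 2 A) :=
  univalence2_inverse (mk (Lam fun _ => fst c)
    (mk (mk (Lam fun _ => one) (Lam fun u => (One.ind (fun u => one ≐ u) rfl' u).as))
      (mk (Lam fun _ => one) (Lam fun a => (snd c ⦿ a).as))))
def unit_eq := @glb _ _ 42 @unit_eq.val

def contr_const.val {A : TyAt 2} : El (Contr (A ⇾ One)) :=
  mk (Lam fun _ => one) (Lam fun f => funext_const fun a => (One.ind (fun u => one ≐ u) rfl' (f ⦿ a)).as)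
def contr_const := @glb _ _ 43 @contr_const.val

/-- By univalence each `P a` equals the unit type, so by extensionality for maps into the universe
the family `P` equals the constant one, for which the claim is `contr_const`. The maps in question
take values in a universe, and for this reason `funext_const` is established one level higher. -/
def weak_funext.val {A : TyAt 2} {P : El A → TyAt 2} (h : (a : El A) → El (Contr (P a))) :
    El (Contr (Fn A P)) :=
  (J (a := (Lam fun _ => Ty.el 2 One : El (A ⇾ Un 2))) (fun Q _ => Contr (Fn A fun a => (Q ⦿ a).ty))
    (contr_const (A := A)).as (b := Lam fun a => Ty.el 2 (P a)) (funext_const fun a => (unit_eq (h a)).as)).as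
def weak_funext := @glb _ _ 44 @weak_funext.val

def contr_from.val {A : TyAt 2} (a : El A) : El (Contr (Sg A fun x => a ≐ x)) :=
  mk (mk a rfl') (Lam fun w => Sg.ind (fun w => mk a rfl' ≐ w)
    (fun x p => J (fun x p => (mk a rfl' : El (Sg A fun x => a ≐ x)) ≐ mk x p) rfl' p) w)
def contr_from := @glb _ _ 45 @contr_from.val

/-- The type of functions choosing for each `a` some `y` with `f a = y` is contractible by
`weak_funext`. It contains `(f, refl)` and `(g, h)`, which are therefore equal, and projection gives
the path. -/
def funext.val {A : TyAt 2} {P : El A → TyAt 2} {f g : El (Fn A P)}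
    (h : (a : El A) → El (f ⦿ a ≐ g ⦿ a)) : El (f ≐ g) :=
  (ap (fun k : El (Fn A fun a => Sg (P a) fun y => f ⦿ a ≐ y) => (Lam fun a => fst (k ⦿ a) : El (Fn A P)))
    (contr_path (weak_funext fun a => contr_from (f ⦿ a)) (Lam fun a => mk (f ⦿ a) rfl')
      (Lam fun a => mk (g ⦿ a) (h a)))).as
def funext := @glb _ _ 46 @funext.val

def funext_rfl.val {A : TyAt 2} {P : El A → TyAt 2} (f : El (Fn A P)) :
    El (funext (f := f) (g := f) (fun _ => rfl') ≐ rfl') :=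
  (ap (fun q => ap (fun k : El (Fn A fun a => Sg (P a) fun y => f ⦿ a ≐ y) =>
      (Lam fun a => fst (k ⦿ a) : El (Fn A P))) q)
    (contr_path_rfl (weak_funext fun a => contr_from (f ⦿ a)) (Lam fun a => mk (f ⦿ a) rfl'))).as
def funext_rfl := @glb _ _ 47 @funext_rfl.val

/-- A path between functions is a retract of a pointwise path, by way of `funext`; only its value at
reflexivity, `funext_rfl`, enters. -/
def isTy_fn.val {k : El Nt} {A : TyAt 2} {P : El A → TyAt 2} (h : (a : El A) → El (isTy k (P a))) :
    El (isTy k (Fn A P)) :=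
  Nt.ind' (fun k => (P : El A → TyAt 2) → ((a : El A) → El (isTy k (P a))) → El (isTy k (Fn A P)))
    (fun P h => isTyO (weak_funext fun a => contr_of (h a)))
    (fun k ih P h => isTyS fun f g => isTy_retract (B := Fn A fun a => f ⦿ a ≐ g ⦿ a)
      (fun p => Lam fun a => ap (fun f => f ⦿ a) p) (fun q => funext fun a => q ⦿ a)
      (fun p => (J (fun g p => funext (f := f) (g := g) (fun a => ap (fun f => f ⦿ a) p) ≐ p)
        (funext_rfl f).as p).as)
      (ih (fun a => f ⦿ a ≐ g ⦿ a) fun a => isTy_paths (h a) (f ⦿ a) (g ⦿ a)))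
    k P h
def isTy_fn := @glb _ _ 48 @isTy_fn.val

def prop_of.val {A : TyAt 2} (h : El A → El (Contr A)) : El (isTy (S O) A) :=
  isTyS fun x y => isTy_paths (isTy_up (isTyO (h x))) x y
def prop_of := @glb _ _ 49 @prop_of.val

def prop_up.val {k : El Nt} {A : TyAt 2} (h : El (isTy (S O) A)) : El (isTy (S k) A) :=
  Nt.ind (fun k => isTy (S k) A) h (fun _ h => isTy_up h) k
def prop_up := @glb _ _ 50 @prop_up.val

def prop_path.val {A : TyAt 2} (h : El (isTy (S O) A)) (x y : El A) : El (x ≐ y) :=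
  fst (contr_of (isTy_paths h x y))
def prop_path := @glb _ _ 51 @prop_path.val

/-- For a proof of being a proposition an element `c` may be assumed. Then `A` is contractible,
hence so are its path types and everything built from them by sums and products. -/
def isProp_contr.val {A : TyAt 2} : El (isTy (S O) (Contr A)) :=
  prop_of fun c => contr_of (isTy_sg (isTyO c) fun a =>
    isTy_fn fun x => isTy_paths (isTy_up (isTyO c)) a x)
def isProp_contr := @glb _ _ 52 @isProp_contr.val

def isProp_isTy.val {k : El Nt} {A : TyAt 2} : El (isTy (S O) (isTy k A)) :=
  Nt.ind' (fun k => (A : TyAt 2) → El (isTy (S O) (isTy k A)))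
    (fun A => (isProp_contr (A := A)).as)
    (fun k ih A => (isTy_fn fun x => isTy_fn fun y => ih (x ≐ y) :
      El (isTy (S O) (Fn A fun x => Fn A fun y => isTy k (x ≐ y)))).as) k A
def isProp_isTy := @glb _ _ 53 @isProp_isTy.val

def weakFunextEntries : List Entry := [
    reducible (entry @idtoeqv2.val), entry @univalence2.val, entry @univalence2_inverse.val,
    entry @unit_eq.val, entry @contr_const.val, entry @weak_funext.val, entry @contr_from.val,
    reducible (entry @funext.val), entry @funext_rfl.val, entry @isTy_fn.val, entry @prop_of.val,
    entry @prop_up.val, entry @prop_path.val, entry @isProp_contr.val, entry @isProp_isTy.val]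

/-- The environment so far. -/
def weakFunextEnv : List Entry := weakFunextEntries.reverse ++ funextEnv

set_option maxRecDepth 100000 in
theorem weakFunextEnv_ok : okAll weakFunextEntries funextEnv = true := by decide +kernel

/-! ### Equalities of types -/

def coe1.val {A B : TyAt 1} (p : El (Ty.el 1 A ≐ Ty.el 1 B)) : El (A ⇾ B) :=
  ⟨coe 1 (Ty.e A) (Ty.e B) p.e⟩
def coe1 := @glb _ _ 54 @coe1.val

def idtoeqv1.val {A B : TyAt 1} (p : El (Ty.el 1 A ≐ Ty.el 1 B)) : El (Equ A B) :=
  ⟨idtoeqv 1 (Ty.e A) (Ty.e B) p.e⟩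
def idtoeqv1 := @glb _ _ 55 @idtoeqv1.val

def univalence1.val : El (Fn (Un 1) fun A => Fn (Un 1) fun B =>
    IsEqu (Lam fun p : El (A ≐ B) => idtoeqv1 (A := A.ty) (B := B.ty) p)) :=
  ⟨Exp.con .univalence⟩
def univalence1 := @glb _ _ 56 @univalence1.val

def univalence1_left.val {A B : TyAt 1} : El (Sg (Equ A B ⇾ Ty.el 1 A ≐ Ty.el 1 B) fun s =>
    Fn (Ty.el 1 A ≐ Ty.el 1 B) fun p => s ⦿ idtoeqv1 p ≐ p) :=
  (fst (⟨univalence1.e ⬝ Ty.e A ⬝ Ty.e B⟩ :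
    El (IsEqu (Lam fun p : El (Ty.el 1 A ≐ Ty.el 1 B) => idtoeqv1 p)))).as
def univalence1_left := @glb _ _ 57 @univalence1_left.val

def univalence1_right.val {A B : TyAt 1} : El (Sg (Equ A B ⇾ Ty.el 1 A ≐ Ty.el 1 B) fun s =>
    Fn (Equ A B) fun w => idtoeqv1 (s ⦿ w) ≐ w) :=
  (snd (⟨univalence1.e ⬝ Ty.e A ⬝ Ty.e B⟩ :
    El (IsEqu (Lam fun p : El (Ty.el 1 A ≐ Ty.el 1 B) => idtoeqv1 p)))).as
def univalence1_right := @glb _ _ 58 @univalence1_right.val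

def ua1.val {A B : TyAt 1} (w : El (Equ A B)) :
    El (Sg (Ty.el 1 A ≐ Ty.el 1 B) fun p => coe1 p ≐ fst w) :=
  Sg.ind (fun _ => Sg (Ty.el 1 A ≐ Ty.el 1 B) fun p => coe1 p ≐ fst w)
    (fun (s : El (Equ A B ⇾ Ty.el 1 A ≐ Ty.el 1 B)) (q : El (Fn (Equ A B) fun w => idtoeqv1 (s ⦿ w) ≐ w)) =>
      mk (s ⦿ w) (ap (fun w => fst w) (q ⦿ w)).as)
    univalence1_right
def ua1 := @glb _ _ 59 @ua1.val

def isTy_equ.val {k : El Nt} {A B : TyAt 2} (hA : El (isTy k A)) (hB : El (isTy k B)) :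
    El (isTy k (Equ A B)) :=
  isTy_sg (isTy_fn fun _ => hB) fun f => isTy_sg
    (isTy_sg (isTy_fn fun _ => hA) fun g => isTy_fn fun a => isTy_paths (isTy_up hA) (g ⦿ (f ⦿ a)) a)
    fun _ => isTy_sg (isTy_fn fun _ => hA) fun g =>
      isTy_fn fun b => isTy_paths (isTy_up hB) (f ⦿ (g ⦿ b)) b
def isTy_equ := @glb _ _ 60 @isTy_equ.val

/-- The left inverse supplied by univalence exhibits an equality of types as a retract of the type
of equivalences. -/
def isTy_type_eq.val {k : El Nt} {A B : El (Un 1)} (hA : El (isTy k A.ty)) (hB : El (isTy k B.ty)) :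
    El (isTy k (A ≐ B)) :=
  isTy_retract (B := Equ A.ty B.ty) (fun p => idtoeqv1 (A := A.ty) (B := B.ty) p)
    (fun w => fst (univalence1_left (A := A.ty) (B := B.ty)) ⦿ w)
    (fun p => snd (univalence1_left (A := A.ty) (B := B.ty)) ⦿ p) (isTy_equ hA hB)
def isTy_type_eq := @glb _ _ 61 @isTy_type_eq.val

/-- The `(k - 2)`-types. -/
def Types.val (k : El Nt) : TyAt 2 := Sg (Un 1) fun X => isTy k X.ty
def Types := @glb _ _ 62 @Types.val

/-- An equality of two elements consists of an equality of types, bounded by `isTy_type_eq`, and a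
path in a proposition, which is harmless at every level. -/
def isTy_types.val {k : El Nt} : El (isTy (S k) (Types k)) :=
  (isTyS fun u v => Sg.ind (fun u => isTy k (u ≐ v))
    (fun X a => Sg.ind (fun v => isTy k (mk (B := fun X : El (Un 1) => isTy k X.ty) X a ≐ v))
      (fun Y b => isTy_pair_paths (isTy_sg (isTy_type_eq a b) fun q =>
        isTy_paths (prop_up isProp_isTy) (tr (fun X : El (Un 1) => isTy k X.ty) q a) b)) v) u :
    El (isTy (S k) (Sg (Un 1) fun X => isTy k X.ty))).as
def isTy_types := @glb _ _ 63 @isTy_types.val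

def typeEqEntries : List Entry := [
    reducible (entry @coe1.val), reducible (entry @idtoeqv1.val), entry @univalence1.val,
    entry @univalence1_left.val, entry @univalence1_right.val, entry @ua1.val,
    entry @isTy_equ.val, entry @isTy_type_eq.val, reducible (entry @Types.val),
    entry @isTy_types.val]

/-- The environment so far. -/
def typeEqEnv : List Entry := typeEqEntries.reverse ++ weakFunextEnv

set_option maxRecDepth 100000 in
theorem typeEqEnv_ok : okAll typeEqEntries weakFunextEnv = true := by decide +kernel

/-! ### Suspensions and spheres -/

def Sus.val (A : TyAt 1) : TyAt 1 := ⟨Susp (Ty.e A)⟩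
def Sus := @glb _ _ 64 @Sus.val

def north.val {A : TyAt 1} : El (Sus A) := ⟨HoTT.north (Ty.e A)⟩
def north := @glb _ _ 65 @north.val

def south.val {A : TyAt 1} : El (Sus A) := ⟨HoTT.south (Ty.e A)⟩
def south := @glb _ _ 66 @south.val

def merid.val {A : TyAt 1} (a : El A) : El (north (A := A) ≐ south) := ⟨HoTT.merid (Ty.e A) a.e⟩
def merid := @glb _ _ 67 @merid.val

/-- The arguments of the induction on the pushout. -/
def Sus.args {A : Ty} (P : El (Sus A) → Ty) (n : El (P north)) (s : El (P south))
    (m : (a : El A) → El (tr P (merid a) n ≐ s)) : List Exp :=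
  [UnitT, UnitT, A.e, toUnit A.e, toUnit A.e, Exp.lam (Sus A).e fun x => (P ⟨x⟩).e,
    (Lam fun u : El One => One.ind (fun u => P ⟨HoTT.pushInl UnitT UnitT A.e (toUnit A.e) (toUnit A.e) u.e⟩) n.as u).e,
    (Lam fun u : El One => One.ind (fun u => P ⟨HoTT.pushInr UnitT UnitT A.e (toUnit A.e) (toUnit A.e) u.e⟩) s.as u).e,
    (Lam m).e]

def Sus.ind.val {A : TyAt 1} (P : El (Sus A) → TyAt 2) (n : El (P north)) (s : El (P south))
    (m : (a : El A) → El (tr P (merid a) n ≐ s)) (x : El (Sus A)) : El (P x) :=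
  ⟨Exp.con .pushInd (Sus.args P n s m ++ [x.e])⟩
def Sus.ind := @glb _ _ 68 @Sus.ind.val

def Sus.ind_merid.val {A : TyAt 1} (P : El (Sus A) → TyAt 2) (n : El (P north)) (s : El (P south))
    (m : (a : El A) → El (tr P (merid a) n ≐ s)) (a : El A) :
    El (dap (fun x => Sus.ind P n s m x) (merid a) ≐ (m a).as) :=
  ⟨Exp.con .pushIndGlue (Sus.args P n s m ++ [a.e])⟩
def Sus.ind_merid := @glb _ _ 69 @Sus.ind_merid.val

def Sus.rec.val {A : TyAt 1} {B : TyAt 2} (n s : El B) (m : El A → El (n ≐ s)) (x : El (Sus A)) :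
    El B :=
  Sus.ind (fun _ => B) n s (fun a => cat (tr_const (merid a) n) (m a)) x
def Sus.rec := @glb _ _ 70 @Sus.rec.val

def cat_cancel.val {A : Ty} {x y z : El A} (p : El (x ≐ y)) {q r : El (y ≐ z)}
    (h : El (cat p q ≐ cat p r)) : El (q ≐ r) :=
  J' (fun y p => (q r : El (y ≐ z)) → El (cat p q ≐ cat p r) → El (q ≐ r))
    (fun q r h => cat (sym (rfl_cat q)) (cat h (rfl_cat r))) p q r h
def cat_cancel := @glb _ _ 71 @cat_cancel.val

/-- The recursor is the induction principle for a constant family. Its rule on meridians therefore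
holds up to the path `tr_const`, which is cancelled. -/
def Sus.rec_merid.val {A : TyAt 1} {B : TyAt 2} (n s : El B) (m : El A → El (n ≐ s)) (a : El A) :
    El (ap (fun x => Sus.rec n s m x) (merid a) ≐ (m a).as) :=
  cat_cancel (tr_const (merid a) (Sus.rec n s m north)) (q := ap (fun x => Sus.rec n s m x) (merid a))
    (r := (m a).as)
    (cat (sym (dap_const (fun x => Sus.rec n s m x) (merid a)))
      (Sus.ind_merid (fun _ => B) n s (fun a => cat (tr_const (merid a) n) (m a)) a).as)
def Sus.rec_merid := @glb _ _ 72 @Sus.rec_merid.val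

def tr_path.val {A B : Ty} (f : El A → El B) {x y : El A} (p : El (x ≐ y)) {b : El B}
    (r : El (f y ≐ b)) : El (tr (fun z => f z ≐ b) p (cat (ap f p) r) ≐ r) :=
  J' (fun y p => (r : El (f y ≐ b)) → El (tr (fun z => f z ≐ b) p (cat (ap f p) r) ≐ r))
    (fun r => (rfl_cat r).as) p r
def tr_path := @glb _ _ 73 @tr_path.val

def ap_null.val {A B : Ty} (f : El A → El B) {b : El B} (h : (x : El A) → El (f x ≐ b)) {x y : El A}
    (p : El (x ≐ y)) : El (ap f p ≐ cat (h x) (sym (h y))) :=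
  J (fun y p => ap f p ≐ cat (h x) (sym (h y))) (sym (cat_sym (h x))).as p
def ap_null := @glb _ _ 74 @ap_null.val

def Sph.val (m : El Nt) : TyAt 0 := ⟨Sphere m.e⟩
def Sph := @glb _ _ 75 @Sph.val

/-- The two points of the sphere of dimension zero. -/
def Sph.left.val : El (Sph O) := (inl' one : El (Sm One One)).as
def Sph.left := @glb _ _ 76 @Sph.left.val

def Sph.right.val : El (Sph O) := (inr' one : El (Sm One One)).as
def Sph.right := @glb _ _ 77 @Sph.right.val

def Sph.rec.val {X : TyAt 2} (x y : El X) (z : El (Sph O)) : El X :=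
  Sm.ind (fun _ => X) (fun _ => x) (fun _ => y) (z.as : El (Sm One One))
def Sph.rec := @glb _ _ 78 @Sph.rec.val

/-- Every map from the sphere to `X` is null. -/
def Null.val (m : El Nt) (X : TyAt 2) : TyAt 2 :=
  Fn (Sph m ⇾ X) fun r => Sg X fun c => Fn (Sph m) fun x => r ⦿ x ≐ c
def Null := @glb _ _ 79 @Null.val

def Null.intro.val {m : El Nt} {X : TyAt 2}
    (h : (r : El (Sph m) → El X) → El (Sg X fun c => Fn (Sph m) fun x => r x ≐ c)) :
    El (Null m X) :=
  (Lam fun r => h fun x => r ⦿ x).as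
def Null.intro := @glb _ _ 80 @Null.intro.val

def Null.elim.val {m : El Nt} {X : TyAt 2} (h : El (Null m X)) (r : El (Sph m) → El X) :
    El (Sg X fun c => Fn (Sph m) fun x => r x ≐ c) :=
  ((h.as : El (Fn (Sph m ⇾ X) fun r => Sg X fun c => Fn (Sph m) fun x => r ⦿ x ≐ c)) ⦿ Lam r).as
def Null.elim := @glb _ _ 81 @Null.elim.val

/-- If all paths `ap r (merid a)` are equal to one path `c`, then `r` contracts to the image of the
south pole: along `c` at north, trivially at south, and compatibly on meridians. -/
def null_susp.val {A : TyAt 1} {X : TyAt 2} (r : El (Sus A) → El X)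
    (w : El (Sg (r north ≐ r south) fun c => Fn A fun a => ap r (merid a) ≐ c)) :
    El (Sg X fun c => Fn (Sus A) fun x => r x ≐ c) :=
  mk (r south) (Lam fun x => Sus.ind (fun x => r x ≐ r south) (fst w) rfl'
    (fun a => cat (ap (fun q => tr (fun x => r x ≐ r south) (merid a) q)
        (cat (sym (snd w ⦿ a)) (sym (cat_rfl (ap r (merid a))))))
      (tr_path r (merid a) rfl')) x)
def null_susp := @glb _ _ 82 @null_susp.val

/-- Induction on the dimension by `null_susp`: a map from a suspension is null once the induced map
into a path type, one truncation level lower, is null. A map from the 0-sphere into a proposition is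
null. -/
def isTy_null.val {m : El Nt} {X : TyAt 2} (h : El (isTy (S m) X)) : El (Null m X) :=
  Nt.ind' (fun m => (X : TyAt 2) → El (isTy (S m) X) → El (Null m X))
    (fun X h => Null.intro fun r => mk (r Sph.right)
      (Lam fun x => prop_path h (r x) (r Sph.right)))
    (fun m ih X h => Null.intro fun r => (null_susp (A := Sph m) (fun x => r x.as)
      (Null.elim (ih (r north.as ≐ r south.as) (isTy_paths h (r north.as) (r south.as)))
        fun a => ap (fun x => r x.as) (merid a))).as)
    m X h
def isTy_null := @glb _ _ 83 @isTy_null.val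

/-- A map `A → (x = y)` is the action on meridians of a map from the suspension. If the latter is
null, its action on any path between the poles is the composite of the two contracting paths there,
whatever the meridian. -/
def null_path.val {A : TyAt 1} {X : TyAt 2} {x y : El X} (r : El A → El (x ≐ y))
    (w : El (Sg X fun c => Fn (Sus A) fun z => Sus.rec x y r z ≐ c)) :
    El (Sg (x ≐ y) fun c => Fn A fun a => r a ≐ c) :=
  (mk (A := Sus.rec x y r north ≐ Sus.rec x y r south) (B := fun c => Fn A fun a => (r a).as ≐ c)
    (cat (snd w ⦿ north) (sym (snd w ⦿ south)))
    (Lam fun a => cat (sym (Sus.rec_merid x y r a))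
      (ap_null (fun z => Sus.rec x y r z) (fun z => snd w ⦿ z) (merid a)))).as
def null_path := @glb _ _ 84 @null_path.val

/-- Nullity of maps from a sphere passes to path types by `null_path`, with the dimension lowered by
one. In dimension zero, contracting the map with values `x` and `y` yields a path between them. -/
def null_isTy.val {m : El Nt} {X : TyAt 2} (h : El (Null m X)) : El (isTy (S m) X) :=
  Nt.ind' (fun m => (X : TyAt 2) → El (Null m X) → El (isTy (S m) X))
    (fun X h => prop_of fun x => mk x (Lam fun y =>
      Sg.ind (B := fun c => Fn (Sph O) fun z => Sph.rec x y z ≐ c) (fun _ => x ≐ y)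
        (fun c k => (cat (k ⦿ Sph.left) (sym (k ⦿ Sph.right))).as)
        (Null.elim h fun z => Sph.rec x y z)))
    (fun m ih X h => isTyS fun x y => ih (x ≐ y) (Null.intro fun r =>
      null_path (A := Sph m) r (Null.elim h fun z => Sus.rec (A := Sph m) x y r z.as).as))
    m X h
def null_isTy := @glb _ _ 85 @null_isTy.val

def suspEntries : List Entry := [
    reducible (entry @Sus.val), reducible (entry @north.val), reducible (entry @south.val),
    reducible (entry @merid.val), reducible (entry @Sus.ind.val), entry @Sus.ind_merid.val,
    reducible (entry @Sus.rec.val), entry @cat_cancel.val, entry @Sus.rec_merid.val,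
    entry @tr_path.val, entry @ap_null.val, reducible (entry @Sph.val),
    reducible (entry @Sph.left.val), reducible (entry @Sph.right.val),
    reducible (entry @Sph.rec.val), reducible (entry @Null.val), entry @Null.intro.val,
    entry @Null.elim.val, entry @null_susp.val, entry @isTy_null.val, entry @null_path.val,
    entry @null_isTy.val]

/-- The environment so far. -/
def suspEnv : List Entry := suspEntries.reverse ++ typeEqEnv

set_option maxRecDepth 100000 in
theorem suspEnv_ok : okAll suspEntries typeEqEnv = true := by decide +kernel

/-! ### Truncations -/

def HT.val (m : El Nt) (A : TyAt 1) : TyAt 1 := ⟨HubTrunc m.e (Ty.e A)⟩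
def HT := @glb _ _ 86 @HT.val

def tin.val {m : El Nt} {A : TyAt 1} (a : El A) : El (HT m A) := ⟨truncIn m.e (Ty.e A) a.e⟩
def tin := @glb _ _ 87 @tin.val

def hub.val {m : El Nt} {A : TyAt 1} (r : El (Sph m ⇾ HT m A)) : El (HT m A) :=
  ⟨HoTT.hub m.e (Ty.e A) r.e⟩
def hub := @glb _ _ 88 @hub.val

def spoke.val {m : El Nt} {A : TyAt 1} (r : El (Sph m ⇾ HT m A)) (x : El (Sph m)) :
    El (r ⦿ x ≐ hub r) :=
  ⟨HoTT.spoke m.e (Ty.e A) r.e x.e⟩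
def spoke := @glb _ _ 89 @spoke.val

/-- The hub and the spokes say precisely that every map from the sphere is null. -/
def isTy_HT.val {m : El Nt} {A : TyAt 1} : El (isTy (S m) (HT m A)) :=
  null_isTy (Null.intro fun r => mk (hub (Lam r)) (Lam fun x => (spoke (Lam r) x).as))
def isTy_HT := @glb _ _ 90 @isTy_HT.val

/-- The data over a hub come for free in a truncated family: transporting the given values along the
spokes puts them into one fibre, where the resulting map from the sphere is null. -/
def HT.center.val {m : El Nt} {A : TyAt 1} {P : El (HT m A) → TyAt 2}
    (w : (z : El (HT m A)) → El (isTy (S m) (P z))) (r : El (Sph m ⇾ HT m A))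
    (r' : El (Fn (Sph m) fun x => P (r ⦿ x))) :
    El (Sg (P (hub r)) fun c => Fn (Sph m) fun x => tr P (spoke r x) (r' ⦿ x) ≐ c) :=
  Null.elim (isTy_null (w (hub r))) fun x => tr P (spoke r x) (r' ⦿ x)
def HT.center := @glb _ _ 91 @HT.center.val

def HT.ind.val {m : El Nt} {A : TyAt 1} (P : El (HT m A) → TyAt 2)
    (w : (z : El (HT m A)) → El (isTy (S m) (P z))) (t : (a : El A) → El (P (tin a)))
    (z : El (HT m A)) : El (P z) :=
  ⟨Exp.con .truncInd [m.e, Ty.e A, Exp.lam (Ty.e (HT m A)) fun z => Ty.e (P ⟨z⟩), (Lam t).e,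
    (Lam fun r : El (Sph m ⇾ HT m A) => Lam fun r' : El (Fn (Sph m) fun x => P (r ⦿ x)) =>
      fst (HT.center w r r')).e,
    (Lam fun r : El (Sph m ⇾ HT m A) => Lam fun r' : El (Fn (Sph m) fun x => P (r ⦿ x)) =>
      Lam fun x : El (Sph m) => snd (HT.center w r r') ⦿ x).e, z.e]⟩
def HT.ind := @glb _ _ 92 @HT.ind.val

def HT.ind_tin.val {m : El Nt} {A : TyAt 1} (P : El (HT m A) → TyAt 2)
    (w : (z : El (HT m A)) → El (isTy (S m) (P z))) (t : (a : El A) → El (P (tin a)))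
    (a : El A) : El (HT.ind P w t (tin a) ≐ t a) :=
  triv
def HT.ind_tin := @glb _ _ 93 @HT.ind_tin.val

def Tr.val (k : El Nt) (A : TyAt 1) : TyAt 1 := ⟨Trunc 1 k.e (Ty.e A)⟩
def Tr := @glb _ _ 94 @Tr.val

def tr_in.val {k : El Nt} {A : TyAt 1} (a : El A) : El (Tr k A) :=
  Nt.ind (fun k => A ⇾ Tr k A) (Lam fun _ => (one).as) (fun m _ => Lam fun a => (tin (m := m) a).as) k ⦿ a
def tr_in := @glb _ _ 95 @tr_in.val

def isTy_Tr.val {k : El Nt} {A : TyAt 1} : El (isTy k (Tr k A)) :=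
  Nt.ind (fun k => isTy k (Tr k A))
    (isTyO (mk one.as (Lam fun u => (One.ind (fun u => (one.as : El (Tr O A)) ≐ u.as) rfl' u.as).as)))
    (fun m _ => (isTy_HT (m := m) (A := A)).as) k
def isTy_Tr := @glb _ _ 96 @isTy_Tr.val

/-- Since `Tr` is defined by recursion on the level, the induction principle requires a case
distinction. The function and its computation rule are constructed together so that this is done
only once. -/
def Tr.ind_exists.val {k : El Nt} {A : TyAt 1} (P : El (Tr k A) → TyAt 2)
    (w : (z : El (Tr k A)) → El (isTy k (P z))) (t : (a : El A) → El (P (tr_in a))) :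
    El (Sg (Fn (Tr k A) P) fun f => Fn A fun a => f ⦿ tr_in a ≐ t a) :=
  Nt.ind' (fun k => (P : El (Tr k A) → TyAt 2) → ((z : El (Tr k A)) → El (isTy k (P z))) →
      (t : (a : El A) → El (P (tr_in a))) →
      El (Sg (Fn (Tr k A) P) fun f => Fn A fun a => f ⦿ tr_in a ≐ t a))
    (fun P w t => mk (Lam fun z => fst (contr_of (w z)))
      (Lam fun a =>
        (contr_path (contr_of (w (tr_in a))) (fst (contr_of (w (tr_in a)))) (t a)).as))
    (fun m _ P w t => mk (Lam fun z => HT.ind (m := m) (fun z => P z.as) (fun z => w z.as)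
        (fun a => (t a).as) z.as)
      (Lam fun a => (HT.ind_tin (m := m) (fun z => P z.as) (fun z => w z.as) (fun a => (t a).as) a).as))
    k P w t
def Tr.ind_exists := @glb _ _ 97 @Tr.ind_exists.val

def Tr.ind.val {k : El Nt} {A : TyAt 1} (P : El (Tr k A) → TyAt 2)
    (w : (z : El (Tr k A)) → El (isTy k (P z))) (t : (a : El A) → El (P (tr_in a)))
    (z : El (Tr k A)) : El (P z) :=
  fst (Tr.ind_exists P w t) ⦿ z
def Tr.ind := @glb _ _ 98 @Tr.ind.val

def Tr.ind_in.val {k : El Nt} {A : TyAt 1} (P : El (Tr k A) → TyAt 2)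
    (w : (z : El (Tr k A)) → El (isTy k (P z))) (t : (a : El A) → El (P (tr_in a)))
    (a : El A) : El (Tr.ind P w t (tr_in a) ≐ t a) :=
  (snd (Tr.ind_exists P w t) ⦿ a).as
def Tr.ind_in := @glb _ _ 99 @Tr.ind_in.val

def truncEntries : List Entry := [
    reducible (entry @HT.val), reducible (entry @tin.val), reducible (entry @hub.val),
    reducible (entry @spoke.val), entry @isTy_HT.val, entry @HT.center.val,
    reducible (entry @HT.ind.val), entry @HT.ind_tin.val, reducible (entry @Tr.val),
    reducible (entry @tr_in.val), entry @isTy_Tr.val, entry @Tr.ind_exists.val,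
    reducible (entry @Tr.ind.val), reducible (entry @Tr.ind_in.val)]

/-- The environment so far. -/
def truncEnv : List Entry := truncEntries.reverse ++ suspEnv

set_option maxRecDepth 100000 in
theorem truncEnv_ok : okAll truncEntries suspEnv = true := by decide +kernel

/-! ### Connected types -/

def fn_ind_family.val {A : TyAt 2} {P : El A → TyAt 2} {f : El (Fn A P)}
    (M : (g : El (Fn A P)) → El (Fn A fun a => f ⦿ a ≐ g ⦿ a) → TyAt 2)
    (k : El (Fn A fun a => Sg (P a) fun y => f ⦿ a ≐ y)) : TyAt 2 :=
  M (Lam fun a => fst (k ⦿ a)) (Lam fun a => (snd (k ⦿ a)).as)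
def fn_ind_family := @glb _ _ 100 @fn_ind_family.val

/-- Induction on homotopies: the pairs of a function `g` and a homotopy from `f` to `g` are the
points of a contractible type of choice functions, and the motive is transported along its
contraction. The computation rule holds because the contracting path from a point to itself is
trivial. -/
def fn_ind_exists.val {A : TyAt 2} {P : El A → TyAt 2} {f : El (Fn A P)}
    (M : (g : El (Fn A P)) → El (Fn A fun a => f ⦿ a ≐ g ⦿ a) → TyAt 2)
    (d : El (M f (Lam fun _ => rfl'))) :
    El (Sg (Fn (Fn A P) fun g => Fn (Fn A fun a => f ⦿ a ≐ g ⦿ a) fun h => M g h) fun s =>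
      s ⦿ f ⦿ (Lam fun _ => rfl') ≐ d) :=
  mk (Lam fun g => Lam fun h => (tr (fun k => fn_ind_family M k)
    (contr_path (weak_funext fun a => contr_from (f ⦿ a)) (Lam fun a => mk (f ⦿ a) rfl')
      (Lam fun a => mk (g ⦿ a) (h ⦿ a))) d.as).as)
    (ap (B := M f (Lam fun _ => rfl')) (fun p => (tr (fun k => fn_ind_family M k) p d.as).as)
      (contr_path_rfl (weak_funext fun a => contr_from (f ⦿ a)) (Lam fun a => mk (f ⦿ a) rfl'))).as
def fn_ind_exists := @glb _ _ 101 @fn_ind_exists.val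

def fn_ind.val {A : TyAt 2} {P : El A → TyAt 2} {f : El (Fn A P)}
    (M : (g : El (Fn A P)) → El (Fn A fun a => f ⦿ a ≐ g ⦿ a) → TyAt 2)
    (d : El (M f (Lam fun _ => rfl'))) {g : El (Fn A P)} (h : El (Fn A fun a => f ⦿ a ≐ g ⦿ a)) :
    El (M g h) :=
  fst (fn_ind_exists M d) ⦿ g ⦿ h
def fn_ind := @glb _ _ 102 @fn_ind.val

def fn_ind_rfl.val {A : TyAt 2} {P : El A → TyAt 2} {f : El (Fn A P)}
    (M : (g : El (Fn A P)) → El (Fn A fun a => f ⦿ a ≐ g ⦿ a) → TyAt 2)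
    (d : El (M f (Lam fun _ => rfl'))) : El (fn_ind M d (Lam fun _ => rfl') ≐ d) :=
  (snd (fn_ind_exists M d)).as
def fn_ind_rfl := @glb _ _ 103 @fn_ind_rfl.val

/-- The family takes values in the `(m-2)`-types. These form an `(m-1)`-type by `isTy_types`, so the
map into them factors through the `(m-1)`-truncation of `A`. -/
def Conn.family_exists.val {m : El Nt} {A : TyAt 1} (P : El A → TyAt 1)
    (w : (x : El A) → El (isTy m (P x))) :
    El (Sg (HT m A ⇾ Un 1) fun F => Fn A fun x => F ⦿ tin x ≐ Ty.el 1 (P x)) :=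
  mk (Lam fun z => fst (A := Un 1) (B := fun X => isTy m X.ty) (HT.ind (fun _ => Types m)
      (fun _ => isTy_types)
      (fun x => (mk (B := fun X : El (Un 1) => isTy m X.ty) (Ty.el 1 (P x)) (w x).as).as) z).as)
    (Lam fun x => (ap (B := Un 1) (fun u => fst (A := Un 1) (B := fun X => isTy m X.ty) u.as)
      (HT.ind_tin (fun _ => Types m) (fun _ => isTy_types)
      (fun x => (mk (B := fun X : El (Un 1) => isTy m X.ty) (Ty.el 1 (P x)) (w x).as).as) x)).as)
def Conn.family_exists := @glb _ _ 104 @Conn.family_exists.val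

def tr_tr_sym.val {A : Ty} {P : El A → Ty} {x y : El A} (p : El (x ≐ y)) (u : El (P y)) :
    El (tr P p (tr P (sym p) u) ≐ u) :=
  J' (fun y p => (u : El (P y)) → El (tr P p (tr P (sym p) u) ≐ u)) (fun _ => triv) p u
def tr_tr_sym := @glb _ _ 105 @tr_tr_sym.val

/-- In the contractible truncation the images of `x₀` and `x` are equal, and `d` is transported
along this path in the family extended by `Conn.family_exists`. At `x = x₀` the path is trivial,
which gives back `d`. -/
def Conn.ind_exists.val {m : El Nt} {A : TyAt 1} (c : El (Contr (HT m A))) (x₀ : El A)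
    (P : El A → TyAt 1) (w : (x : El A) → El (isTy m (P x))) (d : El (P x₀)) :
    El (Sg (Fn A P) fun s => s ⦿ x₀ ≐ d) :=
  Sg.ind (fun _ => Sg (Fn A P) fun s => s ⦿ x₀ ≐ d)
    (fun (F : El (HT m A ⇾ Un 1)) (e : El (Fn A fun x => F ⦿ tin x ≐ Ty.el 1 (P x))) =>
      mk (Lam fun x => (tr (fun X : El (Un 1) => X.ty) (e ⦿ x) (tr (fun z => (F ⦿ z).ty)
          (contr_path c (tin x₀) (tin x)) (tr (fun X : El (Un 1) => X.ty) (sym (e ⦿ x₀)) d.as))).as)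
        (cat (y := (tr (fun X : El (Un 1) => X.ty) (e ⦿ x₀) (tr (fun X : El (Un 1) => X.ty)
            (sym (e ⦿ x₀)) d.as)).as)
          (ap (B := P x₀) (fun p => (tr (fun X : El (Un 1) => X.ty) (e ⦿ x₀) (tr (fun z => (F ⦿ z).ty)
            p (tr (fun X : El (Un 1) => X.ty) (sym (e ⦿ x₀)) d.as))).as)
            (contr_path_rfl c (tin x₀))).as
          (tr_tr_sym (P := fun X : El (Un 1) => X.ty) (e ⦿ x₀) d.as).as))
    (Conn.family_exists P w)
def Conn.ind_exists := @glb _ _ 106 @Conn.ind_exists.val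

def path_of_diff.val {A : Ty} {x y : El A} {p p' : El (x ≐ y)} (t : El (rfl' ≐ cat p (sym p'))) :
    El (p ≐ p') :=
  J' (fun y p' => (p : El (x ≐ y)) → (t : El (rfl' ≐ cat p (sym p'))) → El (p ≐ p'))
    (fun p t => sym (cat t (cat_rfl p).as)) p' p t
def path_of_diff := @glb _ _ 107 @path_of_diff.val

def path_of_diff_rfl.val {A : Ty} {x y : El A} (p : El (x ≐ y)) :
    El (path_of_diff (sym (cat_sym p)) ≐ rfl') :=
  J (fun _ p => path_of_diff (sym (cat_sym p)) ≐ rfl') triv p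
def path_of_diff_rfl := @glb _ _ 108 @path_of_diff_rfl.val

/-- The extensions of `d` to a section of `P`. -/
abbrev Ext {A : TyAt 1} (x₀ : El A) (P : El A → TyAt 1) (d : El (P x₀)) : TyAt 1 :=
  Sg (Fn A P) fun s => s ⦿ x₀ ≐ d

/-- The equality of two extensions, by components. -/
abbrev Ext.Eq {A : TyAt 1} {x₀ : El A} {P : El A → TyAt 1} {d : El (P x₀)} {s g : El (Fn A P)}
    (p : El (s ⦿ x₀ ≐ d)) (p' : El (g ⦿ x₀ ≐ d)) : TyAt 1 :=
  Sg (s ≐ g) fun q => tr (fun s => s ⦿ x₀ ≐ d) q p ≐ p'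

/-- The motive quantifies over the comparison path `p'` and the compatibility `t`. Then at the
trivial homotopy it only remains to deduce `p = p'`, which is `path_of_diff`. -/
def Ext.motive.val {A : TyAt 1} {x₀ : El A} {P : El A → TyAt 1} {d : El (P x₀)} {s : El (Fn A P)}
    (p : El (s ⦿ x₀ ≐ d)) (g : El (Fn A P)) (h : El (Fn A fun b => s ⦿ b ≐ g ⦿ b)) : TyAt 2 :=
  Fn (g ⦿ x₀ ≐ d) fun p' => h ⦿ x₀ ≐ cat p (sym p') ⇾ Ext.Eq p p'
def Ext.motive := @glb _ _ 109 @Ext.motive.val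

def Ext.motive_rfl.val {A : TyAt 1} {x₀ : El A} {P : El A → TyAt 1} {d : El (P x₀)} {s : El (Fn A P)}
    (p : El (s ⦿ x₀ ≐ d)) (p' : El (s ⦿ x₀ ≐ d)) (t : El (rfl' ≐ cat p (sym p'))) : El (Ext.Eq p p') :=
  mk (B := fun q => tr (fun s => s ⦿ x₀ ≐ d) q p ≐ p') rfl' (path_of_diff t).as
def Ext.motive_rfl := @glb _ _ 110 @Ext.motive_rfl.val

def Ext.apply.val {A : TyAt 1} {x₀ : El A} {P : El A → TyAt 1} {d : El (P x₀)} {s : El (Fn A P)}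
    {p : El (s ⦿ x₀ ≐ d)} {g : El (Fn A P)} {h : El (Fn A fun b => s ⦿ b ≐ g ⦿ b)}
    (k : El (Ext.motive p g h)) (p' : El (g ⦿ x₀ ≐ d)) (t : El (h ⦿ x₀ ≐ cat p (sym p'))) :
    El (Ext.Eq p p') :=
  (k.as : El (Fn (g ⦿ x₀ ≐ d) fun p' => h ⦿ x₀ ≐ cat p (sym p') ⇾ Ext.Eq p p')) ⦿ p' ⦿ t
def Ext.apply := @glb _ _ 111 @Ext.apply.val

def Ext.apply_rfl.val {A : TyAt 1} {x₀ : El A} {P : El A → TyAt 1} {d : El (P x₀)} {s : El (Fn A P)}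
    (p : El (s ⦿ x₀ ≐ d)) :
    El (Ext.apply (fn_ind (fun g h => Ext.motive p g h)
          (Lam fun p' => Lam fun t => Ext.motive_rfl p p' t).as (Lam fun _ => rfl')) p
        (sym (cat_sym p)).as ≐
      mk (B := fun q => tr (fun s => s ⦿ x₀ ≐ d) q p ≐ p) rfl' triv) :=
  cat (y := Ext.motive_rfl p p (sym (cat_sym p)))
    (ap (fun k => Ext.apply k p (sym (cat_sym p)).as)
      (fn_ind_rfl (fun g h => Ext.motive p g h)
        (Lam fun p' => Lam fun t => Ext.motive_rfl p p' t).as)).as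
    (ap (fun r => mk (B := fun q => tr (fun s => s ⦿ x₀ ≐ d) q p ≐ p) rfl' r.as)
      (path_of_diff_rfl p)).as
def Ext.apply_rfl := @glb _ _ 112 @Ext.apply_rfl.val

def Ext.path.val {A : TyAt 1} {x₀ : El A} {P : El A → TyAt 1} {d : El (P x₀)} {s g : El (Fn A P)}
    {p : El (s ⦿ x₀ ≐ d)} {p' : El (g ⦿ x₀ ≐ d)}
    (t : El (Ext x₀ (fun b => s ⦿ b ≐ g ⦿ b) (cat p (sym p')))) : El (Ext.Eq p p') :=
  Sg.ind (fun _ => Ext.Eq p p')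
    (fun h t => Ext.apply (fn_ind (fun g h => Ext.motive p g h) (Lam fun p' => Lam fun t => Ext.motive_rfl p p' t).as h) p' t) t
def Ext.path := @glb _ _ 113 @Ext.path.val

def Ext.diff.val {A : TyAt 1} {x₀ : El A} {P : El A → TyAt 1} {d : El (P x₀)} {s g : El (Fn A P)}
    {p : El (s ⦿ x₀ ≐ d)} {p' : El (g ⦿ x₀ ≐ d)} (e : El (Ext.Eq p p')) :
    El (Ext x₀ (fun b => s ⦿ b ≐ g ⦿ b) (cat p (sym p'))) :=
  Sg.ind (fun _ => Ext x₀ (fun b => s ⦿ b ≐ g ⦿ b) (cat p (sym p')))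
    (fun q r => J' (fun g q => (p' : El (g ⦿ x₀ ≐ d)) → El (tr (fun s => s ⦿ x₀ ≐ d) q p ≐ p') →
        El (Ext x₀ (fun b => s ⦿ b ≐ g ⦿ b) (cat p (sym p'))))
      (fun p' r => J (fun p' _ => Ext x₀ (fun b => s ⦿ b ≐ s ⦿ b) (cat p (sym p')))
        (mk (Lam fun _ => rfl') (sym (cat_sym p)).as) (r.as : El (p ≐ p'))) q p' r) e
def Ext.diff := @glb _ _ 114 @Ext.diff.val

def Ext.path_mk.val {A : TyAt 1} {x₀ : El A} {P : El A → TyAt 1} {d : El (P x₀)} {s : El (Fn A P)}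
    (p : El (s ⦿ x₀ ≐ d)) :
    El (Ext.path (p := p) (p' := p) (mk (A := Fn A fun b => s ⦿ b ≐ s ⦿ b) (B := fun h => h ⦿ x₀ ≐ cat p (sym p)) (Lam fun _ => rfl')
        (sym (cat_sym p)).as) ≐ mk (B := fun q => tr (fun s => s ⦿ x₀ ≐ d) q p ≐ p) rfl' triv) :=
  (Ext.apply_rfl p).as
def Ext.path_mk := @glb _ _ 115 @Ext.path_mk.val

def Ext.path_diff_rfl.val {A : TyAt 1} {x₀ : El A} {P : El A → TyAt 1} {d : El (P x₀)} {s : El (Fn A P)}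
    (p : El (s ⦿ x₀ ≐ d)) :
    El (Ext.path (Ext.diff (mk (B := fun q => tr (fun s => s ⦿ x₀ ≐ d) q p ≐ p) rfl' triv)) ≐
      mk (B := fun q => tr (fun s => s ⦿ x₀ ≐ d) q p ≐ p) rfl' triv) :=
  (Ext.path_mk p).as
def Ext.path_diff_rfl := @glb _ _ 116 @Ext.path_diff_rfl.val

/-- An equality of extensions `(s, p)` and `(g, p')` is a retract of an extension of `p · p'⁻¹` to a
section of the family `s b = g b`. Path induction reduces this to trivial data, where it is
`Ext.path_diff_rfl`. -/
def Ext.path_diff.val {A : TyAt 1} {x₀ : El A} {P : El A → TyAt 1} {d : El (P x₀)} {s g : El (Fn A P)}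
    {p : El (s ⦿ x₀ ≐ d)} {p' : El (g ⦿ x₀ ≐ d)} (e : El (Ext.Eq p p')) :
    El (Ext.path (Ext.diff e) ≐ e) :=
  Sg.ind (fun e => Ext.path (Ext.diff e) ≐ e)
    (fun q r => J' (fun g q => (p' : El (g ⦿ x₀ ≐ d)) → (r : El (tr (fun s => s ⦿ x₀ ≐ d) q p ≐ p')) →
        El (Ext.path (Ext.diff (mk q r)) ≐ mk q r))
      (fun p' r => (J (fun p' r => Ext.path (Ext.diff (mk rfl' r.as)) ≐
          mk (B := fun q => tr (fun s => s ⦿ x₀ ≐ d) q p ≐ p') rfl' r.as)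
        (Ext.path_diff_rfl p).as (r.as : El (p ≐ p'))).as) q p' r) e
def Ext.path_diff := @glb _ _ 117 @Ext.path_diff.val

def add.val (k m : El Nt) : El Nt := Nt.ind (fun _ => Nt) m (fun _ r => S r) k
def add := @glb _ _ 118 @add.val

/-- Induction on `k`. For `k = 0`, `Conn.ind_exists` gives an extension, and applied to the family
of paths between two extensions it gives their equality. In the step, the equality of two extensions
is a retract of a type of extensions for path types, whose level is one lower. -/
def isTy_ext.val {k m : El Nt} {A : TyAt 1} (c : El (Contr (HT m A))) {x₀ : El A} {P : El A → TyAt 1}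
    {d : El (P x₀)} (w : (b : El A) → El (isTy (add k m) (P b))) : El (isTy k (Ext x₀ P d)) :=
  Nt.ind' (fun k => (P : El A → TyAt 1) → (d : El (P x₀)) →
      (w : (b : El A) → El (isTy (add k m) (P b))) → El (isTy k (Ext x₀ P d)))
    (fun P d w => isTyO (Sg.ind (fun _ => Contr (Ext x₀ P d))
      (fun s p => mk (mk (B := fun s => s ⦿ x₀ ≐ d) s p) (Lam fun v =>
        Sg.ind (fun v => mk (B := fun s => s ⦿ x₀ ≐ d) s p ≐ v)
          (fun g p' => Sg.ind (fun _ => mk (B := fun s => s ⦿ x₀ ≐ d) s p ≐ mk g p')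
            (fun q r => pair_eq q r)
            (Ext.path (Conn.ind_exists c x₀ (fun b => s ⦿ b ≐ g ⦿ b)
              (fun b => isTy_paths (isTy_up (w b).as) (s ⦿ b) (g ⦿ b))
              (cat p (sym p'))))) v))
      (Conn.ind_exists c x₀ P (fun b => (w b).as) d)))
    (fun k ih P d w => isTyS fun u v => Sg.ind (fun u => isTy k (u ≐ v))
      (fun s p => Sg.ind (fun v => isTy k (mk (B := fun s => s ⦿ x₀ ≐ d) s p ≐ v))
        (fun g p' => isTy_pair_paths (isTy_retract (A := Ext.Eq p p') (fun e => Ext.diff e)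
          (fun t => Ext.path t) (fun e => Ext.path_diff e)
          (ih (fun b => s ⦿ b ≐ g ⦿ b) (cat p (sym p'))
            fun b => isTy_paths (w b).as (s ⦿ b) (g ⦿ b)))) v) u)
    k P d w
def isTy_ext := @glb _ _ 119 @isTy_ext.val

def add_succ.val {k m : El Nt} : El (add k (S m) ≐ S (add k m)) :=
  Nt.ind (fun k => add k (S m) ≐ S (add k m)) triv
    (fun _ ih => (ap (fun n => S n) ih).as) k
def add_succ := @glb _ _ 120 @add_succ.val

def dbl.val (m : El Nt) : El Nt := ⟨double m.e⟩
def dbl := @glb _ _ 121 @dbl.val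

def add_self.val {m : El Nt} : El (dbl m ≐ add m m) :=
  Nt.ind (fun m => dbl m ≐ add m m) triv
    (fun m ih => (ap (fun n => S n) (cat (ap (fun n => S n) ih) (sym add_succ))).as) m
def add_self := @glb _ _ 122 @add_self.val

/-- For fixed `a` the sections of `P a` extending `f a` form an `(m-2)`-type by `isTy_ext`, because
`2m = m + m`. So connectedness applies once more, now in the variable `a`, and the prescribed value
at `x₀` is the pair of `g` and `e`. -/
def wedge.val {m : El Nt} {A : TyAt 1} (c : El (Contr (HT m A))) {x₀ : El A}
    {P : El A → El A → TyAt 1} (w : (a b : El A) → El (isTy (dbl m) (P a b)))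
    (f : (a : El A) → El (P a x₀)) (g : (b : El A) → El (P x₀ b)) (e : El (g x₀ ≐ f x₀)) :
    El (Sg (Fn A fun a => Ext x₀ (P a) (f a)) fun s => s ⦿ x₀ ≐ mk (Lam g) e.as) :=
  (Conn.ind_exists c x₀ (fun a => Ext x₀ (P a) (f a))
    (fun a => isTy_ext c fun b => tr (fun n => isTy n (P a b)) add_self (w a b))
    (mk (Lam g) e.as))
def wedge := @glb _ _ 123 @wedge.val

def connEntries : List Entry := [
    reducible (entry @fn_ind_family.val), entry @fn_ind_exists.val,
    reducible (entry @fn_ind.val), entry @fn_ind_rfl.val, entry @Conn.family_exists.val,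
    entry @tr_tr_sym.val, entry @Conn.ind_exists.val, reducible (entry @path_of_diff.val),
    entry @path_of_diff_rfl.val, reducible (entry @Ext.motive.val),
    reducible (entry @Ext.motive_rfl.val), reducible (entry @Ext.apply.val),
    entry @Ext.apply_rfl.val, reducible (entry @Ext.path.val), reducible (entry @Ext.diff.val),
    entry @Ext.path_mk.val, entry @Ext.path_diff_rfl.val, entry @Ext.path_diff.val,
    reducible (entry @add.val), entry @isTy_ext.val, entry @add_succ.val,
    reducible (entry @dbl.val), entry @add_self.val, entry @wedge.val]

/-- The environment so far. -/
def connEnv : List Entry := connEntries.reverse ++ truncEnv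

set_option maxRecDepth 100000 in
theorem connEnv_ok : okAll connEntries truncEnv = true := by decide +kernel

/-! ### Equivalences and families over path spaces -/

def funext_ap.val {A : TyAt 2} {P : El A → TyAt 2} {f g : El (Fn A P)}
    (h : El (Fn A fun a => f ⦿ a ≐ g ⦿ a)) (x : El A) :
    El (ap (fun f => f ⦿ x) (funext fun a => h ⦿ a) ≐ h ⦿ x) :=
  fn_ind (fun g h => ap (fun f => f ⦿ x) (funext fun a => h ⦿ a) ≐ h ⦿ x)
    (ap (fun q => ap (fun f => f ⦿ x) q) (funext_rfl f)).as h
def funext_ap := @glb _ _ 124 @funext_ap.val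

def J_right.val {A : TyAt 2} {b : El A} (P : (x : El A) → El (x ≐ b) → TyAt 2) (d : El (P b rfl'))
    {a : El A} (p : El (a ≐ b)) : El (P a p) :=
  J' (fun b p => (P : (x : El A) → El (x ≐ b) → TyAt 2) → El (P b rfl') → El (P a p))
    (fun P d => d) p P d
def J_right := @glb _ _ 125 @J_right.val

def contr_to.val {A : TyAt 2} (a : El A) : El (Contr (Sg A fun x => x ≐ a)) :=
  mk (mk a rfl') (Lam fun w => Sg.ind (fun w => mk (B := fun x => x ≐ a) a rfl' ≐ w)
    (fun x p => J_right (fun x p => mk (B := fun x => x ≐ a) a rfl' ≐ mk x p) rfl' p) w)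
def contr_to := @glb _ _ 126 @contr_to.val

/-- The function `f` has contractible fibres. -/
abbrev ContrMap {A B : TyAt 1} (f : El (A ⇾ B)) : TyAt 1 :=
  Fn B fun y => Contr (Sg A fun x => f ⦿ x ≐ y)

/-- By univalence the equivalence is a coercion along an equality of types, and by path induction it
may be taken to be the identity. -/
def contrMap_of_equ.val {A B : TyAt 1} (w : El (Equ A B)) : El (ContrMap (fst w)) :=
  Sg.ind (fun _ => ContrMap (fst w))
    (fun p (q : El (coe1 p ≐ fst w)) => tr (fun f => ContrMap f) q
      (J (fun B p => ContrMap (A := A) (B := B.ty) (coe1 p)) (Lam fun y : El A => contr_to y).as p).as)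
    (ua1 w)
def contrMap_of_equ := @glb _ _ 127 @contrMap_of_equ.val

def equ_of_contrMap.val {A B : TyAt 1} (f : El (A ⇾ B)) (h : El (ContrMap f)) : El (IsEqu f) :=
  mk (mk (Lam fun y => fst (fst (h ⦿ y))) (Lam fun x =>
      (ap (fun u => fst u) (contr_path (h ⦿ (f ⦿ x)) (fst (h ⦿ (f ⦿ x))) (mk x rfl'))).as))
    (mk (Lam fun y => fst (fst (h ⦿ y))) (Lam fun y => (snd (fst (h ⦿ y))).as))
def equ_of_contrMap := @glb _ _ 128 @equ_of_contrMap.val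

/-- This is the reason for working with contractible fibres besides two-sided inverses: here being a
proposition is immediate, as the connectedness argument requires. -/
def isProp_contrMap.val {A B : TyAt 1} {f : El (A ⇾ B)} : El (isTy (S O) (ContrMap f)) :=
  isTy_fn fun _ => isProp_contr
def isProp_contrMap := @glb _ _ 129 @isProp_contrMap.val

/-- Over a meridian, the codes at the two poles have to be joined by a dependent path of families.
By induction on `q` the equalities of `f p` with `g (p · q)` suffice. -/
def dpath.val {A : TyAt 2} {x y : El A} (q : El (x ≐ y)) (f : El (x ≐ x ⇾ Un 1)) (g : El (x ≐ y ⇾ Un 1))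
    (h : El (Fn (x ≐ x) fun p => f ⦿ p ≐ g ⦿ cat p q)) : El (tr (fun y => x ≐ y ⇾ Un 1) q f ≐ g) :=
  J' (fun y q => (g : El (x ≐ y ⇾ Un 1)) → (h : El (Fn (x ≐ x) fun p => f ⦿ p ≐ g ⦿ cat p q)) →
      El (tr (fun y => x ≐ y ⇾ Un 1) q f ≐ g))
    (fun g h => (funext fun p => cat (h ⦿ p) (ap (fun p => g ⦿ p) (cat_rfl p))).as) q g h
def dpath := @glb _ _ 130 @dpath.val

/-- Evaluating both sides of `t` at reflexivity turns the path made by `funext` back into its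
component, by `funext_ap`. -/
def dpath_rfl.val {A : TyAt 2} {x : El A} {f : El (x ≐ x ⇾ Un 1)}
    (h : El (Fn (x ≐ x) fun p => f ⦿ p ≐ f ⦿ cat p rfl'))
    (t : El (triv ≐ dpath rfl' f f h)) : El (triv ≐ h ⦿ rfl') :=
  (cat (x := rfl') (y := ap (fun f => f ⦿ rfl') (funext fun p => cat (h ⦿ p) (ap (fun p => f ⦿ p) (cat_rfl p))))
    (z := (h ⦿ rfl').as) (ap (fun q => ap (fun f => f ⦿ rfl') q) t).as
    (cat (y := (cat (h ⦿ rfl') rfl').as)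
      (funext_ap (Lam fun p => cat (h ⦿ p) (ap (fun p => f ⦿ p) (cat_rfl p))) rfl').as
      (cat_rfl (h ⦿ rfl')).as)).as
def dpath_rfl := @glb _ _ 131 @dpath_rfl.val

/-- Transport in the family `D` along `q`, when the action of `D` on `q` is known. -/
def J_dpath.val {A : TyAt 2} {x y : El A} (q : El (x ≐ y)) (D : (y : El A) → El (x ≐ y ⇾ Un 1))
    (c : El (D x ⦿ rfl').ty) (h : El (Fn (x ≐ x) fun p => D x ⦿ p ≐ D y ⦿ cat p q))
    (t : El (dap D q ≐ dpath q (D x) (D y) h)) :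
    El (tr (fun q => (D y ⦿ q).ty) (rfl_cat q)
        (coe1 (A := (D x ⦿ rfl').ty) (B := (D y ⦿ cat rfl' q).ty) (h ⦿ rfl') ⦿ c) ≐
      J (fun y q => (D y ⦿ q).ty) c q) :=
  J' (fun y q => (h : El (Fn (x ≐ x) fun p => D x ⦿ p ≐ D y ⦿ cat p q)) →
      (t : El (dap D q ≐ dpath q (D x) (D y) h)) →
      El (tr (fun q => (D y ⦿ q).ty) (rfl_cat q)
        (coe1 (A := (D x ⦿ rfl').ty) (B := (D y ⦿ cat rfl' q).ty) (h ⦿ rfl') ⦿ c) ≐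
      J (fun y q => (D y ⦿ q).ty) c q))
    (fun h t => (sym (ap (fun r => coe1 (A := (D x ⦿ rfl').ty) (B := (D x ⦿ cat rfl' rfl').ty) r ⦿ c)
      (dpath_rfl h t.as))).as) q h t
def J_dpath := @glb _ _ 132 @J_dpath.val

def equivEntries : List Entry := [
    entry @funext_ap.val, entry @J_right.val, entry @contr_to.val, entry @contrMap_of_equ.val,
    entry @equ_of_contrMap.val, entry @isProp_contrMap.val, reducible (entry @dpath.val),
    entry @dpath_rfl.val, entry @J_dpath.val]

/-- The environment so far. -/
def equivEnv : List Entry := equivEntries.reverse ++ connEnv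

set_option maxRecDepth 100000 in
theorem equivEnv_ok : okAll equivEntries connEnv = true := by decide +kernel

/-! ### The codes of the paths in a suspension -/

def ins_left.val {A : Ty} {x y z : El A} (q : El (x ≐ y)) (p : El (x ≐ z)) :
    El (p ≐ cat (cat q (sym q)) p) :=
  J (fun _ q => p ≐ cat (cat q (sym q)) p) (sym (rfl_cat p)).as q
def ins_left := @glb _ _ 133 @ins_left.val

def ins_right.val {A : Ty} {x y z : El A} (q : El (z ≐ y)) (p : El (x ≐ y)) :
    El (p ≐ cat (cat p (sym q)) q) :=
  J' (fun y q => (p : El (x ≐ y)) → El (p ≐ cat (cat p (sym q)) q))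
    (fun p => J (fun _ p => p ≐ cat (cat p (sym rfl')) rfl') triv p) q p
def ins_right := @glb _ _ 134 @ins_right.val

def del.val {A : Ty} {x y z : El A} (p : El (x ≐ y)) (q : El (y ≐ z)) :
    El (cat (cat p q) (sym q) ≐ p) :=
  J (fun _ q => cat (cat p q) (sym q) ≐ p)
    (J (fun _ p => cat (cat p rfl') (sym rfl') ≐ p) triv p) q
def del := @glb _ _ 135 @del.val

/-- This is the coherence at the base point that lets the wedge lemma be applied. -/
def ins_eq.val {A : Ty} {x y : El A} (p : El (x ≐ y)) : El (ins_right p p ≐ ins_left p p) :=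
  J (fun _ p => ins_right p p ≐ ins_left p p) triv p
def ins_eq := @glb _ _ 136 @ins_eq.val

/-- The path algebra by which `bwd` after `fwd` is the identity at the base point. -/
def del_ins.val {A : Ty} {x y z : El A} (q : El (z ≐ y)) (p : El (x ≐ y)) :
    El (cat (ap (fun r => cat r (sym q)) (ins_right q p)) (del (cat p (sym q)) q) ≐ rfl') :=
  J' (fun y q => (p : El (x ≐ y)) →
      El (cat (ap (fun r => cat r (sym q)) (ins_right q p)) (del (cat p (sym q)) q) ≐ rfl'))
    (fun p => J (fun _ p => cat (ap (fun r => cat r (sym rfl')) (ins_right rfl' p))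
      (del (cat p (sym rfl')) rfl') ≐ rfl') triv p) q p
def del_ins := @glb _ _ 137 @del_ins.val

/-- The path algebra for the opposite composite. The endpoint `t` is free so that `r` can be
eliminated. -/
def ins_del.val {A : TyAt 2} {x y z : El A} (p : El (x ≐ y)) (q : El (y ≐ z)) {t : El (x ≐ z)}
    (r : El (t ≐ cat p q)) : El (cat (ins_right q t) (ap (fun r => cat r q)
      (cat (ap (fun r => cat r (sym q)) r) (del p q))) ≐ r) :=
  J_right (fun t r => cat (ins_right q t) (ap (fun r => cat r q)
      (cat (ap (fun r => cat r (sym q)) r) (del p q))) ≐ r)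
    (J (fun _ q => cat (ins_right q (cat p q)) (ap (fun r => cat r q)
        (cat (ap (fun r => cat r (sym q)) (rfl' (x := cat p q))) (del p q))) ≐ rfl')
      (J (fun _ p => cat (ins_right rfl' (cat p rfl')) (ap (fun r => cat r rfl')
        (cat (ap (fun r => cat r (sym rfl')) (rfl' (x := cat p rfl'))) (del p rfl'))) ≐ rfl') triv p) q) r
def ins_del := @glb _ _ 138 @ins_del.val

/-- Inserting `q · q⁻¹` in front of `p` and then cancelling it leaves `p` alone. With `q = μ x₀` and
`p = μ a` this determines the image of the base code. -/
def tr_J_ins.val {A : TyAt 2} {x y z : El A} (q : El (x ≐ z)) (p : El (x ≐ y)) (H : El (x ≐ y) → TyAt 2)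
    (i : (t : El (x ≐ y)) → El (p ≐ t) → El (H t)) :
    El (tr H (rfl_cat p) (J (fun t _ => H (cat t p)) (i (cat (cat q (sym q)) p) (ins_left q p))
      (cat_sym q)) ≐ i p rfl') :=
  J (fun _ q => tr H (rfl_cat p) (J (fun t _ => H (cat t p)) (i (cat (cat q (sym q)) p) (ins_left q p))
      (cat_sym q)) ≐ i p rfl')
    (J' (fun y p => (H : El (x ≐ y) → TyAt 2) → (i : (t : El (x ≐ y)) → El (p ≐ t) → El (H t)) →
        El (tr H (rfl_cat p) (J (fun t _ => H (cat t p)) (i (cat (cat rfl' (sym rfl')) p) (ins_left rfl' p))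
          (cat_sym rfl')) ≐ i p rfl'))
      (fun H i => triv) p H i) q
def tr_J_ins := @glb _ _ 139 @tr_J_ins.val

/-- The codes of the loops. -/
abbrev F (k : El Nt) {C X : TyAt 1} {n s : El X} (μ : El (C ⇾ n ≐ s)) (x₀ : El C) (p : El (n ≐ n)) :
    TyAt 1 :=
  Tr k (Sg C fun x => cat (μ ⦿ x) (sym (μ ⦿ x₀)) ≐ p)

/-- The codes of the paths between the poles. -/
abbrev G (k : El Nt) {C X : TyAt 1} {n s : El X} (μ : El (C ⇾ n ≐ s)) (q : El (n ≐ s)) : TyAt 1 :=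
  Tr k (Sg C fun x => μ ⦿ x ≐ q)

def F.in.val {k : El Nt} {C X : TyAt 1} {n s : El X} {μ : El (C ⇾ n ≐ s)} {x₀ : El C} {p : El (n ≐ n)}
    (b : El C) (r : El (cat (μ ⦿ b) (sym (μ ⦿ x₀)) ≐ p)) : El (F k μ x₀ p) :=
  tr_in (mk b r)
def F.in := @glb _ _ 140 @F.in.val

def G.in.val {k : El Nt} {C X : TyAt 1} {n s : El X} {μ : El (C ⇾ n ≐ s)} {q : El (n ≐ s)}
    (b : El C) (r : El (μ ⦿ b ≐ q)) : El (G k μ q) :=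
  tr_in (mk b r)
def G.in := @glb _ _ 141 @G.in.val

/-- The functions that the wedge lemma gives. -/
abbrev Wedge (k : El Nt) {C X : TyAt 1} {n s : El X} (μ : El (C ⇾ n ≐ s)) (x₀ : El C) : TyAt 1 :=
  Fn C fun a => Fn C fun b => G k μ (cat (cat (μ ⦿ b) (sym (μ ⦿ x₀))) (μ ⦿ a))

abbrev Wedge.Left {k : El Nt} {C X : TyAt 1} {n s : El X} {μ : El (C ⇾ n ≐ s)} {x₀ : El C}
    (W : El (Wedge k μ x₀)) : TyAt 1 :=
  Fn C fun a => W ⦿ a ⦿ x₀ ≐ G.in a (ins_left (μ ⦿ x₀) (μ ⦿ a))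

abbrev Wedge.Right {k : El Nt} {C X : TyAt 1} {n s : El X} {μ : El (C ⇾ n ≐ s)} {x₀ : El C}
    (W : El (Wedge k μ x₀)) : TyAt 1 :=
  Fn C fun b => W ⦿ x₀ ⦿ b ≐ G.in b (ins_right (μ ⦿ x₀) (μ ⦿ b))

def wedge_exists.val {m : El Nt} {A : TyAt 1} (c : El (Contr (HT m A))) {x₀ : El A}
    {P : El A → El A → TyAt 1} (w : (a b : El A) → El (isTy (dbl m) (P a b)))
    (f : (a : El A) → El (P a x₀)) (g : (b : El A) → El (P x₀ b)) (e : El (g x₀ ≐ f x₀)) :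
    El (Sg (Fn A fun a => Fn A fun b => P a b) fun h =>
      Sg (Fn A fun a => h ⦿ a ⦿ x₀ ≐ f a) fun _ => Fn A fun b => h ⦿ x₀ ⦿ b ≐ g b) :=
  Sg.ind (fun _ => Sg (Fn A fun a => Fn A fun b => P a b) fun h =>
      Sg (Fn A fun a => h ⦿ a ⦿ x₀ ≐ f a) fun _ => Fn A fun b => h ⦿ x₀ ⦿ b ≐ g b)
    (fun s q => mk (Lam fun a => fst (s ⦿ a))
      (mk (Lam fun a => (snd (s ⦿ a)).as) (Lam fun b => (ap (fun u => fst u ⦿ b) q).as)))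
    (wedge c w f g e)
def wedge_exists := @glb _ _ 142 @wedge_exists.val

/-- On the axis `b = x₀` the element `a` is chosen, on the axis `a = x₀` the element `b`. The two
choices agree at the base point by `ins_eq`. Only path algebra is involved, so `μ` can be any family
of paths. -/
def Wedge.exists.val {m : El Nt} {C X : TyAt 1} {n s : El X} (c : El (Contr (HT m C)))
    (μ : El (C ⇾ n ≐ s)) (x₀ : El C) :
    El (Sg (Wedge (dbl m) μ x₀) fun W => Wedge.Left W ⊗ Wedge.Right W) :=
  wedge_exists c (x₀ := x₀) (P := fun a b => G (dbl m) μ (cat (cat (μ ⦿ b) (sym (μ ⦿ x₀))) (μ ⦿ a)))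
    (fun a b => isTy_Tr) (fun a => G.in a (ins_left (μ ⦿ x₀) (μ ⦿ a)))
    (fun b => G.in b (ins_right (μ ⦿ x₀) (μ ⦿ b)))
    (ap (fun r => G.in x₀ r) (ins_eq (μ ⦿ x₀)))
def Wedge.exists := @glb _ _ 143 @Wedge.exists.val

/-- An element of the truncated fibre may be taken to be represented by some `b`, with `p` equal to
`μ b · (μ x₀)⁻¹`; there `W a b` is the required value. -/
def fwd.val {k : El Nt} {C X : TyAt 1} {n s : El X} {μ : El (C ⇾ n ≐ s)} {x₀ : El C}
    (W : El (Wedge k μ x₀)) (a : El C) (p : El (n ≐ n)) (z : El (F k μ x₀ p)) :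
    El (G k μ (cat p (μ ⦿ a))) :=
  Tr.ind (fun _ => G k μ (cat p (μ ⦿ a))) (fun _ => isTy_Tr)
    (fun u => Sg.ind (fun _ => G k μ (cat p (μ ⦿ a)))
      (fun b r => J (fun p _ => G k μ (cat p (μ ⦿ a))) (W ⦿ a ⦿ b) r) u) z
def fwd := @glb _ _ 144 @fwd.val

def fwd_in.val {k : El Nt} {C X : TyAt 1} {n s : El X} {μ : El (C ⇾ n ≐ s)} {x₀ : El C}
    (W : El (Wedge k μ x₀)) (a : El C) {p : El (n ≐ n)} (b : El C)
    (r : El (cat (μ ⦿ b) (sym (μ ⦿ x₀)) ≐ p)) :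
    El (fwd W a p (F.in b r) ≐ J (fun p _ => G k μ (cat p (μ ⦿ a))) (W ⦿ a ⦿ b) r) :=
  (Tr.ind_in (fun _ => G k μ (cat p (μ ⦿ a))) (fun _ => isTy_Tr)
    (fun u => Sg.ind (fun _ => G k μ (cat p (μ ⦿ a)))
      (fun b r => J (fun p _ => G k μ (cat p (μ ⦿ a))) (W ⦿ a ⦿ b) r) u) (mk b r)).as
def fwd_in := @glb _ _ 145 @fwd_in.val

/-- An inverse is written down only for `a = x₀`, where the representative `b` can be kept. For
other `a`, connectedness does the work. -/
def bwd.val {k : El Nt} {C X : TyAt 1} {n s : El X} {μ : El (C ⇾ n ≐ s)} {x₀ : El C}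
    (p : El (n ≐ n)) (z : El (G k μ (cat p (μ ⦿ x₀)))) : El (F k μ x₀ p) :=
  Tr.ind (fun _ => F k μ x₀ p) (fun _ => isTy_Tr)
    (fun u => Sg.ind (fun _ => F k μ x₀ p)
      (fun b r => F.in b (cat (ap (fun r => cat r (sym (μ ⦿ x₀))) r) (del p (μ ⦿ x₀)))) u) z
def bwd := @glb _ _ 146 @bwd.val

def bwd_in.val {k : El Nt} {C X : TyAt 1} {n s : El X} {μ : El (C ⇾ n ≐ s)} {x₀ : El C}
    {p : El (n ≐ n)} (b : El C) (r : El (μ ⦿ b ≐ cat p (μ ⦿ x₀))) :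
    El (bwd (k := k) (x₀ := x₀) p (G.in b r) ≐
      F.in b (cat (ap (fun r => cat r (sym (μ ⦿ x₀))) r) (del p (μ ⦿ x₀)))) :=
  (Tr.ind_in (fun _ => F k μ x₀ p) (fun _ => isTy_Tr)
    (fun u => Sg.ind (fun _ => F k μ x₀ p)
      (fun b r => F.in b (cat (ap (fun r => cat r (sym (μ ⦿ x₀))) r) (del p (μ ⦿ x₀)))) u) (mk b r)).as
def bwd_in := @glb _ _ 147 @bwd_in.val

def bwd_fwd.val {k : El Nt} {C X : TyAt 1} {n s : El X} {μ : El (C ⇾ n ≐ s)} {x₀ : El C}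
    {W : El (Wedge k μ x₀)} (h : El (Wedge.Right W)) {p : El (n ≐ n)} (z : El (F k μ x₀ p)) :
    El (bwd p (fwd W x₀ p z) ≐ z) :=
  Tr.ind (fun z => bwd p (fwd W x₀ p z) ≐ z)
    (fun z => isTy_paths (isTy_up isTy_Tr) (bwd p (fwd W x₀ p z)) z)
    (fun u => Sg.ind (fun u => bwd p (fwd W x₀ p (tr_in u)) ≐ tr_in u)
      (fun b r => (J (fun p r => bwd p (fwd W x₀ p (F.in b r)) ≐ F.in b r)
        (cat (ap (fun z => bwd (cat (μ ⦿ b) (sym (μ ⦿ x₀))) z) (cat (fwd_in W x₀ b rfl') (h ⦿ b).as))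
          (cat (bwd_in b (ins_right (μ ⦿ x₀) (μ ⦿ b)))
            (ap (fun r => F.in b r) (del_ins (μ ⦿ x₀) (μ ⦿ b))))) r).as) u) z
def bwd_fwd := @glb _ _ 148 @bwd_fwd.val

def J_right_in.val {k : El Nt} {C X : TyAt 1} {n s : El X} {μ : El (C ⇾ n ≐ s)} {x₀ : El C}
    {W : El (Wedge k μ x₀)} (h : El (Wedge.Right W)) {p : El (n ≐ n)} (b : El C)
    (r : El (cat (μ ⦿ b) (sym (μ ⦿ x₀)) ≐ p)) :
    El (J (fun p _ => G k μ (cat p (μ ⦿ x₀))) (W ⦿ x₀ ⦿ b) r ≐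
      G.in b (cat (ins_right (μ ⦿ x₀) (μ ⦿ b)) (ap (fun r => cat r (μ ⦿ x₀)) r))) :=
  J (fun p r => J (fun p _ => G k μ (cat p (μ ⦿ x₀))) (W ⦿ x₀ ⦿ b) r ≐
      G.in b (cat (ins_right (μ ⦿ x₀) (μ ⦿ b)) (ap (fun r => cat r (μ ⦿ x₀)) r)))
    (cat (h ⦿ b) (ap (fun r => G.in b r) (sym (cat_rfl (ins_right (μ ⦿ x₀) (μ ⦿ b)))))).as r
def J_right_in := @glb _ _ 149 @J_right_in.val

def fwd_bwd.val {k : El Nt} {C X : TyAt 1} {n s : El X} {μ : El (C ⇾ n ≐ s)} {x₀ : El C}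
    {W : El (Wedge k μ x₀)} (h : El (Wedge.Right W)) {p : El (n ≐ n)}
    (z : El (G k μ (cat p (μ ⦿ x₀)))) : El (fwd W x₀ p (bwd p z) ≐ z) :=
  Tr.ind (fun z => fwd W x₀ p (bwd p z) ≐ z)
    (fun z => isTy_paths (isTy_up isTy_Tr) (fwd W x₀ p (bwd p z)) z)
    (fun u => Sg.ind (fun u => fwd W x₀ p (bwd p (tr_in u)) ≐ tr_in u)
      (fun b r => (cat (ap (fun z => fwd W x₀ p z) (bwd_in b r))
        (cat (fwd_in W x₀ b (cat (ap (fun r => cat r (sym (μ ⦿ x₀))) r) (del p (μ ⦿ x₀))))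
          (cat (J_right_in h b (cat (ap (fun r => cat r (sym (μ ⦿ x₀))) r) (del p (μ ⦿ x₀))))
            (ap (fun r => G.in b r) (ins_del p (μ ⦿ x₀) r))))).as) u) z
def fwd_bwd := @glb _ _ 150 @fwd_bwd.val

def codeEntries : List Entry := [
    reducible (entry @ins_left.val), reducible (entry @ins_right.val),
    reducible (entry @del.val), entry @ins_eq.val, entry @del_ins.val, entry @ins_del.val,
    entry @tr_J_ins.val, reducible (entry @F.in.val), reducible (entry @G.in.val),
    entry @wedge_exists.val, entry @Wedge.exists.val, reducible (entry @fwd.val),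
    entry @fwd_in.val, reducible (entry @bwd.val), entry @bwd_in.val, entry @bwd_fwd.val,
    entry @J_right_in.val, entry @fwd_bwd.val]

/-- The environment so far. -/
def codeEnv : List Entry := codeEntries.reverse ++ equivEnv

set_option maxRecDepth 100000 in
theorem codeEnv_ok : okAll codeEntries equivEnv = true := by decide +kernel

/-! ### The suspension theorem -/

def contrMap_of_isEqu.val {A B : TyAt 1} {f : El (A ⇾ B)} (w : El (IsEqu f)) : El (ContrMap f) :=
  (contrMap_of_equ (mk f w)).as
def contrMap_of_isEqu := @glb _ _ 151 @contrMap_of_isEqu.val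

def ua1_isEqu.val {A B : TyAt 1} {f : El (A ⇾ B)} (w : El (IsEqu f)) :
    El (Sg (Ty.el 1 A ≐ Ty.el 1 B) fun p => coe1 p ≐ f) :=
  (ua1 (mk f w)).as
def ua1_isEqu := @glb _ _ 152 @ua1_isEqu.val

/-- Having contractible fibres is a proposition, so it spreads from `x₀` to all `a` by
`Conn.ind_exists`. The successor in the truncation is needed here: propositions are allowed as
fibres only if `A` is at least 0-connected. -/
def Conn.contrMap.val {m : El Nt} {A B : TyAt 1} (c : El (Contr (HT (S m) A))) {x₀ : El A}
    {X : El B → TyAt 1} {Y : El A → El B → TyAt 1} (f : (a : El A) → (p : El B) → El (X p ⇾ Y a p))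
    (w : (p : El B) → El (IsEqu (f x₀ p))) (a : El A) (p : El B) : El (ContrMap (f a p)) :=
  fst (Conn.ind_exists c x₀ (fun a => Fn B fun p => ContrMap (f a p))
    (fun a => prop_up (isTy_fn fun p => isProp_contrMap))
    (Lam fun p => contrMap_of_isEqu (w p))) ⦿ a ⦿ p
def Conn.contrMap := @glb _ _ 153 @Conn.contrMap.val

def fwd_isEqu.val {k : El Nt} {C X : TyAt 1} {n s : El X} {μ : El (C ⇾ n ≐ s)} {x₀ : El C}
    {W : El (Wedge k μ x₀)} (h : El (Wedge.Right W)) (p : El (n ≐ n)) :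
    El (IsEqu (Lam fun z => fwd W x₀ p z)) :=
  mk (mk (Lam fun z => bwd p z) (Lam fun z => (bwd_fwd h z).as))
    (mk (Lam fun z => bwd p z) (Lam fun z => (fwd_bwd h z).as))
def fwd_isEqu := @glb _ _ 154 @fwd_isEqu.val

def fwd_contrMap.val {m k : El Nt} {C X : TyAt 1} {n s : El X} {μ : El (C ⇾ n ≐ s)} {x₀ : El C}
    (c : El (Contr (HT (S m) C))) {W : El (Wedge k μ x₀)} (h : El (Wedge.Right W)) (a : El C)
    (p : El (n ≐ n)) : El (ContrMap (Lam fun z => fwd W a p z)) :=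
  Conn.contrMap c (x₀ := x₀) (B := n ≐ n) (X := fun p => F k μ x₀ p)
    (Y := fun a p => G k μ (cat p (μ ⦿ a)))
    (fun a p => Lam fun z => fwd W a p z) (fun p => fwd_isEqu h p) a p
def fwd_contrMap := @glb _ _ 155 @fwd_contrMap.val

def fwd_eq.val {m k : El Nt} {C X : TyAt 1} {n s : El X} {μ : El (C ⇾ n ≐ s)} {x₀ : El C}
    (c : El (Contr (HT (S m) C))) {W : El (Wedge k μ x₀)} (h : El (Wedge.Right W)) (a : El C)
    (p : El (n ≐ n)) : El (Sg (Ty.el 1 (F k μ x₀ p) ≐ Ty.el 1 (G k μ (cat p (μ ⦿ a)))) fun e =>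
      coe1 e ≐ Lam fun z => fwd W a p z) :=
  ua1_isEqu (equ_of_contrMap (Lam fun z => fwd W a p z) (fwd_contrMap c h a p))
def fwd_eq := @glb _ _ 156 @fwd_eq.val

def mer.val (C : TyAt 1) : El (C ⇾ north (A := C) ≐ south) := Lam fun a => merid a
def mer := @glb _ _ 157 @mer.val

/-- The family over the paths from the north pole that `f`, `g` and `e` determine. -/
def code.val {C : TyAt 1} (f : El (north (A := C) ≐ north ⇾ Un 1)) (g : El (north (A := C) ≐ south ⇾ Un 1))
    (e : El (Fn C fun a => Fn (north (A := C) ≐ north) fun p => f ⦿ p ≐ g ⦿ cat p (merid a)))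
    (y : El (Sus C)) : El (north (A := C) ≐ y ⇾ Un 1) :=
  Sus.ind (fun y => north (A := C) ≐ y ⇾ Un 1) f g (fun a => dpath (merid a) f g (e ⦿ a)) y
def code := @glb _ _ 158 @code.val

def code_merid.val {C : TyAt 1} (f : El (north (A := C) ≐ north ⇾ Un 1))
    (g : El (north (A := C) ≐ south ⇾ Un 1))
    (e : El (Fn C fun a => Fn (north (A := C) ≐ north) fun p => f ⦿ p ≐ g ⦿ cat p (merid a)))
    (a : El C) : El (dap (fun y => code f g e y) (merid a) ≐ (dpath (merid a) f g (e ⦿ a)).as) :=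
  (Sus.ind_merid (fun y => north (A := C) ≐ y ⇾ Un 1) f g (fun a => dpath (merid a) f g (e ⦿ a)) a).as
def code_merid := @glb _ _ 159 @code_merid.val

/-- Path induction from the code `d` of reflexivity defines a section over all paths from north. By
`J_dpath` and the rule for meridians, its value on `merid a` is `d` transported by the equality `e a
refl`. -/
def encode_code.val {C : TyAt 1} (f : El (north (A := C) ≐ north ⇾ Un 1))
    (g : El (north (A := C) ≐ south ⇾ Un 1))
    (e : El (Fn C fun a => Fn (north (A := C) ≐ north) fun p => f ⦿ p ≐ g ⦿ cat p (merid a)))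
    (d : El (f ⦿ rfl').ty) :
    El (Sg (Fn (north (A := C) ≐ south) fun q => (g ⦿ q).ty) fun s => Fn C fun a =>
      tr (fun q => (g ⦿ q).ty) (rfl_cat (merid a))
        (coe1 (A := (f ⦿ rfl').ty) (B := (g ⦿ cat rfl' (merid a)).ty) (e ⦿ a ⦿ rfl') ⦿ d) ≐
      s ⦿ merid a) :=
  mk (Lam fun q => (J (fun y q => (code f g e y ⦿ q).ty) d.as q).as)
    (Lam fun a => (J_dpath (merid a) (fun y => code f g e y) d.as (e ⦿ a).as
      (code_merid f g e a).as).as)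
def encode_code := @glb _ _ 160 @encode_code.val

/-- The values on the paths between the poles of a section over the paths from a point. -/
abbrev Encode {C X : TyAt 1} {n s : El X} (μ : El (C ⇾ n ≐ s)) (f : El (n ≐ n) → TyAt 1)
    (g : El (n ≐ s) → TyAt 1)
    (e : (a : El C) → (p : El (n ≐ n)) → El (Ty.el 1 (f p) ≐ Ty.el 1 (g (cat p (μ ⦿ a)))))
    (d : El (f rfl')) : TyAt 1 :=
  Sg (Fn (n ≐ s) fun q => g q) fun z => Fn C fun a =>
    tr g (rfl_cat (μ ⦿ a)) (coe1 (e a rfl') ⦿ d) ≐ z ⦿ (μ ⦿ a)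

def encode.val {C : TyAt 1} (f : El (north (A := C) ≐ north) → TyAt 1)
    (g : El (north (A := C) ≐ south) → TyAt 1)
    (e : (a : El C) → (p : El (north (A := C) ≐ north)) →
      El (Ty.el 1 (f p) ≐ Ty.el 1 (g (cat p (mer C ⦿ a)))))
    (d : El (f rfl')) : El (Encode (mer C) f g e d) :=
  (encode_code (Lam fun p => Ty.el 1 (f p)) (Lam fun q => Ty.el 1 (g q))
    (Lam fun a => Lam fun p => (e a p).as) d.as).as
def encode := @glb _ _ 161 @encode.val

/-- The base code is represented by `x₀`, so its image involves the value of `W` on the axis `b =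
x₀`. That value is the class of `a`, and `tr_J_ins` removes the inserted paths. -/
def fwd_base.val {k : El Nt} {C X : TyAt 1} {n s : El X} {μ : El (C ⇾ n ≐ s)} {x₀ : El C}
    {W : El (Wedge k μ x₀)} (h : El (Wedge.Left W)) (a : El C) :
    El (tr (fun q => G k μ q) (rfl_cat (μ ⦿ a)) (fwd W a rfl' (F.in x₀ (cat_sym (μ ⦿ x₀)))) ≐
      G.in a rfl') :=
  cat (ap (fun z => tr (fun q => G k μ q) (rfl_cat (μ ⦿ a)) z)
      (cat (fwd_in W a x₀ (cat_sym (μ ⦿ x₀)))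
        (ap (fun z => J (fun p _ => G k μ (cat p (μ ⦿ a))) z (cat_sym (μ ⦿ x₀))) (h ⦿ a))))
    (tr_J_ins (μ ⦿ x₀) (μ ⦿ a) (fun q => G k μ q) (fun _ r => G.in a r))
def fwd_base := @glb _ _ 162 @fwd_base.val

/-- A section whose value at each `μ a` is the class of `a` is a centre: an arbitrary element of the
code may be taken to be the class of some `a` together with a path from `μ a` to `q`, and this path
can be eliminated. -/
def G_contr.val {k : El Nt} {C X : TyAt 1} {n s : El X} {μ : El (C ⇾ n ≐ s)}
    (z : El (Fn (n ≐ s) fun q => G k μ q)) (h : El (Fn C fun a => z ⦿ (μ ⦿ a) ≐ G.in a rfl'))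
    (q : El (n ≐ s)) : El (Contr (G k μ q)) :=
  mk (z ⦿ q) (Lam fun w => Tr.ind (fun w => z ⦿ q ≐ w)
    (fun w => isTy_paths (isTy_up isTy_Tr) (z ⦿ q) w)
    (fun u => Sg.ind (fun u => z ⦿ q ≐ tr_in u)
      (fun a r => (J (fun q r => z ⦿ q ≐ G.in a r) (h ⦿ a) r).as) u) w)
def G_contr := @glb _ _ 163 @G_contr.val

def encode_merid.val {m k : El Nt} {C X : TyAt 1} {n s : El X} {μ : El (C ⇾ n ≐ s)} {x₀ : El C}
    (c : El (Contr (HT (S m) C))) {W : El (Wedge k μ x₀)} (l : El (Wedge.Left W))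
    (r : El (Wedge.Right W)) (a : El C) {z : El (G k μ (μ ⦿ a))}
    (h : El (tr (fun q => G k μ q) (rfl_cat (μ ⦿ a))
      (coe1 (fst (fwd_eq c r a rfl')) ⦿ F.in x₀ (cat_sym (μ ⦿ x₀))) ≐ z)) : El (z ≐ G.in a rfl') :=
  cat (sym h) (cat (ap (fun f => tr (fun q => G k μ q) (rfl_cat (μ ⦿ a))
    (f ⦿ F.in x₀ (cat_sym (μ ⦿ x₀)))) (snd (fwd_eq c r a rfl'))) (fwd_base l a).as)
def encode_merid := @glb _ _ 164 @encode_merid.val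

/-- At the base point `bwd` is a left inverse of `fwd`, so the code of a loop is a retract of a code
between the poles, which is contractible by `G_contr`. -/
def wedge_contr.val {m k : El Nt} {C X : TyAt 1} {n s : El X} {μ : El (C ⇾ n ≐ s)} {x₀ : El C}
    (c : El (Contr (HT (S m) C))) {W : El (Wedge k μ x₀)} (l : El (Wedge.Left W))
    (r : El (Wedge.Right W))
    (h : El (Encode μ (fun p => F k μ x₀ p) (fun q => G k μ q) (fun a p => fst (fwd_eq c r a p))
      (F.in x₀ (cat_sym (μ ⦿ x₀)))))
    (p : El (n ≐ n)) : El (Contr (F k μ x₀ p)) :=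
  Sg.ind (fun _ => Contr (F k μ x₀ p))
    (fun z h => contr_of (isTy_retract (fun w => fwd W x₀ p w) (fun w => bwd p w)
      (fun w => bwd_fwd r w) (isTyO (G_contr z
        (Lam fun a => encode_merid c l r a (h ⦿ a)) (cat p (μ ⦿ x₀)))))) h
def wedge_contr := @glb _ _ 165 @wedge_contr.val

def loop_wedge.val {m k : El Nt} {C : TyAt 1} {x₀ : El C} (c : El (Contr (HT (S m) C)))
    {W : El (Wedge k (mer C) x₀)} (l : El (Wedge.Left W)) (r : El (Wedge.Right W))
    (p : El (north (A := C) ≐ north)) : El (Contr (F k (mer C) x₀ p)) :=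
  wedge_contr c l r (encode (fun p => F k (mer C) x₀ p) (fun q => G k (mer C) q)
    (fun a p => fst (fwd_eq c r a p)) (F.in x₀ (cat_sym (mer C ⦿ x₀)))) p
def loop_wedge := @glb _ _ 166 @loop_wedge.val

def loop_contr.val {m : El Nt} {C : TyAt 1} (c : El (Contr (HT (S m) C))) (x₀ : El C)
    (p : El (north (A := C) ≐ north)) : El (Contr (F (dbl (S m)) (mer C) x₀ p)) :=
  Sg.ind (fun _ => Contr (F (dbl (S m)) (mer C) x₀ p))
    (fun W h => loop_wedge (W := W) c (fst h) (snd h).as p) (Wedge.exists c (mer C) x₀)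
def loop_contr := @glb _ _ 167 @loop_contr.val

def trunc_zero_contr.val {A : TyAt 1} : El (Contr (Tr O A)) :=
  contr_of isTy_Tr
def trunc_zero_contr := @glb _ _ 168 @trunc_zero_contr.val

/-- Case distinction on `n = m - 1`. The general argument needs `n ≥ 0`, so that `C` is connected.
-/
def loop_contr_any.val {m : El Nt} {C : TyAt 1} (c : El (Contr (Tr (S m) C))) (x₀ : El C)
    (p : El (north (A := C) ≐ north)) : El (Contr (F (dbl m) (mer C) x₀ p)) :=
  Nt.ind (fun m => Contr (Tr (S m) C) ⇾ Contr (F (dbl m) (mer C) x₀ p))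
    -- For `m = 0` the codes are truncated at level `-2`, and the hypothesis on `C` is not called
    -- upon.
    (Lam fun _ => (trunc_zero_contr (A := Sg C fun x => cat (mer C ⦿ x) (sym (mer C ⦿ x₀)) ≐ p)).as)
    (fun m _ => Lam fun c => loop_contr (m := m) c.as x₀ p) m ⦿ c
def loop_contr_any := @glb _ _ 169 @loop_contr_any.val

def freudenthal.val : El ⟨Freudenthal 1⟩ :=
  (Lam fun m : El Nt => Lam fun C : El (Un 1) => Lam fun c : El (Contr (Tr (S m) C.ty)) =>
    Lam fun x₀ : El C.ty => Lam fun p : El (north (A := C.ty) ≐ north) =>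
      loop_contr_any c x₀ p).as

def loopEntries : List Entry := [
    entry @contrMap_of_isEqu.val, entry @ua1_isEqu.val, entry @Conn.contrMap.val,
    entry @fwd_isEqu.val, entry @fwd_contrMap.val, entry @fwd_eq.val, reducible (entry @mer.val),
    reducible (entry @code.val), entry @code_merid.val, entry @encode_code.val,
    entry @encode.val, entry @fwd_base.val, entry @G_contr.val, entry @encode_merid.val,
    entry @wedge_contr.val, entry @loop_wedge.val, entry @loop_contr.val,
    entry @trunc_zero_contr.val, entry @loop_contr_any.val, entry @freudenthal.val]

/-- The environment so far. -/
def loopEnv : List Entry := loopEntries.reverse ++ codeEnv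

set_option maxRecDepth 100000 in
theorem loopEnv_ok : okAll loopEntries codeEnv = true := by decide +kernel
-- The derivation for all universe levels.
open Model in
theorem okChain_env : okChain loopEnv :=
  okChain_of_okAll loopEnv_ok <|
  okChain_of_okAll codeEnv_ok <|
  okChain_of_okAll equivEnv_ok <|
  okChain_of_okAll connEnv_ok <|
  okChain_of_okAll truncEnv_ok <|
  okChain_of_okAll suspEnv_ok <|
  okChain_of_okAll typeEqEnv_ok <|
  okChain_of_okAll weakFunextEnv_ok <|
  okChain_of_okAll funextEnv_ok <|
  okChain_of_okAll contrEnv_ok <|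
  okChain_of_okAll pathEnv_ok (L := []) trivial

open Model in
theorem exists_entry : ∃ e L, okChain (e :: L) ∧ e.type = (Freudenthal 1).close :=
  ⟨entry @freudenthal.val, _, okChain_env, rfl⟩

end Th

end HoTT

end

theorem mainTheorem2 (i : ℕ) : HoTT.IsInhabited (HoTT.Freudenthal i) := by
  obtain ⟨e, L, h, hT⟩ := HoTT.Th.exists_entry
  refine HoTT.isInhabited_of_okChain h i fun M hM => ?_
  rw [hT, HoTT.interp_freudenthal, hM]
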